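/- Let $\mathbb{R}P^2$ be the real projective plane, represented as the closed unit disk in $\mathbb{R}^2$ with antipodal boundary points identified. Fix a homeomorphism $\Phi$ of $\mathbb{R}P^2$ onto itself (for instance the identity), and call a subset of $\mathbb{R}P^2$ piecewise linear if $\Phi$ carries it to a finite union of images of straight segments of the disk. A cycle in $\mathbb{R}P^2$ is a piecewise linear simple closed curve, regarded as a set of points; it is 1-homologous if it does not bound a disk, i.e. if it is not the image of the boundary circle under an injective continuous map from the closed disk to $\mathbb{R}P^2$. Two cycles $C_1,C_2$ cross transversely at a common point $p$ if there is a homeomorphism from an open neighbourhood $U$ of $p$ onto an open subset $V$ of $\mathbb{R}^2$ that maps $p$ to $0$, $C_1\cap U$ onto the part of the $x$-axis in $V$, and $C_2\cap U$ onto the part of the $y$-axis in $V$. Let $C_1\neq C_2$ be two 1-homologous cycles in $\mathbb{R}P^2$ that cross transversely at every common point. Then $C_1\cap C_2$ is finite, and the number of its points (the number of crossings) is odd. -/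

import Mathlib

/-- The closed unit disk in the Euclidean plane. -/
abbrev UnitDisk : Type := Metric.closedBall (0 : EuclideanSpace ℝ (Fin 2)) 1

/-- Antipodal points of the boundary circle of the disk are identified (and nothing else is). -/
def antipodalSetoid : Setoid UnitDisk where
  r x y := x = y ∨ (‖(x : EuclideanSpace ℝ (Fin 2))‖ = 1 ∧
    (y : EuclideanSpace ℝ (Fin 2)) = -(x : EuclideanSpace ℝ (Fin 2)))
  iseqv :=
    { refl := fun _ => Or.inl rfl
      symm := by
        rintro x y (h | ⟨h1, h2⟩)
        · exact Or.inl h.symm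
        · exact Or.inr ⟨by rw [h2, norm_neg, h1], by rw [h2, neg_neg]⟩
      trans := by
        rintro x y z (rfl | ⟨h1, h2⟩) (rfl | ⟨h3, h4⟩)
        · exact Or.inl rfl
        · exact Or.inr ⟨h3, h4⟩
        · exact Or.inr ⟨h1, h2⟩
        · exact Or.inl (Subtype.ext (by rw [h4, h2, neg_neg])) }

/-- The real projective plane: the closed unit disk with antipodal boundary points identified,
with the quotient topology. -/
abbrev RP2 : Type := Quotient antipodalSetoid

/-- The quotient map from the disk to the projective plane. -/
def RP2.mk (z : UnitDisk) : RP2 := Quotient.mk antipodalSetoid z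

/-- The image in the projective plane of the straight segment between two points of the disk. -/
def RP2.segment (a b : UnitDisk) : Set RP2 :=
  RP2.mk '' {z : UnitDisk | (z : EuclideanSpace ℝ (Fin 2)) ∈
    _root_.segment ℝ (a : EuclideanSpace ℝ (Fin 2)) (b : EuclideanSpace ℝ (Fin 2))}

/-- `C` is piecewise linear in the coordinates `Φ`: the homeomorphism `Φ` of the projective plane
onto the disk model carries `C` to a finite union of straight segments of the disk. With `Φ` the
identity these are the polygonal sets of the disk model; a general `Φ` allows every
piecewise linear structure on the projective plane. -/
def IsPiecewiseLinear (Φ : RP2 ≃ₜ RP2) (C : Set RP2) : Prop :=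
  ∃ S : Set (UnitDisk × UnitDisk), S.Finite ∧ Φ '' C = ⋃ s ∈ S, RP2.segment s.1 s.2

/-- A simple closed curve, that is, an embedded circle. -/
def IsSimpleClosedCurve (C : Set RP2) : Prop :=
  ∃ γ : Circle → RP2, Continuous γ ∧ Function.Injective γ ∧ Set.range γ = C

/-- `C` is a cycle embedded piecewise linearly (in the coordinates `Φ`) in the projective plane. -/
def IsCycle (Φ : RP2 ≃ₜ RP2) (C : Set RP2) : Prop :=
  IsSimpleClosedCurve C ∧ IsPiecewiseLinear Φ C

/-- `C` is the boundary circle of an embedded closed disk. -/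
def BoundsDisk (C : Set RP2) : Prop :=
  ∃ f : UnitDisk → RP2, Continuous f ∧ Function.Injective f ∧
    f '' {z : UnitDisk | ‖(z : EuclideanSpace ℝ (Fin 2))‖ = 1} = C

/-- A cycle is 1-homologous (essential) if it does not bound a disk. -/
def IsOneHomologousCycle (Φ : RP2 ≃ₜ RP2) (C : Set RP2) : Prop :=
  IsCycle Φ C ∧ ¬ BoundsDisk C

/-- `C₁` and `C₂` cross transversely at the common point `p`: some local chart around `p` carries
`C₁` to the first coordinate axis and `C₂` to the second one. -/
def CrossTransverselyAt (C₁ C₂ : Set RP2) (p : RP2) : Prop :=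
  ∃ φ : OpenPartialHomeomorph RP2 (EuclideanSpace ℝ (Fin 2)), p ∈ φ.source ∧ φ p = 0 ∧
    ∀ q ∈ φ.source, (q ∈ C₁ ↔ φ q 1 = 0) ∧ (q ∈ C₂ ↔ φ q 0 = 0)

/-- Every common point of `C₁` and `C₂` is a transverse crossing. -/
def IntersectOnlyTransversely (C₁ C₂ : Set RP2) : Prop :=
  ∀ p ∈ C₁ ∩ C₂, CrossTransverselyAt C₁ C₂ p

/-!
The disk model is double covered by the unit sphere of `ℝ × ℝ²`: `RP2.proj` identifies antipodes.
A simple closed curve lifts to a path on the sphere which, after one turn, either closes up or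
arrives at the antipode of its starting point (`IsSimpleClosedCurve.exists_lift`).

If the lift of a piecewise linear curve closes up, the curve bounds a disk
(`boundsDisk_of_periodic_lift`), and this is the only essential use of piecewise linearity. The lift
is then a Jordan curve disjoint from its antipodal image, and so is its union with one of the two
regions it bounds (`IsStereographic.symm_ne_neg_symm`); so the region projects injectively, and it
remains to see that it is a disk. The lift lies in an arrangement of finitely many circles, the
equator and the vertical sections above lines of the disk, which cut the sphere into finitely many
cells. As long as the region meets the arrangement it can be cut by an arc of it
(`IsStereographic.exists_chord_arrangement`), two disks glue to a disk along a boundary arc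
(`IsDiskWithBoundary.union`), and a single cell is a disk by convexity
(`IsStereographic.isDiskWithBoundary_of_cell`); `isDiskWithBoundary_of_chords` is the resulting
induction.

So the lifts of both given curves run from a point to its antipode. The preimage of `C₁` on the
sphere is then a Jordan curve invariant under the antipodal map, and antipodes off it lie on
opposite sides (`IsStereographic.mem_insideOf_neg_iff`). Follow the lift of `C₂` from a point off
this curve to its antipode. By transversality the side changes at each crossing
(`IsStereographic.exists_flip`), and it differs at the two ends, so the number of crossings is finite
and odd (`finite_and_odd_ncard_of_flips`, `odd_ncard_inter`).

The plane topology rests on square roots. A point `z` off a plane set `C` is called inside `C` if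
`x - z` has no continuous square root for `x` in `C` (`insideOf`), that is, if the winding number is
odd. Borsuk's extension argument (`not_exists_log_frontier`) relates this to the topology of the
complement, a sign count yields the parity rules for curves composed of arcs (`hasSqrtOn_theta`),
and on a Jordan curve the product of two functions without square root has one
(`IsJordanCurve.hasSqrtOn_mul`). The Jordan curve theorem in the form needed here, and the fact that
symmetric curves separate antipodes, come down to computing whether `(x - z) / (x - z')` has a
square root.
-/

open Set Topology Filter Bornology

/-! ### Continuous logarithms and square roots -/

/-- The inverse of an injective continuous map on a compact set is continuous on the image. -/
theorem continuousOn_invFunOn_of_isCompact {E Y : Type*} [TopologicalSpace E] [Nonempty E]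
    [TopologicalSpace Y] [T2Space Y] {f : E → Y} {K : Set E} (hK : IsCompact K)
    (hf : ContinuousOn f K) (hi : InjOn f K) : ContinuousOn (Function.invFunOn f K) (f '' K) := by
  rw [continuousOn_iff_isClosed]
  intro t ht
  refine ⟨f '' (K ∩ t), ((hK.inter_right ht).image_of_continuousOn
    (hf.mono inter_subset_left)).isClosed, ?_⟩
  ext y
  constructor
  · rintro ⟨h1, x, hx, rfl⟩
    rw [mem_preimage, hi.leftInvOn_invFunOn hx] at h1
    exact ⟨⟨x, ⟨hx, h1⟩, rfl⟩, x, hx, rfl⟩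
  · rintro ⟨⟨x, hx, rfl⟩, h2⟩
    refine ⟨?_, h2⟩
    rw [mem_preimage, hi.leftInvOn_invFunOn hx.1]
    exact hx.2

/-- A continuous nowhere zero function on a convex set has a continuous logarithm. -/
theorem Convex.exists_continuousOn_log {E : Type*} [NormedAddCommGroup E] [NormedSpace ℝ E]
    {K : Set E} (hK : Convex ℝ K) {φ : E → ℂ} (hφ : ContinuousOn φ K) (h0 : ∀ x ∈ K, φ x ≠ 0) :
    ∃ l : E → ℂ, ContinuousOn l K ∧ ∀ x ∈ K, Complex.exp (l x) = φ x := by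
  classical
  rcases K.eq_empty_or_nonempty with rfl | hne
  · exact ⟨φ, by simp, by simp⟩
  have := hK.contractibleSpace hne
  have := hK.locallyPathConnectedSpace E
  have hs : IsSimplyConnected (univ : Set K) := by
    have e := (Homeomorph.Set.univ K).toHomotopyEquiv
    exact e.simplyConnectedSpace
  obtain ⟨f, hf, hfe⟩ := Complex.exists_continuousOn_eqOn_exp_comp (g := fun x : K => φ x)
    hs isOpen_univ (continuousOn_iff_continuous_domRestrict.mp hφ).continuousOn
    (by rintro ⟨x, -, hx⟩; exact h0 x x.2 hx)
  refine ⟨fun x => if h : x ∈ K then f ⟨x, h⟩ else 0, ?_, fun x hx => ?_⟩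
  · rw [continuousOn_iff_continuous_domRestrict]
    convert! continuousOn_univ.mp hf using 1
    ext x
    simp [Set.domRestrict]
  · simp only [hx, dif_pos]
    exact hfe (mem_univ (⟨x, hx⟩ : K))

/-- A continuous nowhere zero function on an embedded compact convex set has a continuous
logarithm. -/
theorem exists_continuousOn_log_image {E Y : Type*} [NormedAddCommGroup E] [NormedSpace ℝ E]
    [TopologicalSpace Y] [T2Space Y] {K : Set E} (hK : Convex ℝ K) (hKc : IsCompact K) {f : E → Y}
    (hf : ContinuousOn f K) (hi : InjOn f K) {φ : Y → ℂ} (hφ : ContinuousOn φ (f '' K))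
    (h0 : ∀ y ∈ f '' K, φ y ≠ 0) :
    ∃ l : Y → ℂ, ContinuousOn l (f '' K) ∧ ∀ y ∈ f '' K, Complex.exp (l y) = φ y := by
  obtain ⟨l, hl, hle⟩ := hK.exists_continuousOn_log (hφ.comp hf (mapsTo_image f K))
    (fun x hx => h0 _ ⟨x, hx, rfl⟩)
  refine ⟨l ∘ Function.invFunOn f K, hl.comp (continuousOn_invFunOn_of_isCompact hKc hf hi)
    (fun y hy => Function.invFunOn_mem (by simpa using hy)), ?_⟩
  rintro _ ⟨x, hx, rfl⟩
  simp only [Function.comp_apply, hi.leftInvOn_invFunOn hx, hle x hx]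

/-- `φ` has a continuous square root on `K`. -/
def HasSqrtOn {Y : Type*} [TopologicalSpace Y] (φ : Y → ℂ) (K : Set Y) : Prop :=
  ∃ g : Y → ℂ, ContinuousOn g K ∧ ∀ x ∈ K, g x ^ 2 = φ x

section Sqrt
variable {Y : Type*} [TopologicalSpace Y] {φ ψ : Y → ℂ} {K : Set Y}

theorem HasSqrtOn.congr (h : HasSqrtOn φ K) (hs : ∀ x ∈ K, ψ x = φ x) : HasSqrtOn ψ K :=
  let ⟨g, hg, hg2⟩ := h
  ⟨g, hg, fun x hx => (hg2 x hx).trans (hs x hx).symm⟩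

theorem HasSqrtOn.mul (h : HasSqrtOn φ K) (h' : HasSqrtOn ψ K) :
    HasSqrtOn (fun x => φ x * ψ x) K :=
  let ⟨g, hg, hg2⟩ := h
  let ⟨g', hg', hg2'⟩ := h'
  ⟨fun x => g x * g' x, hg.mul hg', fun x hx => by simp only [mul_pow, hg2 x hx, hg2' x hx]⟩

theorem HasSqrtOn.of_exp {l : Y → ℂ} (hl : ContinuousOn l K)
    (h : ∀ x ∈ K, Complex.exp (l x) = φ x) : HasSqrtOn φ K :=
  ⟨fun x => Complex.exp (l x / 2), (hl.div_const 2).cexp, fun x hx => by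
    rw [← Complex.exp_nat_mul, ← h x hx]; congr 1; push_cast; ring⟩

theorem HasSqrtOn.of_slitPlane (hφ : ContinuousOn φ K) (h : ∀ x ∈ K, φ x ∈ Complex.slitPlane) :
    HasSqrtOn φ K :=
  .of_exp (hφ.clog h) fun x hx => Complex.exp_log (Complex.slitPlane_ne_zero (h x hx))

theorem HasSqrtOn.inv (h : HasSqrtOn φ K) (h0 : ∀ x ∈ K, φ x ≠ 0) :
    HasSqrtOn (fun x => (φ x)⁻¹) K :=
  let ⟨g, hg, hg2⟩ := h
  ⟨fun x => (g x)⁻¹, hg.inv₀ fun x hx hx0 => h0 x hx (by rw [← hg2 x hx, hx0]; simp),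
    fun x hx => by simp only [inv_pow, hg2 x hx]⟩

theorem HasSqrtOn.const (c : ℂ) : HasSqrtOn (fun _ : Y => c) K := by
  obtain ⟨d, hd⟩ := IsAlgClosed.exists_pow_nat_eq c two_pos
  exact ⟨fun _ => d, continuousOn_const, fun _ _ => hd⟩

end Sqrt

/-- On a circle around `z₀`, continuing a square root of `x - z₀` once around changes its sign. -/
theorem not_hasSqrtOn_sphere (z₀ : ℂ) {R : ℝ} (hR : 0 < R) :
    ¬ HasSqrtOn (fun x => x - z₀) (Metric.sphere z₀ R) := by
  rintro ⟨g, hg, hg2⟩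
  set e : ℝ → ℂ := fun t => z₀ + R * Complex.exp (t * Complex.I) with he
  have hec : Continuous e := by fun_prop
  have hmem : ∀ t, e t ∈ Metric.sphere z₀ R := fun t => by
    simp [he, Complex.norm_exp_ofReal_mul_I, abs_of_pos hR]
  set r : ℝ → ℂ := fun t => (Real.sqrt R : ℂ) * Complex.exp (t / 2 * Complex.I) with hr
  have hrc : Continuous r := by fun_prop
  have hsq : EqOn ((g ∘ e) ^ 2) (r ^ 2) univ := fun t _ => by
    rw [Pi.pow_apply, Pi.pow_apply, Function.comp_apply, hg2 _ (hmem t)]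
    simp only [hr, he, mul_pow, ← Complex.exp_nat_mul, ← Complex.ofReal_pow, Real.sq_sqrt hR.le]
    rw [add_sub_cancel_left]
    congr 2
    push_cast; ring
  have h2π : e (2 * Real.pi) = e 0 := by simp [he]
  have hr2 : r (2 * Real.pi) = - r 0 := by
    simp [hr]
  have hr0 : r 0 ≠ 0 := by simp [hr, (Real.sqrt_pos.mpr hR).ne']
  rcases isPreconnected_univ.eq_or_eq_neg_of_sq_eq
      ((hg.comp hec.continuousOn fun t _ => hmem t)) hrc.continuousOn hsq
      (fun {t} _ => by simp [hr, (Real.sqrt_pos.mpr hR).ne']) with h | h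
  · have h1 := h (mem_univ (2 * Real.pi))
    have h0 := h (mem_univ 0)
    simp only [Function.comp_apply, h2π, hr2] at h1 h0
    exact hr0 (self_eq_neg.mp (h0.symm.trans h1))
  · have h1 := h (mem_univ (2 * Real.pi))
    have h0 := h (mem_univ 0)
    simp only [Function.comp_apply, h2π, hr2, Pi.neg_apply, neg_neg] at h1 h0
    exact hr0 (neg_eq_self.mp (h0.symm.trans h1))

/-- Borsuk's separation argument: if `z₀` lies in the closure of a bounded set, then a logarithm of
`x - z₀` on the frontier would extend over the set by Tietze's theorem, and the extension would give
a square root of `x - z₀` on a large circle. -/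
theorem not_exists_log_frontier {U : Set ℂ} (hb : IsBounded U) {z₀ : ℂ}
    (hz : z₀ ∈ closure U) (l : ℂ → ℂ) (hl : ContinuousOn l (frontier U))
    (hexp : ∀ x ∈ frontier U, Complex.exp (l x) = x - z₀) : False := by
  classical
  obtain ⟨L, hL⟩ := ContinuousMap.exists_restrict_eq (s := frontier U) isClosed_frontier
    ⟨_, continuousOn_iff_continuous_domRestrict.mp hl⟩
  have hL' : ∀ x ∈ frontier U, L x = l x := fun x hx => congr($hL ⟨x, hx⟩)
  have hH : Continuous ((closure U).piecewise (fun x => Complex.exp (L x)) fun x => x - z₀) := by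
    refine Continuous.piecewise (fun x hx => ?_) (by fun_prop) (by fun_prop)
    have hx' := frontier_closure_subset hx
    rw [hL' x hx', hexp x hx']
  obtain ⟨M, hM, hMe⟩ := (convex_univ (𝕜 := ℝ) (E := ℂ)).exists_continuousOn_log hH.continuousOn
    fun x _ => by
      by_cases hx : x ∈ closure U
      · simp [hx]
      · simp only [piecewise_eq_of_notMem _ _ _ hx]
        rintro h
        exact hx (by rwa [sub_eq_zero.mp h])
  obtain ⟨R, hR0, hR⟩ := hb.closure.subset_ball_lt 0 z₀
  refine not_hasSqrtOn_sphere z₀ hR0 (.of_exp (hM.mono (subset_univ _)) fun x hx => ?_)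
  rw [hMe x (mem_univ _), piecewise_eq_of_notMem]
  exact fun h => absurd (hR h) (by simp [Metric.mem_sphere.mp hx])

/-! ### Arcs and Jordan curves -/

/-- `A` is an arc from `a` to `b`: the image of an injective path, parametrized by `[0, 1]`. -/
def IsArc {X : Type*} [TopologicalSpace X] (A : Set X) (a b : X) : Prop :=
  ∃ α : ℝ → X, ContinuousOn α (Icc 0 1) ∧ InjOn α (Icc 0 1) ∧ α '' Icc 0 1 = A ∧ α 0 = a ∧ α 1 = b

/-- A Jordan curve: an embedded circle. -/
def IsJordanCurve {X : Type*} [TopologicalSpace X] (C : Set X) : Prop :=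
  ∃ γ : Circle → X, Continuous γ ∧ Function.Injective γ ∧ range γ = C

section Arc
variable {X : Type*} [TopologicalSpace X] {A B : Set X} {a b : X}

theorem IsArc.of_Icc {α : ℝ → X} {s t : ℝ} (hst : s < t) (hc : ContinuousOn α (Icc s t))
    (hi : InjOn α (Icc s t)) : IsArc (α '' Icc s t) (α s) (α t) := by
  have hpos : 0 < t - s := sub_pos.mpr hst
  have himg : (fun x => (t - s) * x + s) '' Icc 0 1 = Icc s t := by
    rw [image_affine_Icc' hpos]; congr 1 <;> ring
  have hm : MapsTo (fun x => (t - s) * x + s) (Icc 0 1) (Icc s t) := mapsTo_iff_image_subset.mpr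
    himg.subset
  refine ⟨fun x => α ((t - s) * x + s), hc.comp (by fun_prop) hm, ?_, ?_, by simp, by simp⟩
  · intro x hx y hy hxy
    have := hi (hm hx) (hm hy) hxy
    simpa [hpos.ne'] using this
  · rw [← himg, image_image]

theorem IsArc.symm (h : IsArc A a b) : IsArc A b a := by
  obtain ⟨α, hc, hi, rfl, rfl, rfl⟩ := h
  have hm : MapsTo (fun x : ℝ => 1 - x) (Icc 0 1) (Icc 0 1) := fun x hx => by
    simp only [mem_Icc] at hx ⊢; constructor <;> linarith [hx.1, hx.2]
  refine ⟨fun x => α (1 - x), hc.comp (by fun_prop) hm, fun x hx y hy hxy => ?_, ?_, by simp,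
    by simp⟩
  · have := hi (hm hx) (hm hy) hxy
    linarith
  · rw [← image_image α (fun x : ℝ => 1 - x)]; simp

theorem IsArc.left_mem (h : IsArc A a b) : a ∈ A := by
  obtain ⟨α, hc, hi, rfl, rfl, rfl⟩ := h
  exact ⟨0, by simp, rfl⟩

theorem IsArc.right_mem (h : IsArc A a b) : b ∈ A := h.symm.left_mem

theorem IsArc.ne (h : IsArc A a b) : a ≠ b := by
  obtain ⟨α, hc, hi, rfl, rfl, rfl⟩ := h
  intro h
  exact zero_ne_one (hi (by simp) (by simp) h)

theorem IsArc.isCompact (h : IsArc A a b) : IsCompact A := by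
  obtain ⟨α, hc, hi, rfl, rfl, rfl⟩ := h
  exact isCompact_Icc.image_of_continuousOn hc

theorem IsArc.isPreconnected (h : IsArc A a b) : IsPreconnected A := by
  obtain ⟨α, hc, hi, rfl, rfl, rfl⟩ := h
  exact isPreconnected_Icc.image _ hc

theorem IsArc.exists_interior (h : IsArc A a b) : ∃ α : ℝ → X, ContinuousOn α (Icc 0 1) ∧
    α '' Ioo 0 1 = A \ {a, b} ∧ α 0 = a ∧ α 1 = b := by
  obtain ⟨α, hc, hi, rfl, rfl, rfl⟩ := h
  refine ⟨α, hc, ?_, rfl, rfl⟩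
  have : Ioo (0 : ℝ) 1 = Icc 0 1 \ {0, 1} := by
    ext x; simp only [mem_Ioo, mem_Icc, Set.mem_sdiff, mem_insert_iff, mem_singleton_iff, not_or]
    constructor
    · rintro ⟨h1, h2⟩; exact ⟨⟨h1.le, h2.le⟩, h1.ne', h2.ne⟩
    · rintro ⟨⟨h1, h2⟩, h3, h4⟩; exact ⟨lt_of_le_of_ne h1 (Ne.symm h3), lt_of_le_of_ne h2 h4⟩
  rw [this, hi.image_sdiff_subset (by rintro x (rfl | rfl) <;> simp), image_pair]

theorem IsArc.isPreconnected_interior (h : IsArc A a b) : IsPreconnected (A \ {a, b}) := by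
  obtain ⟨α, hc, hα, -⟩ := h.exists_interior
  rw [← hα]
  exact isPreconnected_Ioo.image _ (hc.mono Ioo_subset_Icc_self)

theorem IsArc.nonempty_interior (h : IsArc A a b) : (A \ {a, b}).Nonempty := by
  obtain ⟨α, hc, hα, -⟩ := h.exists_interior
  rw [← hα]
  exact ⟨_, 1 / 2, by norm_num, rfl⟩

theorem IsArc.subset_closure_interior (h : IsArc A a b) : A ⊆ closure (A \ {a, b}) := by
  obtain ⟨α, hc, hα, h0, h1⟩ := h.exists_interior
  have := (hc.mono (closure_Ioo (zero_ne_one' ℝ)).subset).image_closure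
  rw [closure_Ioo zero_ne_one, hα] at this
  intro x hx
  by_cases hxa : x = a
  · exact this ⟨0, by simp, h0.trans hxa.symm⟩
  by_cases hxb : x = b
  · exact this ⟨1, by simp, h1.trans hxb.symm⟩
  exact subset_closure ⟨hx, by simp [hxa, hxb]⟩

theorem IsArc.image {Y : Type*} [TopologicalSpace Y] {f : X → Y} (h : IsArc A a b)
    (hf : ContinuousOn f A) (hi : InjOn f A) : IsArc (f '' A) (f a) (f b) := by
  obtain ⟨α, hc, hi', rfl, rfl, rfl⟩ := h
  exact ⟨f ∘ α, hf.comp hc (mapsTo_image _ _), hi.comp hi' (mapsTo_image _ _), image_comp _ _ _,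
    rfl, rfl⟩

theorem IsArc.exists_log [T2Space X] (h : IsArc A a b) {φ : X → ℂ} (hφ : ContinuousOn φ A)
    (h0 : ∀ x ∈ A, φ x ≠ 0) : ∃ l : X → ℂ, ContinuousOn l A ∧ ∀ x ∈ A, Complex.exp (l x) = φ x := by
  obtain ⟨α, hc, hi, rfl, rfl, rfl⟩ := h
  exact exists_continuousOn_log_image (convex_Icc 0 1) isCompact_Icc hc hi hφ h0

theorem IsArc.hasSqrtOn [T2Space X] (h : IsArc A a b) {φ : X → ℂ} (hφ : ContinuousOn φ A)
    (h0 : ∀ x ∈ A, φ x ≠ 0) : HasSqrtOn φ A :=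
  let ⟨_, hl, hle⟩ := h.exists_log hφ h0
  .of_exp hl hle

/-- Two arcs with common end points and disjoint interiors form a Jordan curve. The circle is
parametrized over its horizontal diameter. -/
theorem IsJordanCurve.of_arcs (hA : IsArc A a b) (hB : IsArc B a b) (hAB : A ∩ B ⊆ {a, b}) :
    IsJordanCurve (A ∪ B) := by
  have hne := hA.ne
  obtain ⟨α, hα, hαi, rfl, rfl, rfl⟩ := hA
  obtain ⟨β, hβ, hβi, rfl, hβ0, hβ1⟩ := hB
  set s : Circle → ℝ := fun z => (1 - (z : ℂ).re) / 2 with hs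
  have hsc : Continuous s := by fun_prop
  have hsq : ∀ z : Circle, (z : ℂ).re ^ 2 + (z : ℂ).im ^ 2 = 1 := fun z => by
    have := Circle.normSq_coe z
    rw [Complex.normSq_apply] at this; linarith
  have hsm : ∀ z, s z ∈ Icc (0 : ℝ) 1 := fun z => by
    simp only [hs, mem_Icc]; constructor <;> nlinarith [hsq z, sq_nonneg (z : ℂ).im]
  have hs0 : ∀ z : Circle, (z : ℂ).im = 0 → s z = 0 ∨ s z = 1 := fun z hz => by
    have := hsq z
    rw [hz] at this
    have h2 : ((z : ℂ).re - 1) * ((z : ℂ).re + 1) = 0 := by linarith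
    rcases mul_eq_zero.mp h2 with h | h
    · left; simp only [hs]; linarith
    · right; simp only [hs]; linarith
  have hext : ∀ z w : Circle, s z = s w → (0 ≤ (z : ℂ).im ↔ 0 ≤ (w : ℂ).im) → z = w := by
    intro z w h1 h2
    have hre : (z : ℂ).re = (w : ℂ).re := by simp only [hs] at h1; linarith
    have him : (z : ℂ).im ^ 2 = (w : ℂ).im ^ 2 := by
      have := hsq z; have := hsq w; rw [hre] at *; linarith
    refine Circle.ext (Complex.ext hre ?_)
    rcases sq_eq_sq_iff_eq_or_eq_neg.mp him with h | h
    · exact h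
    · by_cases hz : 0 ≤ (z : ℂ).im
      · have := h2.mp hz; linarith
      · have := mt h2.mpr hz; push Not at this hz; linarith
  have hpt : ∀ x ∈ Icc (0 : ℝ) 1, (1 - 2 * x) ^ 2 + (2 * √(x * (1 - x))) ^ 2 = 1 := by
    intro x hx
    rw [mul_pow, Real.sq_sqrt (mul_nonneg hx.1 (by linarith [hx.2]))]; ring
  have hmk : ∀ x ∈ Icc (0 : ℝ) 1, ∀ ε : ℝ, ε ^ 2 = 1 →
      ∃ z : Circle, s z = x ∧ (z : ℂ).im = ε * (2 * √(x * (1 - x))) := by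
    intro x hx ε hε
    refine ⟨⟨⟨1 - 2 * x, ε * (2 * √(x * (1 - x)))⟩,
      mem_sphere_zero_iff_norm.mpr ?_⟩, ?_, rfl⟩
    · rw [← sq_eq_sq₀ (norm_nonneg _) zero_le_one, ← Complex.normSq_eq_norm_sq,
        Complex.normSq_apply]
      have := hpt x hx
      nlinarith
    · simp only [hs]; ring
  refine ⟨fun z => if 0 ≤ (z : ℂ).im then α (s z) else β (s z), ?_, ?_, ?_⟩
  · refine Continuous.if_le (hα.comp_continuous hsc hsm) (hβ.comp_continuous hsc hsm)
      continuous_const (by fun_prop) fun z hz => ?_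
    rcases hs0 z hz.symm with h | h <;> simp [h, hβ0, hβ1]
  · have key : ∀ z w : Circle, 0 ≤ (z : ℂ).im → ¬ 0 ≤ (w : ℂ).im → α (s z) ≠ β (s w) := by
      intro z w hz hw h
      have hw' : s w = 0 ∨ s w = 1 := by
        have : α (s z) ∈ ({α 0, α 1} : Set X) := hAB ⟨⟨_, hsm z, rfl⟩, h ▸ ⟨_, hsm w, rfl⟩⟩
        rcases this with h' | h'
        · left; exact hβi (hsm w) (by simp) (by rw [← h, h', hβ0])
        · right; exact hβi (hsm w) (by simp) (by rw [← h, h', hβ1])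
      apply hw
      have := hsq w
      have : (w : ℂ).im ^ 2 = 0 := by
        rcases hw' with h | h <;> simp only [hs] at h
        · have : (w : ℂ).re = 1 := by linarith
          nlinarith
        · have : (w : ℂ).re = -1 := by linarith
          nlinarith
      rw [pow_eq_zero_iff two_ne_zero] at this
      exact this.ge
    intro z w h
    by_cases hz : 0 ≤ (z : ℂ).im <;> by_cases hw : 0 ≤ (w : ℂ).im <;>
      simp only [hz, hw, if_true, if_false] at h
    · exact hext z w (hαi (hsm z) (hsm w) h) (by simp [hz, hw])
    · exact absurd h (key z w hz hw)
    · exact absurd h.symm (key w z hw hz)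
    · exact hext z w (hβi (hsm z) (hsm w) h) (by simp [hz, hw])
  · apply subset_antisymm
    · rintro _ ⟨z, rfl⟩
      dsimp only
      split_ifs
      · exact Or.inl ⟨_, hsm z, rfl⟩
      · exact Or.inr ⟨_, hsm z, rfl⟩
    · rintro _ (⟨x, hx, rfl⟩ | ⟨x, hx, rfl⟩)
      · obtain ⟨z, hz, hz'⟩ := hmk x hx 1 (by norm_num)
        refine ⟨z, ?_⟩
        dsimp only
        rw [if_pos (by rw [hz']; positivity), hz]
      · obtain ⟨z, hz, hz'⟩ := hmk x hx (-1) (by norm_num)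
        refine ⟨z, ?_⟩
        dsimp only
        by_cases h0 : 0 ≤ (z : ℂ).im
        · have : √(x * (1 - x)) = 0 := by
            have := Real.sqrt_nonneg (x * (1 - x)); linarith
          have := hs0 z (by rw [hz', this]; ring)
          rw [if_pos h0, ← hz]
          rcases this with h | h <;> simp [h, hβ0, hβ1]
        · rw [if_neg h0, hz]

end Arc

theorem Circle.exp_injOn_of_sub_lt {s t : ℝ} (h : Circle.exp s = Circle.exp t)
    (hst : |s - t| < 2 * Real.pi) : s = t := by
  obtain ⟨m, hm⟩ := Circle.exp_eq_exp.mp h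
  have hπ := Real.pi_pos
  rw [hm, add_sub_cancel_left, abs_mul, abs_of_pos Real.two_pi_pos] at hst
  have hm1 : |(m : ℝ)| < 1 := by
    by_contra hcon; push Not at hcon; nlinarith
  have : m = 0 := by
    have : |m| < 1 := by exact_mod_cast hm1
    exact Int.abs_lt_one_iff.mp this
  simpa [this] using hm

theorem Circle.exists_exp_eq (z : Circle) : ∃ t ∈ Ico 0 (2 * Real.pi), Circle.exp t = z := by
  have hπ := Real.pi_pos
  rcases lt_or_ge (Complex.arg z) 0 with h | h
  · refine ⟨Complex.arg z + 2 * Real.pi, ⟨?_, by linarith⟩, ?_⟩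
    · linarith [Complex.neg_pi_lt_arg (z : ℂ)]
    · rw [Circle.exp_add, Circle.exp_two_pi, mul_one, Circle.exp_arg]
  · exact ⟨Complex.arg z, ⟨h, by linarith [Complex.arg_le_pi (z : ℂ)]⟩, Circle.exp_arg z⟩

section Jordan
variable {X : Type*} [TopologicalSpace X] {C : Set X} {a b : X}

/-- A Jordan curve, traversed from a given point. The parametrization lives on the whole line and is
injective on every half-open interval of length `2π`. -/
theorem IsJordanCurve.exists_param (hC : IsJordanCurve C) (ha : a ∈ C) :
    ∃ f : ℝ → X, Continuous f ∧ f 0 = a ∧ f (2 * Real.pi) = a ∧ f '' Ico 0 (2 * Real.pi) = C ∧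
      (∀ s t, f s = f t → |s - t| < 2 * Real.pi → s = t) := by
  obtain ⟨γ, hγ, hi, rfl⟩ := hC
  obtain ⟨u, rfl⟩ := ha
  refine ⟨fun t => γ (u * Circle.exp t), by fun_prop, by simp, by simp, ?_, fun s t h hst => ?_⟩
  · apply subset_antisymm
    · rintro _ ⟨t, -, rfl⟩; exact ⟨_, rfl⟩
    · rintro _ ⟨z, rfl⟩
      obtain ⟨t, ht, hz⟩ := Circle.exists_exp_eq (u⁻¹ * z)
      exact ⟨t, ht, by simp [hz]⟩
  · exact Circle.exp_injOn_of_sub_lt (mul_left_cancel (hi h)) hst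

/-- Two points split a Jordan curve into two arcs. -/
theorem IsJordanCurve.exists_arcs (hC : IsJordanCurve C) (ha : a ∈ C) (hb : b ∈ C) (hab : a ≠ b) :
    ∃ A B, IsArc A a b ∧ IsArc B a b ∧ A ∪ B = C ∧ A ∩ B = {a, b} := by
  obtain ⟨f, hf, h0, h2, hC', hi⟩ := hC.exists_param ha
  obtain ⟨t, ht, rfl⟩ : b ∈ f '' Ico 0 (2 * Real.pi) := hC' ▸ hb
  have ht0 : 0 < t := lt_of_le_of_ne ht.1 (by rintro rfl; exact hab h0.symm)
  have hA := IsArc.of_Icc (α := f) ht0 hf.continuousOn fun x hx y hy hxy => hi _ _ hxy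
    (by rw [abs_lt]; constructor <;> linarith [hx.1, hx.2, hy.1, hy.2, ht.2])
  have hB := IsArc.of_Icc (α := f) ht.2 hf.continuousOn fun x hx y hy hxy => hi _ _ hxy
    (by rw [abs_lt]; constructor <;> linarith [hx.1, hx.2, hy.1, hy.2, ht.2])
  rw [h0] at hA
  rw [h2] at hB
  refine ⟨_, _, hA, hB.symm, ?_, ?_⟩
  · rw [← image_union, Icc_union_Icc_eq_Icc ht.1 ht.2.le, ← hC']
    refine subset_antisymm ?_ (image_mono Ico_subset_Icc_self)
    rintro _ ⟨x, hx, rfl⟩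
    rcases eq_or_lt_of_le hx.2 with h | h
    · exact ⟨0, ⟨le_rfl, Real.two_pi_pos⟩, by rw [h, h0, h2]⟩
    · exact ⟨x, ⟨hx.1, h⟩, rfl⟩
  · apply subset_antisymm
    · rintro x ⟨⟨s, hs, rfl⟩, ⟨r, hr, hrs⟩⟩
      by_cases hsr : |r - s| < 2 * Real.pi
      · have := hi r s hrs hsr
        have : s = t := le_antisymm hs.2 (this ▸ hr.1)
        rw [this]; simp
      · have : r - s ≤ 2 * Real.pi := by linarith [hs.1, hr.2]
        have h3 : 0 ≤ r - s := by linarith [hs.2, hr.1]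
        rw [abs_of_nonneg h3] at hsr
        have : s = 0 := by linarith [hs.1, hr.2]
        rw [this, h0]; simp
    · rintro x (rfl | rfl)
      · exact ⟨hA.left_mem, hB.right_mem⟩
      · exact ⟨hA.right_mem, hB.left_mem⟩

/-- A proper closed subset of a Jordan curve is contained in an arc of the curve. -/
theorem IsJordanCurve.exists_arc_superset (hC : IsJordanCurve C) {K : Set X} (hK : IsClosed K)
    (hKC : K ⊆ C) {p : X} (hp : p ∈ C) (hpK : p ∉ K) : ∃ A a b, IsArc A a b ∧ K ⊆ A ∧ A ⊆ C := by
  obtain ⟨f, hf, h0, h2, hC', hi⟩ := hC.exists_param hp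
  have hπ := Real.pi_pos
  have hU : IsOpen (f ⁻¹' Kᶜ) := hK.isOpen_compl.preimage hf
  obtain ⟨ε, hε, h0'⟩ := Metric.isOpen_iff.mp hU 0 (by simpa [h0] using hpK)
  obtain ⟨δ, hδ, h2'⟩ := Metric.isOpen_iff.mp hU (2 * Real.pi) (by simpa [h2] using hpK)
  set ε' := min (ε / 2) 1
  set δ' := min (δ / 2) 1
  have hε' : 0 < ε' := by positivity
  have hδ' : 0 < δ' := by positivity
  have h1 : ε' ≤ 1 := min_le_right _ _
  have h1' : δ' ≤ 1 := min_le_right _ _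
  have hlt : ε' < 2 * Real.pi - δ' := by linarith [Real.pi_gt_three]
  refine ⟨_, _, _, IsArc.of_Icc (α := f) hlt hf.continuousOn fun x hx y hy hxy => hi _ _ hxy
    (by rw [abs_lt]; constructor <;> linarith [hx.1, hx.2, hy.1, hy.2]), fun x hx => ?_, ?_⟩
  · obtain ⟨t, ht, rfl⟩ : x ∈ f '' Ico 0 (2 * Real.pi) := hC' ▸ hKC hx
    refine ⟨t, ⟨?_, ?_⟩, rfl⟩
    · by_contra hcon
      refine h0' (a := t) ?_ hx
      rw [Metric.mem_ball, Real.dist_eq, sub_zero, abs_of_nonneg ht.1]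
      linarith [min_le_left (ε / 2) 1]
    · by_contra hcon
      refine h2' (a := t) ?_ hx
      rw [Metric.mem_ball, Real.dist_eq, abs_sub_comm, abs_of_nonneg (by linarith [ht.2])]
      linarith [min_le_left (δ / 2) 1]
  · rw [← hC']
    refine image_mono fun x hx => ⟨by linarith [hx.1], by linarith [hx.2]⟩

theorem IsJordanCurve.image {Y : Type*} [TopologicalSpace Y] {f : X → Y} (h : IsJordanCurve C)
    (hf : ContinuousOn f C) (hi : InjOn f C) : IsJordanCurve (f '' C) := by
  obtain ⟨γ, hc, hi', rfl⟩ := h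
  refine ⟨f ∘ γ, hf.comp_continuous hc fun x => ⟨x, rfl⟩, fun x y hxy => ?_, range_comp _ _⟩
  exact hi' (hi ⟨x, rfl⟩ ⟨y, rfl⟩ hxy)

theorem IsJordanCurve.isCompact (h : IsJordanCurve C) : IsCompact C := by
  obtain ⟨γ, hc, hi', rfl⟩ := h
  exact isCompact_range hc

theorem IsJordanCurve.nontrivial (h : IsJordanCurve C) : C.Nontrivial := by
  obtain ⟨γ, hc, hi', rfl⟩ := h
  refine ⟨γ 1, ⟨1, rfl⟩, γ (Circle.exp 1), ⟨_, rfl⟩, fun h => ?_⟩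
  have h1 : Circle.exp 0 = Circle.exp 1 := by simpa using hi' h
  have := Circle.exp_injOn_of_sub_lt h1 (by norm_num; linarith [Real.pi_gt_three])
  norm_num at this

end Jordan

/-! ### Inside and outside of a plane set -/

/-- The points off `C` around which `C` winds an odd number of times: `x - z` has no continuous
square root on `C`. For a Jordan curve this is the bounded complementary component. -/
def insideOf (C : Set ℂ) : Set ℂ := {z | z ∉ C ∧ ¬ HasSqrtOn (fun x => x - z) C}

/-- The points off `C` around which `C` winds an even number of times. -/
def outsideOf (C : Set ℂ) : Set ℂ := {z | z ∉ C ∧ HasSqrtOn (fun x => x - z) C}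

theorem mem_insideOf_or {C : Set ℂ} {z : ℂ} (hz : z ∉ C) : z ∈ insideOf C ∨ z ∈ outsideOf C := by
  by_cases h : HasSqrtOn (fun x => x - z) C
  · exact Or.inr ⟨hz, h⟩
  · exact Or.inl ⟨hz, h⟩

theorem disjoint_insideOf_outsideOf (C : Set ℂ) : Disjoint (insideOf C) (outsideOf C) :=
  disjoint_left.mpr fun _ h h' => h.2 h'.2

theorem HasSqrtOn.sub_of_close {C : Set ℂ} {z w : ℂ} (h : HasSqrtOn (fun x => x - z) C)
    (hzw : ∀ x ∈ C, ‖z - w‖ < ‖x - z‖) : HasSqrtOn (fun x => x - w) C := by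
  have h0 : ∀ x ∈ C, x - z ≠ 0 := fun x hx h0 => by
    have := hzw x hx
    rw [h0, norm_zero] at this
    exact absurd this (norm_nonneg _).not_gt
  refine (h.mul (HasSqrtOn.of_slitPlane (φ := fun x => 1 + (z - w) / (x - z)) ?_ fun x hx =>
    ?_)).congr fun x hx => ?_
  · exact continuousOn_const.add (continuousOn_const.div (by fun_prop) h0)
  · have : ‖(z - w) / (x - z)‖ < 1 := by
      rw [norm_div, div_lt_one (norm_pos_iff.mpr (h0 x hx))]; exact hzw x hx
    exact Complex.mem_slitPlane_of_norm_lt_one this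
  · have := h0 x hx
    field_simp
    ring

theorem eventually_hasSqrtOn_sub_iff {C : Set ℂ} (hC : IsCompact C) {z : ℂ} (hz : z ∉ C) :
    ∀ᶠ w in 𝓝 z, w ∉ C ∧ (HasSqrtOn (fun x => x - w) C ↔ HasSqrtOn (fun x => x - z) C) := by
  obtain ⟨ε, hε, hb⟩ := Metric.isOpen_iff.mp hC.isClosed.isOpen_compl z hz
  have hd : ∀ x ∈ C, ε ≤ ‖x - z‖ := fun x hx => by
    by_contra h
    exact hb (by rwa [Metric.mem_ball, dist_eq_norm, ← not_le]) hx
  filter_upwards [Metric.ball_mem_nhds z (half_pos hε)] with w hw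
  rw [Metric.mem_ball, dist_eq_norm] at hw
  refine ⟨hb (by rw [Metric.mem_ball, dist_eq_norm]; linarith), fun h => ?_, fun h => ?_⟩
  · refine h.sub_of_close fun x hx => ?_
    have h1 := hd x hx
    have h2 : ‖x - z‖ ≤ ‖x - w‖ + ‖w - z‖ := norm_sub_le_norm_sub_add_norm_sub x w z
    linarith
  · refine h.sub_of_close fun x hx => ?_
    rw [norm_sub_rev]
    linarith [hd x hx]

theorem isOpen_insideOf {C : Set ℂ} (hC : IsCompact C) : IsOpen (insideOf C) :=
  isOpen_iff_mem_nhds.mpr fun _ hz => (eventually_hasSqrtOn_sub_iff hC hz.1).mono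
    fun _ hw => ⟨hw.1, fun h => hz.2 (hw.2.mp h)⟩

theorem isOpen_outsideOf {C : Set ℂ} (hC : IsCompact C) : IsOpen (outsideOf C) :=
  isOpen_iff_mem_nhds.mpr fun _ hz => (eventually_hasSqrtOn_sub_iff hC hz.1).mono
    fun _ hw => ⟨hw.1, hw.2.mpr hz.2⟩

theorem closure_insideOf_subset {C : Set ℂ} (hC : IsCompact C) :
    closure (insideOf C) ⊆ insideOf C ∪ C := by
  intro x hx
  by_contra h
  rw [mem_union, not_or] at h
  exact ((disjoint_insideOf_outsideOf C).closure_left (isOpen_outsideOf hC)).le_bot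
    ⟨hx, (mem_insideOf_or h.2).resolve_left h.1⟩

theorem closure_outsideOf_subset {C : Set ℂ} (hC : IsCompact C) :
    closure (outsideOf C) ⊆ outsideOf C ∪ C := by
  intro x hx
  by_contra h
  rw [mem_union, not_or] at h
  exact ((disjoint_insideOf_outsideOf C).symm.closure_left (isOpen_insideOf hC)).le_bot
    ⟨hx, (mem_insideOf_or h.2).resolve_right h.1⟩

theorem hasSqrtOn_sub_of_subset_ball {C : Set ℂ} {R : ℝ} (hCR : C ⊆ Metric.ball 0 R) {z : ℂ}
    (hz : R ≤ ‖z‖) : HasSqrtOn (fun x => x - z) C := by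
  rcases C.eq_empty_or_nonempty with rfl | ⟨x₀, hx₀⟩
  · exact ⟨0, by simp, by simp⟩
  have hR : 0 < R := by
    have := hCR hx₀
    rw [mem_ball_zero_iff] at this
    exact (norm_nonneg _).trans_lt this
  have hz0 : z ≠ 0 := norm_pos_iff.mp (hR.trans_le hz)
  refine ((HasSqrtOn.const (-z)).mul (HasSqrtOn.of_slitPlane (φ := fun x => 1 + -x / z)
    (by fun_prop) fun x hx => ?_)).congr fun x hx => by field_simp; ring
  refine Complex.mem_slitPlane_of_norm_lt_one ?_
  rw [norm_div, norm_neg, div_lt_one (norm_pos_iff.mpr hz0)]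
  have := hCR hx
  rw [mem_ball_zero_iff] at this
  linarith

theorem exists_compl_ball_subset_outsideOf {C : Set ℂ} (hC : IsCompact C) :
    ∃ R > 0, ∀ z : ℂ, R ≤ ‖z‖ → z ∈ outsideOf C := by
  obtain ⟨R, hR, hCR⟩ := hC.isBounded.subset_ball_lt 0 0
  refine ⟨R, hR, fun z hz => ⟨fun h => ?_, hasSqrtOn_sub_of_subset_ball hCR hz⟩⟩
  have := hCR h
  rw [mem_ball_zero_iff] at this
  linarith

theorem isBounded_compl_outsideOf {C : Set ℂ} (hC : IsCompact C) : IsBounded (outsideOf C)ᶜ := by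
  obtain ⟨R, -, hR⟩ := exists_compl_ball_subset_outsideOf hC
  refine (Metric.isBounded_ball (x := (0 : ℂ)) (r := R)).subset fun z hz => ?_
  by_contra h
  exact hz (hR z (by simpa using h))

theorem isBounded_insideOf {C : Set ℂ} (hC : IsCompact C) : IsBounded (insideOf C) :=
  (isBounded_compl_outsideOf hC).subset (disjoint_insideOf_outsideOf C).subset_compl_right

/-! ### Parity of square roots on curves made of arcs -/

theorem eq_or_eq_neg_of_roots {Y : Type*} {A B : Set Y} {a b : Y} {φ g h : Y → ℂ}
    (hg2 : ∀ x ∈ A, g x ^ 2 = φ x)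
    (hh2 : ∀ x ∈ B, h x ^ 2 = φ x) (ha : a ∈ A ∩ B) (hb : b ∈ A ∩ B) :
    g a * h b = g b * h a ∨ g a * h b = -(g b * h a) := by
  rw [← sq_eq_sq_iff_eq_or_eq_neg, mul_pow, mul_pow, hg2 a ha.1, hg2 b hb.1, hh2 a ha.2, hh2 b hb.2,
    mul_comm]

section Parity
variable {Y : Type*} [TopologicalSpace Y] {A B Q C : Set Y} {a b : Y} {φ ψ : Y → ℂ}

/-- Square roots on two arcs with common end points fit together, after a change of sign, exactly
if they have the same relative sign at both ends. -/
theorem hasSqrtOn_union_iff [T2Space Y] (hA : IsArc A a b) (hB : IsArc B a b) (hAB : A ∩ B ⊆ {a, b})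
    (h0 : ∀ x ∈ A ∪ B, φ x ≠ 0) {g h : Y → ℂ} (hg : ContinuousOn g A) (hg2 : ∀ x ∈ A, g x ^ 2 = φ x)
    (hh : ContinuousOn h B) (hh2 : ∀ x ∈ B, h x ^ 2 = φ x) :
    HasSqrtOn φ (A ∪ B) ↔ g a * h b = g b * h a := by
  classical
  have hgn : ∀ x ∈ A, g x ≠ 0 := fun x hx hx0 => h0 x (Or.inl hx) (by rw [← hg2 x hx, hx0]; simp)
  have hhn : ∀ x ∈ B, h x ≠ 0 := fun x hx hx0 => h0 x (Or.inr hx) (by rw [← hh2 x hx, hx0]; simp)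
  constructor
  · rintro ⟨f, hf, hf2⟩
    have h1 := hA.isPreconnected.eq_or_eq_neg_of_sq_eq (hf.mono subset_union_left) hg
      (fun x hx => (hf2 x (Or.inl hx)).trans (hg2 x hx).symm) (fun {x} hx => hgn x hx)
    have h2 := hB.isPreconnected.eq_or_eq_neg_of_sq_eq (hf.mono subset_union_right) hh
      (fun x hx => (hf2 x (Or.inr hx)).trans (hh2 x hx).symm) (fun {x} hx => hhn x hx)
    have ha1 := hA.left_mem
    have hb1 := hA.right_mem
    have ha2 := hB.left_mem
    have hb2 := hB.right_mem
    rcases h1 with h1 | h1 <;> rcases h2 with h2 | h2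
    all_goals
      have e1 := h1 ha1; have e2 := h1 hb1; have e3 := h2 ha2; have e4 := h2 hb2
      try simp only [Pi.neg_apply] at e1 e2
      try simp only [Pi.neg_apply] at e3 e4
    · rw [← e1, ← e2, ← e3, ← e4, mul_comm]
    · rw [← e1, ← e2, ← neg_eq_iff_eq_neg.mpr e3, ← neg_eq_iff_eq_neg.mpr e4]; ring
    · rw [← e3, ← e4, ← neg_eq_iff_eq_neg.mpr e1, ← neg_eq_iff_eq_neg.mpr e2]; ring
    · rw [← neg_eq_iff_eq_neg.mpr e3, ← neg_eq_iff_eq_neg.mpr e4, ← neg_eq_iff_eq_neg.mpr e1,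
        ← neg_eq_iff_eq_neg.mpr e2]; ring
  · intro hab
    have hha := hhn a hB.left_mem
    set ε := g a / h a with hε
    have hε2 : ε ^ 2 = 1 := by
      rw [hε, div_pow, hg2 a hA.left_mem, hh2 a hB.left_mem, div_self (h0 a (Or.inl hA.left_mem))]
    have hglue : EqOn (fun x => if x ∈ A then g x else ε * h x) (fun x => ε * h x) B := by
      intro x hx
      dsimp only
      split_ifs with hxA
      · rcases hAB ⟨hxA, hx⟩ with rfl | rfl
        · rw [hε]; field_simp
        · rw [hε]; field_simp; exact hab.symm
      · rfl
    refine ⟨fun x => if x ∈ A then g x else ε * h x, ContinuousOn.union_of_isClosed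
      (hg.congr fun x hx => if_pos hx) ((continuousOn_const.mul hh).congr hglue)
      hA.isCompact.isClosed hB.isCompact.isClosed, fun x hx => ?_⟩
    by_cases hxA : x ∈ A
    · simp only [hxA, if_true, hg2 x hxA]
    · simp only [hxA, if_false, mul_pow, hε2, one_mul]
      exact hh2 x (hx.resolve_left hxA)

/-- The parity rule for a theta graph. -/
theorem hasSqrtOn_theta [T2Space Y] (hA : IsArc A a b) (hB : IsArc B a b) (hQ : IsArc Q a b)
    (hAB : A ∩ B ⊆ {a, b}) (hAQ : A ∩ Q ⊆ {a, b}) (hBQ : B ∩ Q ⊆ {a, b})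
    (hφ : ContinuousOn φ (A ∪ B ∪ Q)) (h0 : ∀ x ∈ A ∪ B ∪ Q, φ x ≠ 0) :
    HasSqrtOn φ (A ∪ B) ↔ (HasSqrtOn φ (A ∪ Q) ↔ HasSqrtOn φ (B ∪ Q)) := by
  have sA : A ⊆ A ∪ B ∪ Q := fun x hx => Or.inl (Or.inl hx)
  have sB : B ⊆ A ∪ B ∪ Q := fun x hx => Or.inl (Or.inr hx)
  have sQ : Q ⊆ A ∪ B ∪ Q := fun x hx => Or.inr hx
  obtain ⟨f, hf, hf2⟩ := hA.hasSqrtOn (hφ.mono sA) fun x hx => h0 x (sA hx)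
  obtain ⟨g, hg, hg2⟩ := hB.hasSqrtOn (hφ.mono sB) fun x hx => h0 x (sB hx)
  obtain ⟨h, hh, hh2⟩ := hQ.hasSqrtOn (hφ.mono sQ) fun x hx => h0 x (sQ hx)
  rw [hasSqrtOn_union_iff hA hB hAB (fun x hx => h0 x (union_subset sA sB hx)) hf hf2 hg hg2,
    hasSqrtOn_union_iff hA hQ hAQ (fun x hx => h0 x (union_subset sA sQ hx)) hf hf2 hh hh2,
    hasSqrtOn_union_iff hB hQ hBQ (fun x hx => h0 x (union_subset sB sQ hx)) hg hg2 hh hh2]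
  have nz : ∀ {u : Y → ℂ} {S : Set Y}, (∀ x ∈ S, u x ^ 2 = φ x) → S ⊆ A ∪ B ∪ Q → ∀ x ∈ S,
      u x ≠ 0 := fun hu hS x hx hx0 => h0 x (hS hx) (by rw [← hu x hx, hx0]; simp)
  have fa := nz hf2 sA a hA.left_mem
  have fb := nz hf2 sA b hA.right_mem
  have ga := nz hg2 sB a hB.left_mem
  have gb := nz hg2 sB b hB.right_mem
  have ha := nz hh2 sQ a hQ.left_mem
  have hb := nz hh2 sQ b hQ.right_mem
  have e1 := eq_or_eq_neg_of_roots (a := a) (b := b) hf2 hg2 ⟨hA.left_mem, hB.left_mem⟩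
    ⟨hA.right_mem, hB.right_mem⟩
  have e2 := eq_or_eq_neg_of_roots (a := a) (b := b) hf2 hh2 ⟨hA.left_mem, hQ.left_mem⟩
    ⟨hA.right_mem, hQ.right_mem⟩
  have e3 := eq_or_eq_neg_of_roots (a := a) (b := b) hg2 hh2 ⟨hB.left_mem, hQ.left_mem⟩
    ⟨hB.right_mem, hQ.right_mem⟩
  have key : (f a * g b) * (g a * h b) * (f b * h a) = (f b * g a) * (g b * h a) * (f a * h b) := by
    ring
  have nzz : (f b * g a) * (g b * h a) * (f b * h a) ≠ 0 := by positivity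
  have hne : ∀ z : ℂ, z ≠ 0 → -z ≠ z := fun z hz h => hz (neg_eq_self.mp h)
  have n1 := hne _ (mul_ne_zero fb ga)
  have n2 := hne _ (mul_ne_zero fb ha)
  have n3 := hne _ (mul_ne_zero gb ha)
  rcases e1 with e1 | e1 <;> rcases e2 with e2 | e2 <;> rcases e3 with e3 | e3 <;>
    rw [e1, e2, e3] at key <;> rw [e1, e2, e3] <;>
      simp only [n1, n2, n3, iff_self, iff_true, iff_false, not_true]
  all_goals
    exfalso
    apply nzz
    first | linear_combination (1 / 2) * key | linear_combination (-1 / 2) * key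

/-- On a Jordan curve, a product of two functions without square root has a square root. -/
theorem IsJordanCurve.hasSqrtOn_mul [T2Space Y] (hC : IsJordanCurve C) (hφ : ContinuousOn φ C)
    (hψ : ContinuousOn ψ C) (h0 : ∀ x ∈ C, φ x ≠ 0) (h0' : ∀ x ∈ C, ψ x ≠ 0)
    (h : ¬ HasSqrtOn φ C) (h' : ¬ HasSqrtOn ψ C) : HasSqrtOn (fun x => φ x * ψ x) C := by
  obtain ⟨a, ha, b, hb, hab⟩ := hC.nontrivial
  obtain ⟨A, B, hA, hB, rfl, hAB⟩ := hC.exists_arcs ha hb hab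
  have sA : A ⊆ A ∪ B := subset_union_left
  have sB : B ⊆ A ∪ B := subset_union_right
  obtain ⟨f, hf, hf2⟩ := hA.hasSqrtOn (hφ.mono sA) fun x hx => h0 x (sA hx)
  obtain ⟨g, hg, hg2⟩ := hB.hasSqrtOn (hφ.mono sB) fun x hx => h0 x (sB hx)
  obtain ⟨f', hf', hf2'⟩ := hA.hasSqrtOn (hψ.mono sA) fun x hx => h0' x (sA hx)
  obtain ⟨g', hg', hg2'⟩ := hB.hasSqrtOn (hψ.mono sB) fun x hx => h0' x (sB hx)
  rw [hasSqrtOn_union_iff hA hB hAB.subset h0 hf hf2 hg hg2] at h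
  rw [hasSqrtOn_union_iff hA hB hAB.subset h0' hf' hf2' hg' hg2'] at h'
  rw [hasSqrtOn_union_iff hA hB hAB.subset (fun x hx => mul_ne_zero (h0 x hx) (h0' x hx))
    (hf.mul hf') (fun x hx => by simp only [Pi.mul_apply, mul_pow, hf2 x hx, hf2' x hx])
    (hg.mul hg') (fun x hx => by simp only [Pi.mul_apply, mul_pow, hg2 x hx, hg2' x hx])]
  have e1 := (eq_or_eq_neg_of_roots (a := a) (b := b) hf2 hg2 ⟨hA.left_mem, hB.left_mem⟩
    ⟨hA.right_mem, hB.right_mem⟩).resolve_left h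
  have e2 := (eq_or_eq_neg_of_roots (a := a) (b := b) hf2' hg2' ⟨hA.left_mem, hB.left_mem⟩
    ⟨hA.right_mem, hB.right_mem⟩).resolve_left h'
  simp only [Pi.mul_apply]
  linear_combination (f' a * g' b) * e1 - (f b * g a) * e2

end Parity

/-! ### The Jordan curve theorem -/

/-- An arc does not enclose a bounded open set. -/
theorem IsArc.eq_empty_of_frontier_subset {A U : Set ℂ} {a b : ℂ} (hA : IsArc A a b)
    (hb : IsBounded U) (hd : Disjoint U A) (hf : frontier U ⊆ A) : U = ∅ := by
  by_contra h
  obtain ⟨z, hz⟩ := nonempty_iff_ne_empty.mpr h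
  obtain ⟨l, hl, hle⟩ := hA.exists_log (φ := fun x => x - z) (by fun_prop) fun x hx h0 =>
    disjoint_left.mp hd hz (by rwa [← sub_eq_zero.mp h0])
  exact not_exists_log_frontier hb (subset_closure hz) l (hl.mono hf) fun x hx => hle x (hf hx)

/-- A finite set does not enclose a bounded open set. -/
theorem eq_empty_of_frontier_subset_finite {U F : Set ℂ} (hF : F.Finite) (hb : IsBounded U)
    (hd : Disjoint U F) (hf : frontier U ⊆ F) : U = ∅ := by
  by_contra h
  obtain ⟨z, hz⟩ := nonempty_iff_ne_empty.mpr h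
  refine not_exists_log_frontier hb (subset_closure hz) (fun x => Complex.log (x - z))
    ((hF.subset hf).continuousOn _) fun x hx => Complex.exp_log fun h0 => ?_
  exact disjoint_left.mp hd hz (by rw [← sub_eq_zero.mp h0]; exact hf hx)

/-- A point of the curve that is not in the closure of the inside would leave the frontier of the
inside within an arc; but an arc encloses nothing. -/
theorem IsJordanCurve.subset_closure_insideOf {C : Set ℂ} (hC : IsJordanCurve C)
    (hne : (insideOf C).Nonempty) : C ⊆ closure (insideOf C) := by
  intro p hp
  by_contra hcon
  have hCc := hC.isCompact
  have hfr : frontier (insideOf C) ⊆ C := by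
    rw [(isOpen_insideOf hCc).frontier_eq]
    exact fun x hx => (closure_insideOf_subset hCc hx.1).resolve_left hx.2
  obtain ⟨A, a, b, hA, hKA, hAC⟩ := hC.exists_arc_superset isClosed_frontier hfr hp
    fun h => hcon (frontier_subset_closure h)
  exact hne.ne_empty (hA.eq_empty_of_frontier_subset (isBounded_insideOf hCc)
    (disjoint_left.mpr fun x hx hxA => hx.1 (hAC hxA)) hKA)

/-- As for the inside: otherwise the frontier of the outside would lie in an arc, and the arc would
enclose the nonempty inside. -/
theorem IsJordanCurve.subset_closure_outsideOf {C : Set ℂ} (hC : IsJordanCurve C)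
    (hne : (insideOf C).Nonempty) : C ⊆ closure (outsideOf C) := by
  intro p hp
  by_contra hcon
  have hCc := hC.isCompact
  have hfr : frontier (outsideOf C) ⊆ C := by
    rw [(isOpen_outsideOf hCc).frontier_eq]
    exact fun x hx => (closure_outsideOf_subset hCc hx.1).resolve_left hx.2
  obtain ⟨A, a, b, hA, hKA, hAC⟩ := hC.exists_arc_superset isClosed_frontier hfr hp
    fun h => hcon (frontier_subset_closure h)
  have h0 := hA.eq_empty_of_frontier_subset (U := (A ∪ outsideOf C)ᶜ)
    ((isBounded_compl_outsideOf hCc).subset (compl_subset_compl.mpr subset_union_right))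
    (disjoint_left.mpr fun x hx hxA => hx (Or.inl hxA)) (by
      rw [frontier_compl]
      refine (frontier_union_subset _ _).trans (union_subset ?_ ?_)
      · exact inter_subset_left.trans hA.isCompact.isClosed.frontier_subset
      · exact inter_subset_right.trans hKA)
  obtain ⟨z, hz⟩ := hne
  have : z ∈ (A ∪ outsideOf C)ᶜ := by
    rintro (h | h)
    · exact hz.1 (hAC h)
    · exact disjoint_left.mp (disjoint_insideOf_outsideOf C) hz h
  rw [h0] at this
  exact this

theorem isArc_segment {a b : ℂ} (hab : a ≠ b) : IsArc (segment ℝ a b) a b := by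
  refine ⟨AffineMap.lineMap a b, AffineMap.lineMap_continuous.continuousOn,
    (AffineMap.lineMap_injective ℝ hab).injOn, (segment_eq_image_lineMap ℝ a b).symm, by simp,
    by simp⟩

/-- The principal square root has positive real part off the negative half line. -/
theorem exists_continuousOn_sqrt_re_pos {A : Set ℂ} {φ : ℂ → ℂ} (hφ : ContinuousOn φ A)
    (h : ∀ x ∈ A, φ x ∈ Complex.slitPlane) :
    ∃ r : ℂ → ℂ, ContinuousOn r A ∧ (∀ x ∈ A, r x ^ 2 = φ x) ∧ ∀ x ∈ A, 0 < (r x).re := by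
  refine ⟨fun x => Complex.exp (Complex.log (φ x) / 2), ((hφ.clog h).div_const 2).cexp,
    fun x hx => ?_, fun x hx => ?_⟩
  · rw [← Complex.exp_nat_mul]
    push_cast
    rw [mul_div_cancel₀ _ two_ne_zero, Complex.exp_log (Complex.slitPlane_ne_zero (h x hx))]
  · rw [Complex.exp_re]
    refine mul_pos (Real.exp_pos _) (Real.cos_pos_of_mem_Ioo ?_)
    have h1 := Complex.neg_pi_lt_arg (φ x)
    have h2 := lt_of_le_of_ne (Complex.arg_le_pi (φ x))
      (Complex.mem_slitPlane_iff_arg.mp (h x hx)).1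
    have : (Complex.log (φ x) / 2).im = (φ x).arg / 2 := by
      rw [Complex.div_ofNat_im, Complex.log_im]
    rw [this]
    constructor <;> linarith

theorem eq_of_sq_eq_of_re_pos {z w : ℂ} (h : z ^ 2 = w ^ 2) (hz : 0 < z.re) (hw : 0 < w.re) :
    z = w := by
  rcases sq_eq_sq_iff_eq_or_eq_neg.mp h with h | h
  · exact h
  · rw [h, Complex.neg_re] at hz; linarith

/-- A Jordan curve containing a straight segment has points inside: of two points facing each other
across the segment, exactly one is inside, as `(x - z₁) / (x - z₂)` has no square root. Along the
rest of the curve its principal root is available, but along the segment the root moves from one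
side of the imaginary axis to the other. -/
theorem insideOf_union_segment_nonempty {A : Set ℂ} {a b : ℂ} (hA : IsArc A a b)
    (hAs : A ∩ segment ℝ a b ⊆ {a, b}) : (insideOf (A ∪ segment ℝ a b)).Nonempty := by
  by_contra hcon
  rw [not_nonempty_iff_eq_empty] at hcon
  have hab := hA.ne
  set d := b - a with hd
  have hd0 : d ≠ 0 := sub_ne_zero.mpr hab.symm
  have hdn : 0 < ‖d‖ := norm_pos_iff.mpr hd0
  set m := a + d / 2 with hm
  have hQ := isArc_segment hab
  -- the affine coordinate in which the segment is the interval from `-1/2` to `1/2`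
  set w : ℂ → ℂ := fun x => (x - m) / d with hw
  have hwc : Continuous w := by fun_prop
  have hwx : ∀ x, x = m + d * w x := fun x => by simp only [hw]; field_simp; ring
  have hwa : w a = -(1 / 2) := by simp only [hw, hm]; field_simp; ring
  have hwb : w b = 1 / 2 := by simp only [hw, hm, hd]; field_simp; ring
  have hwim : ∀ x ∈ segment ℝ a b, (w x).im = 0 := by
    rw [segment_eq_image_lineMap]
    rintro _ ⟨t, -, rfl⟩
    have : w (AffineMap.lineMap a b t) = ((t - 1 / 2 : ℝ) : ℂ) := by
      simp only [hw, hm, hd, AffineMap.lineMap_apply, vsub_eq_sub, vadd_eq_add, Complex.real_smul]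
      rw [← hd]; field_simp; push_cast; ring
    rw [this, Complex.ofReal_im]
  have hmA : m ∉ A := by
    intro hmA
    have hms : m ∈ segment ℝ a b := by
      rw [segment_eq_image_lineMap]
      refine ⟨1 / 2, by norm_num, ?_⟩
      simp only [AffineMap.lineMap_apply, hm, hd, vsub_eq_sub, vadd_eq_add, Complex.real_smul]
      push_cast; ring
    have hwm : w m = 0 := by simp [hw]
    rcases hAs ⟨hmA, hms⟩ with h | h
    · rw [h, hwa] at hwm; norm_num at hwm
    · rw [h, hwb] at hwm; norm_num at hwm
  obtain ⟨η, hη, hηA⟩ := Metric.isOpen_iff.mp hA.isCompact.isClosed.isOpen_compl m hmA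
  obtain ⟨δ, hδ, hδη⟩ : ∃ δ > 0, δ * ‖d‖ < η :=
    ⟨η / (2 * ‖d‖), by positivity, by rw [div_mul_eq_mul_div, div_lt_iff₀ (by positivity)]; nlinarith⟩
  have hwA : ∀ x ∈ A, δ < ‖w x‖ := by
    intro x hx
    by_contra hle
    push Not at hle
    refine hηA (a := x) ?_ hx
    rw [Metric.mem_ball, dist_eq_norm]
    calc ‖x - m‖ = ‖d‖ * ‖w x‖ := by
          rw [← norm_mul]; congr 1; simp only [hw]; field_simp
      _ ≤ ‖d‖ * δ := by gcongr
      _ < η := by rwa [mul_comm]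
  have hpt : ∀ ε : ℝ, |ε| = δ → ∀ x ∈ A ∪ segment ℝ a b, w x - ε * Complex.I ≠ 0 := by
    rintro ε hε x (hx | hx) h0
    · have h1 := hwA x hx
      rw [sub_eq_zero.mp h0, norm_mul, Complex.norm_I, mul_one, Complex.norm_real, Real.norm_eq_abs,
        hε] at h1
      exact lt_irrefl _ h1
    · have h1 := hwim x hx
      rw [sub_eq_zero.mp h0] at h1
      simp only [Complex.mul_im, Complex.ofReal_re, Complex.I_im, mul_one, Complex.ofReal_im,
        Complex.I_re, mul_zero, add_zero] at h1
      rw [h1, abs_zero] at hε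
      exact hδ.ne hε
  have hsq : ∀ ε : ℝ, |ε| = δ → HasSqrtOn (fun x => w x - ε * Complex.I) (A ∪ segment ℝ a b) := by
    intro ε hε
    have hz : m + d * (ε * Complex.I) ∉ A ∪ segment ℝ a b := fun h => by
      refine hpt ε hε _ h ?_
      simp only [hw]
      field_simp
      ring
    have : m + d * (ε * Complex.I) ∉ insideOf (A ∪ segment ℝ a b) := by simp [hcon]
    refine ((HasSqrtOn.const d⁻¹).mul ((mem_insideOf_or hz).resolve_left this).2).congr
      fun x hx => ?_
    simp only [hw]; field_simp; ring
  have h1 := hsq δ (abs_of_pos hδ)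
  have h2 := hsq (-δ) (by rw [abs_neg, abs_of_pos hδ])
  have hn1 := hpt δ (abs_of_pos hδ)
  have hn2 := hpt (-δ) (by rw [abs_neg, abs_of_pos hδ])
  have hφ := h1.mul (h2.inv hn2)
  set φ : ℂ → ℂ := fun x => (w x - δ * Complex.I) * (w x - (-δ : ℝ) * Complex.I)⁻¹ with hφdef
  have hφ0 : ∀ x ∈ A ∪ segment ℝ a b, φ x ≠ 0 := fun x hx =>
    mul_ne_zero (hn1 x hx) (inv_ne_zero (hn2 x hx))
  have hφc : ContinuousOn φ (A ∪ segment ℝ a b) :=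
    (by fun_prop : Continuous fun x => w x - δ * Complex.I).continuousOn.mul
      ((by fun_prop : Continuous fun x => w x - (-δ : ℝ) * Complex.I).continuousOn.inv₀ hn2)
  have hslit : ∀ x ∈ A, φ x ∈ Complex.slitPlane := by
    intro x hx
    refine Or.inl ?_
    have hpos : 0 < Complex.normSq (w x - (-δ : ℝ) * Complex.I) :=
      Complex.normSq_pos.mpr (hn2 x (Or.inl hx))
    have h3 : δ ^ 2 < Complex.normSq (w x) := by
      rw [Complex.normSq_eq_norm_sq]
      exact pow_lt_pow_left₀ (hwA x hx) hδ.le two_ne_zero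
    rw [Complex.normSq_apply] at h3
    have : (φ x).re = (Complex.normSq (w x) - δ ^ 2) /
        Complex.normSq (w x - (-δ : ℝ) * Complex.I) := by
      simp only [hφdef]
      rw [← div_eq_mul_inv, Complex.div_re, ← add_div]
      congr 1
      simp [Complex.normSq_apply]
      ring
    rw [this, Complex.normSq_apply]
    exact div_pos (by linarith) hpos
  obtain ⟨r, hr, hr2, hrpos⟩ := exists_continuousOn_sqrt_re_pos
    (hφc.mono subset_union_left) hslit
  set κ : ℂ → ℝ := fun x => √((w x).re ^ 2 + δ ^ 2) with hκ
  have hκ0 : ∀ x, 0 < κ x := fun x => Real.sqrt_pos.mpr (by positivity)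
  have hκc : Continuous κ := by fun_prop
  set q : ℂ → ℂ := fun x => (w x - δ * Complex.I) / κ x with hq
  have hqc : Continuous q := by
    refine Continuous.div (by fun_prop) (by fun_prop) fun x => ?_
    exact_mod_cast (hκ0 x).ne'
  have hq2 : ∀ x ∈ segment ℝ a b, q x ^ 2 = φ x := by
    intro x hx
    have hwre : w x = ((w x).re : ℂ) := Complex.ext (by simp) (by simp [hwim x hx])
    have hκ2 : ((κ x : ℝ) : ℂ) ^ 2 = (w x - δ * Complex.I) * (w x - (-δ : ℝ) * Complex.I) := by
      rw [← Complex.ofReal_pow, hκ, Real.sq_sqrt (by positivity)]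
      conv_rhs => rw [hwre]
      push_cast
      linear_combination (δ : ℂ) ^ 2 * Complex.I_sq
    have hz1 := hn1 x (Or.inr hx)
    have hz2 := hn2 x (Or.inr hx)
    simp only [hq, div_pow, hκ2, hφdef]
    field_simp
  rw [hasSqrtOn_union_iff hA hQ hAs hφ0 hr hr2 hqc.continuousOn hq2] at hφ
  have hqb : 0 < (q b).re := by
    simp only [hq, Complex.div_ofReal_re, hwb]
    refine div_pos ?_ (hκ0 b)
    simp
  have hqa : 0 < (-q a).re := by
    simp only [hq, Complex.neg_re, Complex.div_ofReal_re, hwa]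
    rw [← neg_div]
    refine div_pos ?_ (hκ0 a)
    simp
  have eb : r b = q b := eq_of_sq_eq_of_re_pos
    ((hr2 b hA.right_mem).trans (hq2 b hQ.right_mem).symm) (hrpos b hA.right_mem) hqb
  have ea : r a = -q a := eq_of_sq_eq_of_re_pos
    ((hr2 a hA.left_mem).trans ((hq2 a hQ.left_mem).symm.trans (neg_sq _).symm))
    (hrpos a hA.left_mem) hqa
  rw [ea, eb] at hφ
  have : q a * q b = 0 := by linear_combination (-1 / 2) * hφ
  rcases mul_eq_zero.mp this with h | h
  · rw [h] at hqa; simp at hqa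
  · rw [h] at hqb; simp at hqb

/-- A Jordan curve is not convex, as a circle does not admit all logarithms. -/
theorem IsJordanCurve.not_convex {C : Set ℂ} (hC : IsJordanCurve C) : ¬ Convex ℝ C := by
  intro hconv
  obtain ⟨γ, hγ, hi, rfl⟩ := hC
  have hinv := continuousOn_invFunOn_of_isCompact isCompact_univ hγ.continuousOn hi.injOn
  rw [image_univ] at hinv
  obtain ⟨l, hl, hle⟩ := hconv.exists_continuousOn_log
    (φ := fun x => ((Function.invFunOn γ univ x : Circle) : ℂ))
    ((by fun_prop : Continuous fun z : Circle => (z : ℂ)).comp_continuousOn hinv)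
    fun x _ => Circle.coe_ne_zero _
  refine not_hasSqrtOn_sphere 0 one_pos (HasSqrtOn.of_exp
    (l := fun x => l (γ (Circle.exp (Complex.arg x)))) ?_ fun x hx => ?_)
  · have hce : ContinuousOn (fun x : ℂ => Circle.exp (Complex.arg x)) (Metric.sphere 0 1) := by
      rw [(⟨rfl⟩ : IsInducing fun z : Circle => (z : ℂ)).continuousOn_iff]
      refine continuousOn_id.congr fun x hx => ?_
      have hx1 : ‖x‖ = 1 := by simpa using hx
      have := Complex.norm_mul_exp_arg_mul_I x
      rw [hx1, Complex.ofReal_one, one_mul] at this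
      exact this
    exact hl.comp (hγ.comp_continuousOn hce) fun x _ => ⟨_, rfl⟩
  · have hx1 : ‖x‖ = 1 := by simpa using hx
    rw [hle _ ⟨_, rfl⟩, hi.injOn.leftInvOn_invFunOn (mem_univ _), Circle.coe_exp, sub_zero]
    have := Complex.norm_mul_exp_arg_mul_I x
    rwa [hx1, Complex.ofReal_one, one_mul] at this

/-- A path leaving an open set in both directions has a maximal excursion inside it. -/
theorem exists_maximal_excursion {X : Type*} [TopologicalSpace X] {e : ℝ → X} {s₀ t₀ s₁ : ℝ}
    {U : Set X} (hU : IsOpen U) (he : ContinuousOn e (Icc s₀ s₁)) (h0 : s₀ ≤ t₀) (h1 : t₀ ≤ s₁)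
    (hs0 : e s₀ ∉ U) (ht : e t₀ ∈ U) (hs1 : e s₁ ∉ U) :
    ∃ t₁ t₂, s₀ ≤ t₁ ∧ t₁ < t₀ ∧ t₀ < t₂ ∧ t₂ ≤ s₁ ∧ e t₁ ∉ U ∧ e t₂ ∉ U ∧
      ∀ t ∈ Ioo t₁ t₂, e t ∈ U := by
  have hcl : ∀ u v, s₀ ≤ u → v ≤ s₁ → IsCompact (Icc u v ∩ e ⁻¹' Uᶜ) := fun u v hu hv =>
    isCompact_Icc.of_isClosed_subset
      ((he.mono (Icc_subset_Icc hu hv)).preimage_isClosed_of_isClosed isClosed_Icc hU.isClosed_compl)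
      inter_subset_left
  obtain ⟨t₁, ht1, hm1⟩ := (hcl s₀ t₀ le_rfl h1).exists_isGreatest ⟨s₀, ⟨le_rfl, h0⟩, hs0⟩
  obtain ⟨t₂, ht2, hm2⟩ := (hcl t₀ s₁ h0 le_rfl).exists_isLeast ⟨s₁, ⟨h1, le_rfl⟩, hs1⟩
  have l1 : t₁ < t₀ := lt_of_le_of_ne ht1.1.2 (by rintro rfl; exact ht1.2 ht)
  have l2 : t₀ < t₂ := lt_of_le_of_ne ht2.1.1 (by rintro rfl; exact ht2.2 ht)
  refine ⟨t₁, t₂, ht1.1.1, l1, l2, ht2.1.2, ht1.2, ht2.2, fun t hmem => ?_⟩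
  by_contra hcon
  rcases le_total t t₀ with h | h
  · exact (hm1 ⟨⟨ht1.1.1.trans hmem.1.le, h⟩, hcon⟩).not_gt hmem.1
  · exact (hm2 ⟨⟨h, hmem.2.le.trans ht2.1.2⟩, hcon⟩).not_gt hmem.2

/-- A stretch of an injective path that runs in `U` between its endpoints is an arc with interior
in `U`. -/
theorem IsArc.of_excursion {X : Type*} [TopologicalSpace X] {e : ℝ → X} {t₁ t₂ : ℝ} {U : Set X}
    (hlt : t₁ < t₂) (he : ContinuousOn e (Icc t₁ t₂)) (hi : InjOn e (Icc t₁ t₂))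
    (h : ∀ t ∈ Ioo t₁ t₂, e t ∈ U) :
    IsArc (e '' Icc t₁ t₂) (e t₁) (e t₂) ∧ e '' Icc t₁ t₂ \ {e t₁, e t₂} ⊆ U := by
  refine ⟨.of_Icc hlt he hi, ?_⟩
  rintro _ ⟨⟨t, ht, rfl⟩, hne⟩
  simp only [mem_insert_iff, mem_singleton_iff, not_or] at hne
  exact h t ⟨lt_of_le_of_ne ht.1 (by rintro rfl; exact hne.1 rfl),
    lt_of_le_of_ne ht.2 (by rintro rfl; exact hne.2 rfl)⟩

/-- Every Jordan curve has points inside. A straight chord splits the curve into two curves which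
have points inside; were the curve to have none, these two curves would have the same inside. -/
theorem IsJordanCurve.insideOf_nonempty {C : Set ℂ} (hC : IsJordanCurve C) :
    (insideOf C).Nonempty := by
  have hnc := hC.not_convex
  rw [convex_iff_segment_subset] at hnc
  push Not at hnc
  obtain ⟨a', ha', b', hb', hsub⟩ := hnc
  obtain ⟨z, hz, hzC⟩ := not_subset.mp hsub
  rw [segment_eq_image_lineMap] at hz
  obtain ⟨t₀, ht₀, rfl⟩ := hz
  obtain ⟨t₁, t₂, -, h1, h2, -, ha, hb, hin⟩ := exists_maximal_excursion
    (e := AffineMap.lineMap a' b') (s₀ := 0) (s₁ := 1) hC.isCompact.isClosed.isOpen_compl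
    AffineMap.lineMap_continuous.continuousOn ht₀.1 ht₀.2 (by simpa) hzC (by simpa)
  rw [notMem_compl_iff] at ha hb
  have hab' : a' ≠ b' := by
    rintro rfl
    simp only [AffineMap.lineMap_same, AffineMap.const_apply] at hzC
    exact hzC ha'
  obtain ⟨hQ, hQC⟩ := IsArc.of_excursion (h1.trans h2) AffineMap.lineMap_continuous.continuousOn
    ((AffineMap.lineMap_injective ℝ hab').injOn) hin
  have hseg : (AffineMap.lineMap a' b' : ℝ → ℂ) '' Icc t₁ t₂ =
      segment ℝ (AffineMap.lineMap a' b' t₁ : ℂ) (AffineMap.lineMap a' b' t₂) := by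
    rw [← image_segment, segment_eq_Icc (h1.trans h2).le]
  rw [hseg] at hQ hQC
  set a : ℂ := AffineMap.lineMap a' b' t₁
  set b : ℂ := AffineMap.lineMap a' b' t₂
  set Q := segment ℝ a b with hQdef
  obtain ⟨A, B, hA, hB, rfl, hAB⟩ := hC.exists_arcs ha hb hQ.ne
  have hAQ : A ∩ Q ⊆ {a, b} := fun x hx => by
    by_contra h
    exact hQC ⟨hx.2, h⟩ (Or.inl hx.1)
  have hBQ : B ∩ Q ⊆ {a, b} := fun x hx => by
    by_contra h
    exact hQC ⟨hx.2, h⟩ (Or.inr hx.1)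
  have hJ1 := IsJordanCurve.of_arcs hA hQ hAQ
  have hn1 := insideOf_union_segment_nonempty hA hAQ
  by_contra hemp
  rw [not_nonempty_iff_eq_empty] at hemp
  obtain ⟨p, hpA, hpab⟩ := hA.nonempty_interior
  have hpB : p ∉ B := fun h => hpab (hAB ▸ ⟨hpA, h⟩)
  have hpQ : p ∉ Q := fun h => hpab (hAQ ⟨hpA, h⟩)
  have hp2 : p ∉ B ∪ Q := fun h => h.elim hpB hpQ
  have hBQc : IsCompact (B ∪ Q) := hB.isCompact.union hQ.isCompact
  have par : ∀ z, z ∉ A ∪ Q → z ∉ B ∪ Q → (z ∈ insideOf (A ∪ Q) ↔ z ∈ insideOf (B ∪ Q)) := by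
    intro z h1 h2
    have hz : z ∉ A ∪ B := fun h => h.elim (fun h => h1 (Or.inl h)) fun h => h2 (Or.inl h)
    have h3 : HasSqrtOn (fun x => x - z) (A ∪ B) :=
      ((mem_insideOf_or hz).resolve_left (by simp [hemp])).2
    rw [hasSqrtOn_theta hA hB hQ hAB.subset hAQ hBQ (by fun_prop) ?_] at h3
    · simp only [insideOf, mem_ofPred_eq, h1, h2, not_false_eq_true, true_and, h3]
    · rintro x hx h0
      rw [sub_eq_zero] at h0
      rw [← h0] at h1 h2
      rcases hx with (hx | hx) | hx
      exacts [h1 (Or.inl hx), h2 (Or.inl hx), h2 (Or.inr hx)]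
  rcases mem_insideOf_or hp2 with h | h
  · obtain ⟨z, hz, hz'⟩ := mem_closure_iff.mp
      (hJ1.subset_closure_outsideOf hn1 (Or.inl hpA)) _ (isOpen_insideOf hBQc) h
    exact disjoint_left.mp (disjoint_insideOf_outsideOf _) ((par z hz'.1 hz.1).mpr hz) hz'
  · obtain ⟨z, hz, hz'⟩ := mem_closure_iff.mp
      (hJ1.subset_closure_insideOf hn1 (Or.inl hpA)) _ (isOpen_outsideOf hBQc) h
    exact disjoint_left.mp (disjoint_insideOf_outsideOf _) ((par z hz'.1 hz.1).mp hz') hz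

theorem IsJordanCurve.closure_insideOf {C : Set ℂ} (hC : IsJordanCurve C) :
    closure (insideOf C) = C ∪ insideOf C :=
  subset_antisymm (by rw [union_comm]; exact closure_insideOf_subset hC.isCompact)
    (union_subset (hC.subset_closure_insideOf hC.insideOf_nonempty) subset_closure)

/-! ### Cutting a Jordan domain along a chord -/

theorem frontier_inter_subset_of_closure {X : Type*} [TopologicalSpace X] {S T C D : Set X}
    (hS : IsOpen S) (hT : IsOpen T) (hSC : closure S ⊆ S ∪ C) (hTD : closure T ⊆ T ∪ D) {x : X}
    (hx : x ∈ frontier (S ∩ T)) : x ∈ C ∪ D ∧ x ∈ S ∪ C ∧ x ∈ T ∪ D ∧ x ∈ closure (S ∩ T) := by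
  rw [(hS.inter hT).frontier_eq] at hx
  have h1 := hSC (closure_mono inter_subset_left hx.1)
  have h2 := hTD (closure_mono inter_subset_right hx.1)
  refine ⟨?_, h1, h2, hx.1⟩
  rcases h1 with h1 | h1
  · rcases h2 with h2 | h2
    · exact absurd ⟨h1, h2⟩ hx.2
    · exact Or.inr h2
  · exact Or.inl h1

section Chord
variable {A B Q : Set ℂ} {a b : ℂ}

/-- Parity in a theta curve: a point off the three arcs lies inside an even number of the three
curves they form. -/
theorem mem_insideOf_theta (hA : IsArc A a b) (hB : IsArc B a b) (hQ : IsArc Q a b)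
    (hAB : A ∩ B ⊆ {a, b}) (hAQ : A ∩ Q ⊆ {a, b}) (hBQ : B ∩ Q ⊆ {a, b}) {z : ℂ}
    (hzA : z ∉ A) (hzB : z ∉ B) (hzQ : z ∉ Q) :
    z ∈ insideOf (A ∪ B) ↔ ¬ (z ∈ insideOf (A ∪ Q) ↔ z ∈ insideOf (B ∪ Q)) := by
  have := hasSqrtOn_theta (φ := fun x => x - z) hA hB hQ hAB hAQ hBQ (by fun_prop) (by
    rintro x hx h0
    rw [sub_eq_zero] at h0
    subst h0
    rcases hx with (hx | hx) | hx
    exacts [hzA hx, hzB hx, hzQ hx])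
  simp only [insideOf, mem_ofPred_eq, mem_union, hzA, hzB, hzQ, or_self, not_false_eq_true,
    true_and, this, not_iff_not]

theorem interior_subset_insideOf_or (hA : IsArc A a b) (hB : IsArc B a b) (hQ : IsArc Q a b)
    (hAB : A ∩ B ⊆ {a, b}) (hBQ : B ∩ Q ⊆ {a, b}) :
    B \ {a, b} ⊆ insideOf (A ∪ Q) ∨ B \ {a, b} ⊆ outsideOf (A ∪ Q) := by
  have hc : IsCompact (A ∪ Q) := hA.isCompact.union hQ.isCompact
  refine hB.isPreconnected_interior.subset_or_subset (isOpen_insideOf hc) (isOpen_outsideOf hc)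
    (disjoint_insideOf_outsideOf _) fun x hx => mem_insideOf_or ?_
  rintro (h | h)
  · exact hx.2 (hAB ⟨h, hx.1⟩)
  · exact hx.2 (hBQ ⟨hx.1, h⟩)

theorem chord_inter_left (hQin : Q \ {a, b} ⊆ insideOf (A ∪ B)) : A ∩ Q ⊆ {a, b} := fun x hx => by
  by_contra h
  exact (hQin ⟨hx.2, h⟩).1 (Or.inl hx.1)

theorem chord_inter_right (hQin : Q \ {a, b} ⊆ insideOf (A ∪ B)) : B ∩ Q ⊆ {a, b} := fun x hx => by
  by_contra h
  exact (hQin ⟨hx.2, h⟩).1 (Or.inr hx.1)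

/-- If `A` runs outside the curve `B ∪ Q`, then `B` runs outside `A ∪ Q`: otherwise the part of the
inside of `B ∪ Q` lying outside `A ∪ Q` would be enclosed by the arc `Q`. -/
theorem subset_outsideOf_of_subset_outsideOf (hA : IsArc A a b) (hB : IsArc B a b)
    (hQ : IsArc Q a b) (hAB : A ∩ B ⊆ {a, b}) (hQin : Q \ {a, b} ⊆ insideOf (A ∪ B))
    (hout : A \ {a, b} ⊆ outsideOf (B ∪ Q)) : B \ {a, b} ⊆ outsideOf (A ∪ Q) := by
  have hAQ := chord_inter_left hQin
  have hBQ := chord_inter_right hQin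
  have h1 : IsCompact (A ∪ Q) := hA.isCompact.union hQ.isCompact
  have h2 : IsCompact (B ∪ Q) := hB.isCompact.union hQ.isCompact
  refine (interior_subset_insideOf_or hA hB hQ hAB hBQ).resolve_left fun hin => ?_
  have hemp : insideOf (B ∪ Q) ∩ outsideOf (A ∪ Q) = ∅ := by
    refine hQ.eq_empty_of_frontier_subset ((isBounded_insideOf h2).subset inter_subset_left)
      (disjoint_left.mpr fun x hx hxQ => hx.1.1 (Or.inr hxQ)) fun x hx => ?_
    obtain ⟨hx1, hx2, hx3, -⟩ := frontier_inter_subset_of_closure (isOpen_insideOf h2)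
      (isOpen_outsideOf h1) (closure_insideOf_subset h2) (closure_outsideOf_subset h1) hx
    by_contra hxQ
    have hxab : x ∉ ({a, b} : Set ℂ) := by
      rintro (rfl | rfl)
      exacts [hxQ hQ.left_mem, hxQ hQ.right_mem]
    have key : x ∈ A ∨ x ∈ B := by
      rcases hx1 with (h | h) | (h | h)
      exacts [Or.inr h, absurd h hxQ, Or.inl h, absurd h hxQ]
    rcases key with h | h
    · have ho := hout ⟨h, hxab⟩
      exact hx2.elim (fun h' => disjoint_left.mp (disjoint_insideOf_outsideOf _) h' ho) ho.1
    · have hi := hin ⟨h, hxab⟩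
      exact hx3.elim (fun h' => disjoint_left.mp (disjoint_insideOf_outsideOf _) hi h') hi.1
  obtain ⟨q, hq⟩ := hQ.nonempty_interior
  have hJ := IsJordanCurve.of_arcs hB hQ hBQ
  obtain ⟨z, hz1, hz2⟩ := mem_closure_iff.mp (hJ.subset_closure_insideOf hJ.insideOf_nonempty
    (Or.inr hq.1)) _ (isOpen_insideOf (hA.isCompact.union hB.isCompact)) (hQin hq)
  have hzA : z ∉ A := fun h => hz1.1 (Or.inl h)
  have hzB : z ∉ B := fun h => hz1.1 (Or.inr h)
  have hzQ : z ∉ Q := fun h => hz2.1 (Or.inr h)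
  have hz3 : z ∉ insideOf (A ∪ Q) := fun h =>
    (mem_insideOf_theta hA hB hQ hAB hAQ hBQ hzA hzB hzQ).mp hz1 ⟨fun _ => hz2, fun _ => h⟩
  have : z ∈ insideOf (B ∪ Q) ∩ outsideOf (A ∪ Q) :=
    ⟨hz2, (mem_insideOf_or fun h => h.elim hzA hzQ).resolve_left hz3⟩
  rw [hemp] at this
  exact this

/-- If the arc `Q` crosses the inside of `A ∪ B`, then each of `A` and `B` runs outside the curve
formed by `Q` and the other one. -/
theorem subset_outsideOf_of_chord (hA : IsArc A a b) (hB : IsArc B a b) (hQ : IsArc Q a b)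
    (hAB : A ∩ B ⊆ {a, b}) (hQin : Q \ {a, b} ⊆ insideOf (A ∪ B)) :
    A \ {a, b} ⊆ outsideOf (B ∪ Q) ∧ B \ {a, b} ⊆ outsideOf (A ∪ Q) := by
  have hAQ := chord_inter_left hQin
  have hBQ := chord_inter_right hQin
  have hBA : B ∩ A ⊆ {a, b} := by rwa [inter_comm]
  have hQin' : Q \ {a, b} ⊆ insideOf (B ∪ A) := by rwa [union_comm]
  have h1 : IsCompact (A ∪ Q) := hA.isCompact.union hQ.isCompact
  have h2 : IsCompact (B ∪ Q) := hB.isCompact.union hQ.isCompact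
  rcases interior_subset_insideOf_or hA hB hQ hAB hBQ with hi1 | ho1
  · rcases interior_subset_insideOf_or hB hA hQ hBA hAQ with hi2 | ho2
    · -- the common outside would have its frontier in `{a, b}`
      exfalso
      set W := outsideOf (A ∪ Q) ∩ outsideOf (B ∪ Q) with hW
      have hWo : IsOpen W := (isOpen_outsideOf h1).inter (isOpen_outsideOf h2)
      have hWf : frontier W ⊆ {a, b} := fun x hx => by
        obtain ⟨hx1, hx2, hx3, hx4⟩ := frontier_inter_subset_of_closure (isOpen_outsideOf h1)
          (isOpen_outsideOf h2) (closure_outsideOf_subset h1) (closure_outsideOf_subset h2) hx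
        by_contra hxab
        have key : x ∈ A ∨ x ∈ B ∨ x ∈ Q := by
          rcases hx1 with (h | h) | (h | h)
          exacts [Or.inl h, Or.inr (Or.inr h), Or.inr (Or.inl h), Or.inr (Or.inr h)]
        rcases key with h | h | h
        · have hi := hi2 ⟨h, hxab⟩
          exact hx3.elim (fun h' => disjoint_left.mp (disjoint_insideOf_outsideOf _) hi h') hi.1
        · have hi := hi1 ⟨h, hxab⟩
          exact hx2.elim (fun h' => disjoint_left.mp (disjoint_insideOf_outsideOf _) hi h') hi.1
        · obtain ⟨z, hz1, hz2, hz3⟩ := mem_closure_iff.mp hx4 _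
            (isOpen_insideOf (hA.isCompact.union hB.isCompact)) (hQin ⟨h, hxab⟩)
          refine (mem_insideOf_theta hA hB hQ hAB hAQ hBQ (fun h => hz1.1 (Or.inl h))
            (fun h => hz1.1 (Or.inr h)) (fun h => hz2.1 (Or.inr h))).mp hz1 ?_
          exact iff_of_false (fun h => disjoint_left.mp (disjoint_insideOf_outsideOf _) h hz2)
            fun h => disjoint_left.mp (disjoint_insideOf_outsideOf _) h hz3
      have hV := eq_empty_of_frontier_subset_finite (F := {a, b}) (U := ({a, b} ∪ W)ᶜ)
        (by simp) (by
          obtain ⟨R₁, -, hR₁⟩ := exists_compl_ball_subset_outsideOf h1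
          obtain ⟨R₂, -, hR₂⟩ := exists_compl_ball_subset_outsideOf h2
          refine (Metric.isBounded_ball (x := (0 : ℂ)) (r := max R₁ R₂)).subset fun z hz => ?_
          by_contra hcon
          rw [mem_ball_zero_iff, not_lt] at hcon
          exact hz (Or.inr ⟨hR₁ z (le_of_max_le_left hcon), hR₂ z (le_of_max_le_right hcon)⟩))
        (disjoint_left.mpr fun x hx hxF => hx (Or.inl hxF)) (by
          rw [frontier_compl]
          refine (frontier_union_subset _ _).trans (union_subset ?_ ?_)
          · exact inter_subset_left.trans (Set.toFinite {a, b}).isClosed.frontier_subset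
          · exact inter_subset_right.trans hWf)
      obtain ⟨q, hq⟩ := hQ.nonempty_interior
      have : q ∈ ({a, b} ∪ W)ᶜ := by
        rintro (h | h)
        · exact hq.2 h
        · exact h.1.1 (Or.inr hq.1)
      rw [hV] at this
      exact this
    · exact ⟨ho2, subset_outsideOf_of_subset_outsideOf hA hB hQ hAB hQin ho2⟩
  · exact ⟨subset_outsideOf_of_subset_outsideOf hB hA hQ hBA hQin' ho1, ho1⟩

/-- The two curves into which a chord splits a Jordan curve have disjoint insides. -/
theorem disjoint_insideOf_of_chord (hA : IsArc A a b) (hB : IsArc B a b) (hQ : IsArc Q a b)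
    (hAB : A ∩ B ⊆ {a, b}) (hQin : Q \ {a, b} ⊆ insideOf (A ∪ B)) :
    Disjoint (insideOf (A ∪ Q)) (insideOf (B ∪ Q)) := by
  have hAQ := chord_inter_left hQin
  have hBQ := chord_inter_right hQin
  obtain ⟨hoA, hoB⟩ := subset_outsideOf_of_chord hA hB hQ hAB hQin
  have h1 : IsCompact (A ∪ Q) := hA.isCompact.union hQ.isCompact
  have h2 : IsCompact (B ∪ Q) := hB.isCompact.union hQ.isCompact
  rw [disjoint_iff_inter_eq_empty]
  refine eq_empty_of_frontier_subset_finite (F := {a, b}) (by simp)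
    ((isBounded_insideOf h1).subset inter_subset_left) (disjoint_left.mpr ?_) fun x hx => ?_
  · rintro x hx (rfl | rfl)
    exacts [hx.1.1 (Or.inl hA.left_mem), hx.1.1 (Or.inl hA.right_mem)]
  · obtain ⟨hx1, hx2, hx3, hx4⟩ := frontier_inter_subset_of_closure (isOpen_insideOf h1)
      (isOpen_insideOf h2) (closure_insideOf_subset h1) (closure_insideOf_subset h2) hx
    by_contra hxab
    have key : x ∈ A ∨ x ∈ B ∨ x ∈ Q := by
      rcases hx1 with (h | h) | (h | h)
      exacts [Or.inl h, Or.inr (Or.inr h), Or.inr (Or.inl h), Or.inr (Or.inr h)]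
    rcases key with h | h | h
    · have ho := hoA ⟨h, hxab⟩
      exact hx3.elim (fun h' => disjoint_left.mp (disjoint_insideOf_outsideOf _) h' ho) ho.1
    · have ho := hoB ⟨h, hxab⟩
      exact hx2.elim (fun h' => disjoint_left.mp (disjoint_insideOf_outsideOf _) h' ho) ho.1
    · obtain ⟨z, hz1, hz2, hz3⟩ := mem_closure_iff.mp hx4 _
        (isOpen_insideOf (hA.isCompact.union hB.isCompact)) (hQin ⟨h, hxab⟩)
      exact (mem_insideOf_theta hA hB hQ hAB hAQ hBQ (fun h => hz1.1 (Or.inl h))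
        (fun h => hz1.1 (Or.inr h)) (fun h => hz2.1 (Or.inr h))).mp hz1 (iff_of_true hz2 hz3)

/-- A chord cuts the inside of a Jordan curve into the insides of two Jordan curves. -/
theorem insideOf_diff_chord (hA : IsArc A a b) (hB : IsArc B a b) (hQ : IsArc Q a b)
    (hAB : A ∩ B ⊆ {a, b}) (hQin : Q \ {a, b} ⊆ insideOf (A ∪ B)) :
    insideOf (A ∪ B) \ Q = insideOf (A ∪ Q) ∪ insideOf (B ∪ Q) := by
  have hAQ := chord_inter_left hQin
  have hBQ := chord_inter_right hQin
  obtain ⟨hoA, hoB⟩ := subset_outsideOf_of_chord hA hB hQ hAB hQin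
  have hdis := disjoint_insideOf_of_chord hA hB hQ hAB hQin
  have hA' : ∀ z ∈ insideOf (B ∪ Q), z ∉ A := fun z hz hzA => by
    refine disjoint_left.mp (disjoint_insideOf_outsideOf _) hz (hoA ⟨hzA, ?_⟩)
    rintro (rfl | rfl)
    exacts [hz.1 (Or.inl hB.left_mem), hz.1 (Or.inl hB.right_mem)]
  have hB' : ∀ z ∈ insideOf (A ∪ Q), z ∉ B := fun z hz hzB => by
    refine disjoint_left.mp (disjoint_insideOf_outsideOf _) hz (hoB ⟨hzB, ?_⟩)
    rintro (rfl | rfl)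
    exacts [hz.1 (Or.inl hA.left_mem), hz.1 (Or.inl hA.right_mem)]
  ext z
  constructor
  · rintro ⟨hz, hzQ⟩
    have := (mem_insideOf_theta hA hB hQ hAB hAQ hBQ (fun h => hz.1 (Or.inl h))
        (fun h => hz.1 (Or.inr h)) hzQ).mp hz
    by_contra hcon
    rw [mem_union, not_or] at hcon
    exact this (iff_of_false hcon.1 hcon.2)
  · rintro (hz | hz)
    · refine ⟨(mem_insideOf_theta hA hB hQ hAB hAQ hBQ (fun h => hz.1 (Or.inl h))
        (hB' z hz) (fun h => hz.1 (Or.inr h))).mpr fun h => ?_, fun h => hz.1 (Or.inr h)⟩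
      exact disjoint_left.mp hdis hz (h.mp hz)
    · refine ⟨(mem_insideOf_theta hA hB hQ hAB hAQ hBQ (hA' z hz) (fun h => hz.1 (Or.inl h))
        (fun h => hz.1 (Or.inr h))).mpr fun h => ?_, fun h => hz.1 (Or.inr h)⟩
      exact disjoint_left.mp hdis (h.mpr hz) hz

end Chord

/-- The inside of a Jordan curve is connected. If it were the union of two disjoint open sets, a
straight chord inside one of them would cut the other into pieces enclosed by arcs. -/
theorem IsJordanCurve.isPreconnected_insideOf {C : Set ℂ} (hC : IsJordanCurve C) :
    IsPreconnected (insideOf C) := by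
  have hCc := hC.isCompact
  rw [isPreconnected_iff_subset_of_disjoint]
  intro u v hu hv hcov hdis
  by_contra hcon
  rw [not_or, not_subset, not_subset] at hcon
  obtain ⟨⟨y, hy, hyu⟩, ⟨x, hx, hxv⟩⟩ := hcon
  set U := insideOf C ∩ u with hU
  set V := insideOf C ∩ v with hV
  have hUo : IsOpen U := (isOpen_insideOf hCc).inter hu
  have hVo : IsOpen V := (isOpen_insideOf hCc).inter hv
  have hUV : Disjoint U V := disjoint_left.mpr fun z hz hz' => by
    have : z ∈ insideOf C ∩ (u ∩ v) := ⟨hz.1, hz.2, hz'.2⟩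
    rw [hdis] at this; exact this
  have hxU : x ∈ U := ⟨hx, (hcov hx).resolve_right hxv⟩
  have hyV : y ∈ V := ⟨hy, (hcov hy).resolve_left hyu⟩
  have hclU : closure U ⊆ U ∪ C := fun z hz => by
    refine (closure_insideOf_subset hCc (closure_mono inter_subset_left hz)).imp_left fun hz' => ?_
    refine ⟨hz', (hcov hz').resolve_right fun h => ?_⟩
    exact (hUV.closure_left hVo).le_bot ⟨hz, hz', h⟩
  have hclV : closure V ⊆ V ∪ C := fun z hz => by
    refine (closure_insideOf_subset hCc (closure_mono inter_subset_left hz)).imp_left fun hz' => ?_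
    refine ⟨hz', (hcov hz').resolve_left fun h => ?_⟩
    exact (hUV.symm.closure_left hUo).le_bot ⟨hz, hz', h⟩
  obtain ⟨R, hR0, hR⟩ := ((isBounded_insideOf hCc).subset
    (inter_subset_left (t := u))).subset_ball_lt 0 x
  have hec : Continuous fun t : ℝ => x + t := by fun_prop
  obtain ⟨t₁, t₂, -, h1, h2, -, ha, hb, hin⟩ := exists_maximal_excursion
    (e := fun t : ℝ => x + t) (s₀ := -R) (t₀ := 0) (s₁ := R) hUo hec.continuousOn (by linarith)
    hR0.le
    (fun h => by simpa [abs_of_pos hR0] using hR h) (by simpa using hxU)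
    (fun h => by simpa [abs_of_pos hR0] using hR h)
  have hei : Function.Injective fun t : ℝ => x + t := fun s t hst => by
    simpa using hst
  obtain ⟨hQ, hQU⟩ := IsArc.of_excursion (h1.trans h2) hec.continuousOn hei.injOn hin
  set Q := (fun t : ℝ => x + t) '' Icc t₁ t₂
  set a : ℂ := x + t₁
  set b : ℂ := x + t₂
  have hcl : Q ⊆ closure U := hQ.subset_closure_interior.trans (closure_mono hQU)
  have haC : a ∈ C := (hclU (hcl hQ.left_mem)).resolve_left ha
  have hbC : b ∈ C := (hclU (hcl hQ.right_mem)).resolve_left hb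
  obtain ⟨A, B, hA, hB, rfl, hAB⟩ := hC.exists_arcs haC hbC hQ.ne
  have hQin : Q \ {a, b} ⊆ insideOf (A ∪ B) := hQU.trans inter_subset_left
  -- one half of the argument, stated so as to apply to both arcs
  have key : ∀ A B : Set ℂ, IsArc A a b → IsArc B a b → A ∩ B ⊆ {a, b} →
      Q \ {a, b} ⊆ insideOf (A ∪ B) → closure V ⊆ V ∪ (A ∪ B) → V ⊆ insideOf (A ∪ B) →
      insideOf (A ∪ Q) ∩ V = ∅ := by
    intro A B hA hB hAB hQin hclV hVin
    have h1 : IsCompact (A ∪ Q) := hA.isCompact.union hQ.isCompact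
    have hoB := (subset_outsideOf_of_chord hA hB hQ hAB hQin).2
    refine hA.eq_empty_of_frontier_subset ((isBounded_insideOf h1).subset inter_subset_left)
      (disjoint_left.mpr fun z hz hzA => hz.1.1 (Or.inl hzA)) fun z hz => ?_
    obtain ⟨hz1, hz2, hz3, hz4⟩ := frontier_inter_subset_of_closure (isOpen_insideOf h1) hVo
      (closure_insideOf_subset h1) hclV hz
    by_contra hzA
    have hzab : z ∉ ({a, b} : Set ℂ) := by
      rintro (rfl | rfl)
      exacts [hzA hA.left_mem, hzA hA.right_mem]
    have : z ∈ Q ∨ z ∈ B := by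
      rcases hz1 with (h | h) | (h | h)
      exacts [absurd h hzA, Or.inl h, absurd h hzA, Or.inr h]
    rcases this with h | h
    · exact (hUV.symm.closure_left hUo).le_bot
        ⟨closure_mono inter_subset_right hz4, hQU ⟨h, hzab⟩⟩
    · have ho := hoB ⟨h, hzab⟩
      exact hz2.elim (fun h' => disjoint_left.mp (disjoint_insideOf_outsideOf _) h' ho) ho.1
  have k1 := key A B hA hB hAB.subset hQin hclV inter_subset_left
  have k2 := key B A hB hA (by rw [inter_comm]; exact hAB.subset) (by rwa [union_comm])
    (by rwa [union_comm B A]) (by rw [union_comm]; exact inter_subset_left)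
  have hyQ : y ∉ Q := fun hyQ => (hUV.closure_left hVo).le_bot ⟨hcl hyQ, hyV⟩
  have : y ∈ insideOf (A ∪ Q) ∪ insideOf (B ∪ Q) := by
    rw [← insideOf_diff_chord hA hB hQ hAB.subset hQin]
    exact ⟨hy, hyQ⟩
  rcases this with h | h
  · exact (k1 ▸ ⟨h, hyV⟩ : y ∈ (∅ : Set ℂ))
  · exact (k2 ▸ ⟨h, hyV⟩ : y ∈ (∅ : Set ℂ))

/-! ### Closed disks in the plane -/

/-- `R` is a closed disk with boundary circle `C`. -/
def IsDiskWithBoundary (C R : Set ℂ) : Prop :=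
  ∃ f : ℂ → ℂ, ContinuousOn f (Metric.closedBall 0 1) ∧ InjOn f (Metric.closedBall 0 1) ∧
    f '' Metric.sphere 0 1 = C ∧ f '' Metric.closedBall 0 1 = R

/-- The cone over a self-map of the unit circle. -/
noncomputable def circleCone (h : ℂ → ℂ) (x : ℂ) : ℂ := ‖x‖ • h (‖x‖⁻¹ • x)

section Cone
variable {h : ℂ → ℂ}

theorem norm_inv_smul_mem_sphere {x : ℂ} (hx : x ≠ 0) : ‖x‖⁻¹ • x ∈ Metric.sphere (0 : ℂ) 1 := by
  rw [mem_sphere_zero_iff_norm, norm_smul, norm_inv, norm_norm,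
    inv_mul_cancel₀ (norm_ne_zero_iff.mpr hx)]

theorem norm_circleCone (hm : MapsTo h (Metric.sphere 0 1) (Metric.sphere 0 1)) (x : ℂ) :
    ‖circleCone h x‖ = ‖x‖ := by
  by_cases hx : x = 0
  · simp [circleCone, hx]
  · have := hm (norm_inv_smul_mem_sphere hx)
    rw [mem_sphere_zero_iff_norm] at this
    rw [circleCone, norm_smul, this, norm_norm, mul_one]

theorem circleCone_of_mem_sphere {x : ℂ} (hx : x ∈ Metric.sphere (0 : ℂ) 1) :
    circleCone h x = h x := by
  rw [mem_sphere_zero_iff_norm] at hx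
  simp [circleCone, hx]

theorem continuous_circleCone (hm : MapsTo h (Metric.sphere 0 1) (Metric.sphere 0 1))
    (hc : ContinuousOn h (Metric.sphere 0 1)) : Continuous (circleCone h) := by
  rw [continuous_iff_continuousAt]
  intro x
  by_cases hx : x = 0
  · subst hx
    have h0 : circleCone h 0 = 0 := by simp [circleCone]
    rw [ContinuousAt, h0]
    refine squeeze_zero_norm (fun y => (norm_circleCone hm y).le) ?_
    simpa using (continuous_norm (E := ℂ)).tendsto 0
  · have : ContinuousOn (circleCone h) {0}ᶜ := by
      have hn : ContinuousOn (fun x : ℂ => ‖x‖⁻¹) {0}ᶜ :=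
        continuous_norm.continuousOn.inv₀ fun y hy => norm_ne_zero_iff.mpr hy
      exact continuous_norm.continuousOn.smul (hc.comp (hn.smul continuousOn_id)
        fun y hy => norm_inv_smul_mem_sphere hy)
    exact this.continuousAt (isOpen_compl_singleton.mem_nhds hx)

theorem circleCone_injective (hm : MapsTo h (Metric.sphere 0 1) (Metric.sphere 0 1))
    (hi : InjOn h (Metric.sphere 0 1)) : Function.Injective (circleCone h) := by
  intro x y hxy
  have hn : ‖x‖ = ‖y‖ := by rw [← norm_circleCone hm x, hxy, norm_circleCone hm]
  by_cases hx : x = 0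
  · rw [hx, norm_zero] at hn
    rw [hx, norm_eq_zero.mp hn.symm]
  · have hy : y ≠ 0 := norm_ne_zero_iff.mp (hn ▸ norm_ne_zero_iff.mpr hx)
    have hn0 := norm_ne_zero_iff.mpr hy
    rw [circleCone, circleCone, hn] at hxy
    have h1 := hi (hn ▸ norm_inv_smul_mem_sphere hx) (norm_inv_smul_mem_sphere hy)
      (smul_right_injective ℂ hn0 hxy)
    exact smul_right_injective ℂ (inv_ne_zero hn0) h1

theorem circleCone_image_closedBall (hm : MapsTo h (Metric.sphere 0 1) (Metric.sphere 0 1))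
    (hs : SurjOn h (Metric.sphere 0 1) (Metric.sphere 0 1)) :
    circleCone h '' Metric.closedBall 0 1 = Metric.closedBall 0 1 := by
  apply subset_antisymm
  · rintro _ ⟨x, hx, rfl⟩
    rw [mem_closedBall_zero_iff] at hx ⊢
    rwa [norm_circleCone hm]
  · intro y hy
    by_cases hy0 : y = 0
    · exact ⟨0, by simp, by simp [circleCone, hy0]⟩
    · obtain ⟨u, hu, huy⟩ := hs (norm_inv_smul_mem_sphere hy0)
      have hu1 : ‖u‖ = 1 := by simpa using hu
      have hn0 := norm_ne_zero_iff.mpr hy0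
      refine ⟨‖y‖ • u, ?_, ?_⟩
      · rw [mem_closedBall_zero_iff] at hy ⊢
        rwa [norm_smul, norm_norm, hu1, mul_one]
      · rw [circleCone, norm_smul, norm_norm, hu1, mul_one, inv_smul_smul₀ hn0, huy,
          smul_inv_smul₀ hn0]

end Cone

/-- The image of a plane convex body under an embedding is a disk. -/
theorem IsDiskWithBoundary.of_convex {E : Type*} [NormedAddCommGroup E] [NormedSpace ℝ E]
    (L : ℂ ≃ₗᵢ[ℝ] E) {K : Set E} (hK : Convex ℝ K) (hKc : IsCompact K) (hKi : (interior K).Nonempty)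
    {f : E → ℂ} (hf : ContinuousOn f K) (hi : InjOn f K) :
    IsDiskWithBoundary (f '' frontier K) (f '' K) := by
  obtain ⟨e, -, he, hef⟩ := exists_homeomorph_image_interior_closure_frontier_eq_unitBall hK hKi
    hKc.isBounded
  rw [hKc.isClosed.closure_eq] at he
  have him : (fun z => e.symm (L z)) '' Metric.closedBall 0 1 = K := by
    rw [← image_image e.symm L, L.image_closedBall, map_zero, ← he, image_image]; simp
  have him' : (fun z => e.symm (L z)) '' Metric.sphere 0 1 = frontier K := by
    rw [← image_image e.symm L, L.image_sphere, map_zero, ← hef, image_image]; simp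
  refine ⟨fun z => f (e.symm (L z)), hf.comp (by fun_prop) (mapsTo_iff_image_subset.mpr him.subset),
    hi.comp (e.symm.injective.comp L.injective).injOn (mapsTo_iff_image_subset.mpr him.subset),
    ?_, ?_⟩
  · rw [← image_image f, him']
  · rw [← image_image f, him]

/-- A disk can be reparametrized over any convex body with any prescribed parametrization of its
boundary, by coning. -/
theorem IsDiskWithBoundary.exists_param {C R K : Set ℂ} (hD : IsDiskWithBoundary C R)
    (hK : Convex ℝ K) (hKc : IsCompact K) (hKi : (interior K).Nonempty) {β : ℂ → ℂ}
    (hβ : ContinuousOn β (frontier K)) (hβi : InjOn β (frontier K)) (hβC : β '' frontier K = C) :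
    ∃ F : ℂ → ℂ, ContinuousOn F K ∧ InjOn F K ∧ F '' K = R ∧ EqOn F β (frontier K) := by
  obtain ⟨f, hf, hfi, hfC, hfR⟩ := hD
  obtain ⟨e, -, he, hef⟩ := exists_homeomorph_image_interior_closure_frontier_eq_unitBall hK hKi
    hKc.isBounded
  rw [hKc.isClosed.closure_eq] at he
  have hfi' := hfi.mono Metric.sphere_subset_closedBall
  set g := Function.invFunOn f (Metric.sphere 0 1) with hg
  have hgc : ContinuousOn g C := hfC ▸ continuousOn_invFunOn_of_isCompact
    (isCompact_sphere (0 : ℂ) 1) (hf.mono Metric.sphere_subset_closedBall) hfi'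
  have hgm : MapsTo g C (Metric.sphere 0 1) := fun y hy =>
    Function.invFunOn_mem (by rw [← hfC] at hy; simpa using hy)
  have hfg : ∀ y ∈ C, f (g y) = y := fun y hy =>
    Function.invFunOn_eq (by rw [← hfC] at hy; simpa using hy)
  have hgf : ∀ x ∈ Metric.sphere (0 : ℂ) 1, g (f x) = x := hfi'.leftInvOn_invFunOn
  have hes : MapsTo e.symm (Metric.sphere 0 1) (frontier K) := by
    rw [← hef]; rintro _ ⟨x, hx, rfl⟩; simpa
  have hem : ∀ x ∈ frontier K, e x ∈ Metric.sphere (0 : ℂ) 1 := fun x hx => hef ▸ ⟨x, hx, rfl⟩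
  have hβm : MapsTo β (frontier K) C := mapsTo_iff_image_subset.mpr hβC.subset
  set h : ℂ → ℂ := fun x => g (β (e.symm x)) with hh
  have hhm : MapsTo h (Metric.sphere 0 1) (Metric.sphere 0 1) := fun x hx => hgm (hβm (hes hx))
  have hhc : ContinuousOn h (Metric.sphere 0 1) :=
    hgc.comp (hβ.comp e.symm.continuous.continuousOn hes) (hβm.comp hes)
  have hhi : InjOn h (Metric.sphere 0 1) := fun x hx y hy hxy => by
    have := congrArg f hxy
    simp only [hh, hfg _ (hβm (hes hx)), hfg _ (hβm (hes hy))] at this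
    exact e.symm.injective (hβi (hes hx) (hes hy) this)
  have hhs : SurjOn h (Metric.sphere 0 1) (Metric.sphere 0 1) := fun y hy => by
    have : f y ∈ β '' frontier K := by rw [hβC, ← hfC]; exact ⟨y, hy, rfl⟩
    obtain ⟨x, hx, hxy⟩ := this
    exact ⟨e x, hem x hx, by simp only [hh, e.symm_apply_apply, hxy, hgf y hy]⟩
  have hcone := circleCone_image_closedBall hhm hhs
  have hcm : MapsTo (fun x => circleCone h (e x)) K (Metric.closedBall 0 1) := fun x hx => by
    rw [← hcone]; exact ⟨e x, he ▸ ⟨x, hx, rfl⟩, rfl⟩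
  refine ⟨fun x => f (circleCone h (e x)), hf.comp
    ((continuous_circleCone hhm hhc).comp e.continuous).continuousOn hcm,
    hfi.comp ((circleCone_injective hhm hhi).comp e.injective).injOn hcm, ?_, fun x hx => ?_⟩
  · rw [← image_image f, ← image_image (circleCone h), he, hcone, hfR]
  · have := hem x hx
    simp only [circleCone_of_mem_sphere this, hh, e.symm_apply_apply, hfg _ (hβm hx)]

/-- The closed upper half disk. -/
def upperHalfDisk : Set ℂ := {z | ‖z‖ ≤ 1 ∧ 0 ≤ z.im}

theorem convex_upperHalfDisk : Convex ℝ upperHalfDisk := by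
  have h1 : upperHalfDisk = Metric.closedBall 0 1 ∩ {z : ℂ | 0 ≤ z.im} := by
    ext z; simp [upperHalfDisk]
  rw [h1]
  exact (convex_closedBall 0 1).inter (convex_halfSpace_im_ge 0)

theorem isCompact_upperHalfDisk : IsCompact upperHalfDisk := by
  have h1 : upperHalfDisk = Metric.closedBall 0 1 ∩ {z : ℂ | 0 ≤ z.im} := by
    ext z; simp [upperHalfDisk]
  rw [h1]
  exact (isCompact_closedBall 0 1).inter_right (isClosed_le continuous_const Complex.continuous_im)

theorem interior_upperHalfDisk : interior upperHalfDisk = {z : ℂ | ‖z‖ < 1 ∧ 0 < z.im} := by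
  have h1 : upperHalfDisk = Metric.closedBall 0 1 ∩ {z : ℂ | 0 ≤ z.im} := by
    ext z; simp [upperHalfDisk]
  rw [h1, interior_inter, interior_closedBall _ one_ne_zero, Complex.interior_setOfPred_le_im]
  ext z; simp

theorem frontier_upperHalfDisk : frontier upperHalfDisk =
    {z : ℂ | ‖z‖ ≤ 1 ∧ z.im = 0} ∪ {z : ℂ | ‖z‖ = 1 ∧ 0 ≤ z.im} := by
  rw [isCompact_upperHalfDisk.isClosed.frontier_eq, interior_upperHalfDisk]
  ext z
  simp only [upperHalfDisk, Set.mem_sdiff, mem_ofPred_eq, not_and, not_lt, mem_union]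
  constructor
  · rintro ⟨⟨h1, h2⟩, h3⟩
    rcases h1.lt_or_eq with h | h
    · exact Or.inl ⟨h1, le_antisymm (h3 h) h2⟩
    · exact Or.inr ⟨h, h2⟩
  · rintro (⟨h1, h2⟩ | ⟨h1, h2⟩)
    · exact ⟨⟨h1, h2.ge⟩, fun _ => h2.le⟩
    · exact ⟨⟨h1.le, h2⟩, fun h => absurd h1 h.ne⟩

theorem Complex.re_sq_add_im_sq_eq_one {z : ℂ} (hz : ‖z‖ = 1) : z.re ^ 2 + z.im ^ 2 = 1 := by
  have := Complex.normSq_eq_norm_sq z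
  rw [hz, Complex.normSq_apply] at this
  linarith

/-- A disk bounded by two arcs, parametrized over the upper half disk so that one of the arcs lies
over the diameter in a prescribed way. -/
theorem IsDiskWithBoundary.exists_halfDisk_param {A R : Set ℂ} {a b : ℂ} {q : ℝ → ℂ}
    (hA : IsArc A a b) (hq : ContinuousOn q (Icc 0 1)) (hqi : InjOn q (Icc 0 1)) (hq0 : q 0 = a)
    (hq1 : q 1 = b) (hAQ : A ∩ q '' Icc 0 1 ⊆ {a, b})
    (hD : IsDiskWithBoundary (A ∪ q '' Icc 0 1) R) :
    ∃ F : ℂ → ℂ, ContinuousOn F upperHalfDisk ∧ InjOn F upperHalfDisk ∧ F '' upperHalfDisk = R ∧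
      (∀ z : ℂ, ‖z‖ ≤ 1 → z.im = 0 → F z = q ((1 - z.re) / 2)) ∧
      F '' {z : ℂ | ‖z‖ = 1 ∧ 0 ≤ z.im} = A := by
  obtain ⟨α, hα, hαi, rfl, rfl, rfl⟩ := hA
  set s : ℂ → ℝ := fun z => (1 - z.re) / 2 with hs
  have hsc : Continuous s := by fun_prop
  have hsm : ∀ z : ℂ, ‖z‖ ≤ 1 → s z ∈ Icc (0 : ℝ) 1 := fun z hz => by
    have := abs_le.mp ((Complex.abs_re_le_norm z).trans hz)
    simp only [hs, mem_Icc]; constructor <;> linarith [this.1, this.2]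
  set β : ℂ → ℂ := fun z => if z.im = 0 then q (s z) else α (s z) with hβ
  have hβ1 : EqOn β (fun z => q (s z)) {z : ℂ | ‖z‖ ≤ 1 ∧ z.im = 0} := fun z hz => if_pos hz.2
  have hβ2 : EqOn β (fun z => α (s z)) {z : ℂ | ‖z‖ = 1 ∧ 0 ≤ z.im} := by
    intro z hz
    by_cases h0 : z.im = 0
    · have h1 := Complex.re_sq_add_im_sq_eq_one hz.1
      rw [h0] at h1
      have h2 : (z.re - 1) * (z.re + 1) = 0 := by linarith
      simp only [hβ, h0, if_true]
      rcases mul_eq_zero.mp h2 with h | h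
      · have : s z = 0 := by simp only [hs]; linarith
        rw [this, hq0]
      · have : s z = 1 := by simp only [hs]; linarith
        rw [this, hq1]
    · simp only [hβ, h0, if_false]
  have hcl1 : IsClosed {z : ℂ | ‖z‖ ≤ 1 ∧ z.im = 0} :=
    (isClosed_le continuous_norm continuous_const).inter
      (isClosed_eq Complex.continuous_im continuous_const)
  have hcl2 : IsClosed {z : ℂ | ‖z‖ = 1 ∧ 0 ≤ z.im} :=
    (isClosed_eq continuous_norm continuous_const).inter
      (isClosed_le continuous_const Complex.continuous_im)
  have hβc : ContinuousOn β (frontier upperHalfDisk) := by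
    rw [frontier_upperHalfDisk]
    exact ContinuousOn.union_of_isClosed
      ((hq.comp hsc.continuousOn fun z hz => hsm z hz.1).congr hβ1)
      ((hα.comp hsc.continuousOn fun z hz => hsm z hz.1.le).congr hβ2) hcl1 hcl2
  have himg2 : β '' {z : ℂ | ‖z‖ = 1 ∧ 0 ≤ z.im} = α '' Icc 0 1 := by
    rw [hβ2.image_eq]
    apply subset_antisymm
    · rintro _ ⟨z, hz, rfl⟩; exact ⟨_, hsm z hz.1.le, rfl⟩
    · rintro _ ⟨t, ht, rfl⟩
      refine ⟨⟨1 - 2 * t, 2 * √(t * (1 - t))⟩, ⟨?_, by positivity⟩, ?_⟩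
      · rw [← sq_eq_sq₀ (norm_nonneg _) zero_le_one, ← Complex.normSq_eq_norm_sq,
          Complex.normSq_apply]
        have := Real.mul_self_sqrt (mul_nonneg ht.1 (by linarith [ht.2] : (0 : ℝ) ≤ 1 - t))
        dsimp only
        nlinarith
      · simp only [hs]; congr 1; ring
  have himg1 : β '' {z : ℂ | ‖z‖ ≤ 1 ∧ z.im = 0} = q '' Icc 0 1 := by
    rw [hβ1.image_eq]
    apply subset_antisymm
    · rintro _ ⟨z, hz, rfl⟩; exact ⟨_, hsm z hz.1, rfl⟩
    · rintro _ ⟨t, ht, rfl⟩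
      refine ⟨((1 - 2 * t : ℝ) : ℂ), ⟨?_, by simp⟩, ?_⟩
      · rw [Complex.norm_real, Real.norm_eq_abs, abs_le]; constructor <;> linarith [ht.1, ht.2]
      · simp only [hs, Complex.ofReal_re]; congr 1; ring
  have hcross : ∀ x y : ℂ, ‖x‖ ≤ 1 → x.im = 0 → ‖y‖ = 1 → 0 < y.im → β x ≠ β y := by
    intro x y hx hx0 hy hy0 h
    rw [hβ1 ⟨hx, hx0⟩, hβ2 ⟨hy, hy0.le⟩] at h
    dsimp only at h
    have : α (s y) ∈ ({α 0, α 1} : Set ℂ) := hAQ ⟨⟨_, hsm y hy.le, rfl⟩, h ▸ ⟨_, hsm x hx, rfl⟩⟩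
    have h1 := Complex.re_sq_add_im_sq_eq_one hy
    have hsy : s y = 0 ∨ s y = 1 := this.imp (fun h => hαi (hsm y hy.le) (by simp) h)
      fun h => hαi (hsm y hy.le) (by simp) h
    rcases hsy with h | h <;> simp only [hs] at h
    · have : y.re = 1 := by linarith
      rw [this] at h1; nlinarith
    · have : y.re = -1 := by linarith
      rw [this] at h1; nlinarith
  have hβi : InjOn β (frontier upperHalfDisk) := by
    rw [frontier_upperHalfDisk]
    intro x hx y hy hxy
    by_cases hx0 : x.im = 0 <;> by_cases hy0 : y.im = 0
    · have hx1 : ‖x‖ ≤ 1 := hx.elim (fun h => h.1) fun h => h.1.le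
      have hy1 : ‖y‖ ≤ 1 := hy.elim (fun h => h.1) fun h => h.1.le
      rw [hβ1 ⟨hx1, hx0⟩, hβ1 ⟨hy1, hy0⟩] at hxy
      have := hqi (hsm x hx1) (hsm y hy1) hxy
      simp only [hs] at this
      exact Complex.ext (by linarith) (hx0.trans hy0.symm)
    · have hx1 : ‖x‖ ≤ 1 := hx.elim (fun h => h.1) fun h => h.1.le
      have hy1 := hy.resolve_left fun h => hy0 h.2
      exact absurd hxy (hcross x y hx1 hx0 hy1.1 (lt_of_le_of_ne hy1.2 (Ne.symm hy0)))
    · have hy1 : ‖y‖ ≤ 1 := hy.elim (fun h => h.1) fun h => h.1.le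
      have hx1 := hx.resolve_left fun h => hx0 h.2
      exact absurd hxy.symm (hcross y x hy1 hy0 hx1.1 (lt_of_le_of_ne hx1.2 (Ne.symm hx0)))
    · have hx1 := hx.resolve_left fun h => hx0 h.2
      have hy1 := hy.resolve_left fun h => hy0 h.2
      rw [hβ2 hx1, hβ2 hy1] at hxy
      have := hαi (hsm x hx1.1.le) (hsm y hy1.1.le) hxy
      simp only [hs] at this
      have hre : x.re = y.re := by linarith
      have e1 := Complex.re_sq_add_im_sq_eq_one hx1.1
      have e2 := Complex.re_sq_add_im_sq_eq_one hy1.1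
      rw [hre] at e1
      exact Complex.ext hre ((sq_eq_sq₀ hx1.2 hy1.2).mp (by linarith))
  have hβC : β '' frontier upperHalfDisk = α '' Icc 0 1 ∪ q '' Icc 0 1 := by
    rw [frontier_upperHalfDisk, image_union, himg1, himg2, union_comm]
  obtain ⟨F, hF, hFi, hFR, hFβ⟩ := hD.exists_param convex_upperHalfDisk isCompact_upperHalfDisk
    (by
      rw [interior_upperHalfDisk]
      refine ⟨Complex.I / 2, ?_, ?_⟩
      · simp; norm_num
      · simp) hβc hβi hβC
  rw [frontier_upperHalfDisk] at hFβ
  refine ⟨F, hF, hFi, hFR, fun z hz hz0 => ?_, ?_⟩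
  · rw [hFβ (Or.inl ⟨hz, hz0⟩), hβ1 ⟨hz, hz0⟩]
  · rw [← himg2]
    exact (hFβ.mono subset_union_right).image_eq

/-- Two disks glued along a boundary arc form a disk. -/
theorem IsDiskWithBoundary.union {A B Q R₁ R₂ : Set ℂ} {a b : ℂ} (hA : IsArc A a b)
    (hB : IsArc B a b) (hQ : IsArc Q a b) (hAQ : A ∩ Q ⊆ {a, b}) (hBQ : B ∩ Q ⊆ {a, b})
    (h₁ : IsDiskWithBoundary (A ∪ Q) R₁) (h₂ : IsDiskWithBoundary (B ∪ Q) R₂) (hR : R₁ ∩ R₂ ⊆ Q) :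
    IsDiskWithBoundary (A ∪ B) (R₁ ∪ R₂) := by
  obtain ⟨q, hq, hqi, rfl, hq0, hq1⟩ := hQ
  obtain ⟨F, hF, hFi, rfl, hFq, hFA⟩ := h₁.exists_halfDisk_param hA hq hqi hq0 hq1 hAQ
  obtain ⟨G, hG, hGi, rfl, hGq, hGB⟩ := h₂.exists_halfDisk_param hB hq hqi hq0 hq1 hBQ
  set conj : ℂ → ℂ := fun z => starRingEnd ℂ z with hconj
  have hcc : Continuous conj := Complex.continuous_conj
  have hcn : ∀ z, ‖conj z‖ = ‖z‖ := Complex.norm_conj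
  have hcim : ∀ z, (conj z).im = -z.im := Complex.conj_im
  have hcre : ∀ z, (conj z).re = z.re := Complex.conj_re
  have hcc2 : ∀ z, conj (conj z) = z := Complex.conj_conj
  set f : ℂ → ℂ := fun z => if 0 ≤ z.im then F z else G (conj z) with hf
  have hf1 : EqOn f F upperHalfDisk := fun z hz => if_pos hz.2
  have hf2 : EqOn f (G ∘ conj) {z | ‖z‖ ≤ 1 ∧ z.im ≤ 0} := by
    rintro z ⟨hz, hz0⟩
    by_cases h0 : 0 ≤ z.im
    · have him : z.im = 0 := le_antisymm hz0 h0
      simp only [hf, h0, if_true, Function.comp_apply]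
      rw [hFq z hz him, hGq (conj z) (by rwa [hcn]) (by rw [hcim, him, neg_zero]), hcre]
    · simp only [hf, h0, if_false, Function.comp_apply]
  have hlow : MapsTo conj {z | ‖z‖ ≤ 1 ∧ z.im ≤ 0} upperHalfDisk := fun z hz =>
    ⟨by rw [hcn]; exact hz.1, by rw [hcim]; linarith [hz.2]⟩
  have hball : Metric.closedBall (0 : ℂ) 1 = upperHalfDisk ∪ {z | ‖z‖ ≤ 1 ∧ z.im ≤ 0} := by
    ext z
    simp only [mem_closedBall_zero_iff, upperHalfDisk, mem_union, mem_ofPred_eq, ← and_or_left]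
    exact ⟨fun h => ⟨h, le_total _ _⟩, fun h => h.1⟩
  have hclow : IsClosed {z : ℂ | ‖z‖ ≤ 1 ∧ z.im ≤ 0} :=
    (isClosed_le continuous_norm continuous_const).inter
      (isClosed_le Complex.continuous_im continuous_const)
  have hconjimg : conj '' {z | ‖z‖ ≤ 1 ∧ z.im ≤ 0} = upperHalfDisk := by
    refine subset_antisymm (mapsTo_iff_image_subset.mp hlow) fun z hz => ⟨conj z, ⟨?_, ?_⟩, hcc2 z⟩
    · rw [hcn]; exact hz.1
    · rw [hcim]; linarith [hz.2]
  have hcross : ∀ x y : ℂ, x ∈ upperHalfDisk → ‖y‖ ≤ 1 → y.im < 0 → F x ≠ G (conj y) := by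
    intro x y hx hy hy0 h
    have hyc := hlow ⟨hy, hy0.le⟩
    obtain ⟨t, ht, htq⟩ := hR ⟨⟨x, hx, rfl⟩, h ▸ ⟨_, hyc, rfl⟩⟩
    have hn : ‖((1 - 2 * t : ℝ) : ℂ)‖ ≤ 1 := by
      rw [Complex.norm_real, Real.norm_eq_abs, abs_le]; constructor <;> linarith [ht.1, ht.2]
    have h1 := hGq ((1 - 2 * t : ℝ) : ℂ) hn (Complex.ofReal_im _)
    rw [Complex.ofReal_re, show (1 - (1 - 2 * t)) / 2 = t by ring, htq, h] at h1
    have h2 := hGi ⟨hn, (Complex.ofReal_im _).ge⟩ hyc h1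
    have h3 := congrArg Complex.im h2
    rw [Complex.ofReal_im, hcim] at h3
    linarith
  refine ⟨f, ?_, ?_, ?_, ?_⟩
  · rw [hball]
    exact ContinuousOn.union_of_isClosed (hF.congr hf1)
      ((hG.comp hcc.continuousOn hlow).congr hf2) isCompact_upperHalfDisk.isClosed hclow
  · intro x hx y hy hxy
    rw [mem_closedBall_zero_iff] at hx hy
    by_cases hx0 : 0 ≤ x.im <;> by_cases hy0 : 0 ≤ y.im <;>
      simp only [hf, hx0, hy0, if_true, if_false] at hxy
    · exact hFi ⟨hx, hx0⟩ ⟨hy, hy0⟩ hxy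
    · exact absurd hxy (hcross x y ⟨hx, hx0⟩ hy (not_le.mp hy0))
    · exact absurd hxy.symm (hcross y x ⟨hy, hy0⟩ hx (not_le.mp hx0))
    · have := hGi (hlow ⟨hx, (not_le.mp hx0).le⟩) (hlow ⟨hy, (not_le.mp hy0).le⟩) hxy
      rw [← hcc2 x, this, hcc2]
  · have hsph : Metric.sphere (0 : ℂ) 1 =
        {z | ‖z‖ = 1 ∧ 0 ≤ z.im} ∪ conj '' {z | ‖z‖ = 1 ∧ 0 ≤ z.im} := by
      ext z
      simp only [mem_sphere_zero_iff_norm, mem_union, mem_ofPred_eq, mem_image]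
      constructor
      · intro h
        rcases le_total 0 z.im with h0 | h0
        · exact Or.inl ⟨h, h0⟩
        · exact Or.inr ⟨conj z, ⟨by rw [hcn, h], by rw [hcim]; linarith⟩, hcc2 z⟩
      · rintro (h | ⟨w, hw, rfl⟩)
        · exact h.1
        · rw [hcn]; exact hw.1
    have e1 : f '' {z | ‖z‖ = 1 ∧ 0 ≤ z.im} = A := by
      rw [← hFA]
      exact image_congr fun z hz => hf1 (show z ∈ upperHalfDisk from ⟨hz.1.le, hz.2⟩)
    have e2 : f '' (conj '' {z | ‖z‖ = 1 ∧ 0 ≤ z.im}) = B := by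
      rw [← hGB, image_image]
      refine image_congr fun z hz => ?_
      rw [hf2 ⟨by rw [hcn]; exact hz.1.le, by rw [hcim]; linarith [hz.2]⟩, Function.comp_apply, hcc2]
    rw [hsph, image_union, e1, e2]
  · rw [hball, image_union, hf1.image_eq, hf2.image_eq, image_comp, hconjimg]

/-! ### A Schoenflies induction -/

theorem IsPreconnected.subset_insideOf {C S : Set ℂ} (hC : IsCompact C) (hS : IsPreconnected S)
    (hd : Disjoint S C) {z : ℂ} (hzS : z ∈ S) (hz : z ∈ insideOf C) : S ⊆ insideOf C := by
  intro w hw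
  by_contra h
  have hsub : S ⊆ insideOf C ∪ outsideOf C := fun x hx =>
    mem_insideOf_or (disjoint_left.mp hd hx)
  have hwo : w ∈ outsideOf C := (hsub hw).resolve_left h
  obtain ⟨y, -, h1, h2⟩ := hS _ _ (isOpen_insideOf hC) (isOpen_outsideOf hC) hsub ⟨z, hzS, hz⟩
    ⟨w, hw, hwo⟩
  exact disjoint_left.mp (disjoint_insideOf_outsideOf C) h1 h2

/-- A Jordan curve in a set `T` with dense complement and finitely many complementary cells bounds a
disk, provided that its inside can be cut along arcs of `T` as long as it meets `T`, and that the
curves whose inside misses `T` bound disks. The induction is on the number of cells inside. -/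
theorem isDiskWithBoundary_of_chords {κ : Type*} [Finite κ] {T I₀ : Set ℂ} {key : ℂ → κ}
    (hT : Dense Tᶜ) (hcell : ∀ k, IsPreconnected {z | z ∉ T ∧ key z = k})
    (hchord : ∀ C, IsJordanCurve C → C ⊆ T → insideOf C ⊆ I₀ → (insideOf C ∩ T).Nonempty →
      ∃ Q a b, IsArc Q a b ∧ Q ⊆ T ∧ a ∈ C ∧ b ∈ C ∧ Q \ {a, b} ⊆ insideOf C)
    (hbase : ∀ C, IsJordanCurve C → C ⊆ T → insideOf C ⊆ I₀ → insideOf C ∩ T = ∅ →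
      IsDiskWithBoundary C (C ∪ insideOf C)) {C : Set ℂ} (hC : IsJordanCurve C) (hCT : C ⊆ T)
    (hCI : insideOf C ⊆ I₀) : IsDiskWithBoundary C (C ∪ insideOf C) := by
  induction hn : (key '' (insideOf C \ T)).ncard using Nat.strong_induction_on generalizing C with
  | _ n ih =>
  subst hn
  rcases (insideOf C ∩ T).eq_empty_or_nonempty with he | hne
  · exact hbase C hC hCT hCI he
  obtain ⟨Q, a, b, hQ, hQT, ha, hb, hQin⟩ := hchord C hC hCT hCI hne
  obtain ⟨A, B, hA, hB, rfl, hAB⟩ := hC.exists_arcs ha hb hQ.ne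
  have hcut : ∀ A B : Set ℂ, IsArc A a b → IsArc B a b → A ∩ B ⊆ {a, b} → A ∪ B ⊆ T →
      Q \ {a, b} ⊆ insideOf (A ∪ B) → insideOf (A ∪ B) ⊆ I₀ →
      (key '' (insideOf (A ∪ Q) \ T)).ncard < (key '' (insideOf (A ∪ B) \ T)).ncard ∧
      IsJordanCurve (A ∪ Q) ∧ A ∪ Q ⊆ T ∧ insideOf (A ∪ Q) ⊆ I₀ := by
    intro A B hA hB hAB hCT hQin hCI
    have hJA := IsJordanCurve.of_arcs hA hQ (chord_inter_left hQin)
    have hJB := IsJordanCurve.of_arcs hB hQ (chord_inter_right hQin)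
    have hdiff := insideOf_diff_chord hA hB hQ hAB hQin
    have hsubA : insideOf (A ∪ Q) ⊆ insideOf (A ∪ B) := fun x hx =>
      (hdiff.symm.subset (Or.inl hx)).1
    have hsubB : insideOf (B ∪ Q) ⊆ insideOf (A ∪ B) := fun x hx =>
      (hdiff.symm.subset (Or.inr hx)).1
    have hAT : A ∪ Q ⊆ T := union_subset (subset_union_left.trans hCT) hQT
    refine ⟨?_, hJA, hAT, hsubA.trans hCI⟩
    obtain ⟨z, hzB, hzT⟩ := hT.inter_open_nonempty _ (isOpen_insideOf hJB.isCompact)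
      hJB.insideOf_nonempty
    refine ncard_lt_ncard ⟨image_mono (Set.sdiff_subset_sdiff_left hsubA), fun h => ?_⟩ (toFinite _)
    obtain ⟨w, ⟨hwA, hwT⟩, hwz⟩ := h ⟨z, ⟨hsubB hzB, hzT⟩, rfl⟩
    have hd : Disjoint {x | x ∉ T ∧ key x = key z} (A ∪ Q) :=
      disjoint_left.mpr fun x hx hxA => hx.1 (hAT hxA)
    exact disjoint_left.mp (disjoint_insideOf_of_chord hA hB hQ hAB hQin)
      ((hcell (key z)).subset_insideOf hJA.isCompact hd ⟨hwT, hwz⟩ hwA ⟨hzT, rfl⟩) hzB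
  obtain ⟨hlt₁, hJ₁, hT₁, hI₁⟩ := hcut A B hA hB hAB.subset hCT hQin hCI
  obtain ⟨hlt₂, hJ₂, hT₂, hI₂⟩ := hcut B A hB hA (by rw [inter_comm, hAB])
    (by rwa [union_comm]) (by rwa [union_comm]) (by rwa [union_comm])
  rw [union_comm B A] at hlt₂
  have hD₁ := ih _ hlt₁ hJ₁ hT₁ hI₁ rfl
  have hD₂ := ih _ hlt₂ hJ₂ hT₂ hI₂ rfl
  obtain ⟨hAo, hBo⟩ := subset_outsideOf_of_chord hA hB hQ hAB.subset hQin
  have hdis := disjoint_insideOf_of_chord hA hB hQ hAB.subset hQin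
  have hends : ({a, b} : Set ℂ) ⊆ Q := by
    rintro x (rfl | rfl)
    exacts [hQ.left_mem, hQ.right_mem]
  have hdiff := insideOf_diff_chord hA hB hQ hAB.subset hQin
  have hR : (A ∪ Q ∪ insideOf (A ∪ Q)) ∩ (B ∪ Q ∪ insideOf (B ∪ Q)) ⊆ Q := by
    rintro x ⟨(h1 | h1) | h1, h2⟩
    · by_contra hxQ
      have hxe : x ∉ ({a, b} : Set ℂ) := fun h => hxQ (hends h)
      rcases h2 with (h2 | h2) | h2
      · exact hxe (hAB.subset ⟨h1, h2⟩)
      · exact hxQ h2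
      · exact disjoint_left.mp (disjoint_insideOf_outsideOf _) h2 (hAo ⟨h1, hxe⟩)
    · exact h1
    · by_contra hxQ
      have hxe : x ∉ ({a, b} : Set ℂ) := fun h => hxQ (hends h)
      rcases h2 with (h2 | h2) | h2
      · exact disjoint_left.mp (disjoint_insideOf_outsideOf _) h1 (hBo ⟨h2, hxe⟩)
      · exact hxQ h2
      · exact disjoint_left.mp hdis h1 h2
  have hfin := IsDiskWithBoundary.union hA hB hQ (chord_inter_left hQin) (chord_inter_right hQin)
    hD₁ hD₂ hR
  convert hfin using 1
  ext x
  have h1 := Set.ext_iff.mp hdiff x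
  have h2 : x ∈ Q → x ∈ A ∪ B ∪ insideOf (A ∪ B) := by
    intro hx
    by_cases hxe : x ∈ ({a, b} : Set ℂ)
    · rcases hxe with rfl | rfl
      exacts [Or.inl (Or.inl hA.left_mem), Or.inl (Or.inl hA.right_mem)]
    · exact Or.inr (hQin ⟨hx, hxe⟩)
  simp only [mem_union, Set.mem_sdiff] at h1 h2 ⊢
  tauto

/-! ### The sphere as the double cover of the projective plane -/

/-- The unit sphere in `ℝ × ℝ²`, with the Euclidean norm. -/
abbrev Sphere2 : Type := Metric.sphere (0 : WithLp 2 (ℝ × EuclideanSpace ℝ (Fin 2))) 1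

/-- The coordinate of a point of the sphere on the axis through the poles. -/
def Sphere2.height (x : Sphere2) : ℝ := (x : WithLp 2 (ℝ × EuclideanSpace ℝ (Fin 2))).fst

/-- The orthogonal projection of a point of the sphere to the equatorial plane. -/
def Sphere2.shadow (x : Sphere2) : EuclideanSpace ℝ (Fin 2) :=
  (x : WithLp 2 (ℝ × EuclideanSpace ℝ (Fin 2))).snd

namespace Sphere2

theorem continuous_height : Continuous height :=
  (WithLp.continuous_fst 2 ℝ (EuclideanSpace ℝ (Fin 2))).comp continuous_subtype_val

theorem continuous_shadow : Continuous shadow :=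
  (WithLp.continuous_snd 2 ℝ (EuclideanSpace ℝ (Fin 2))).comp continuous_subtype_val

@[simp] theorem height_neg (x : Sphere2) : height (-x) = -height x := rfl

@[simp] theorem shadow_neg (x : Sphere2) : shadow (-x) = -shadow x := rfl

theorem height_sq_add (x : Sphere2) : height x ^ 2 + ‖shadow x‖ ^ 2 = 1 := by
  have h := WithLp.prod_norm_sq_eq_of_L2 (x : WithLp 2 (ℝ × EuclideanSpace ℝ (Fin 2)))
  rw [norm_eq_of_mem_sphere x, Real.norm_eq_abs, sq_abs] at h
  rw [height, shadow]
  linarith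

theorem norm_shadow_le (x : Sphere2) : ‖shadow x‖ ≤ 1 := by
  nlinarith [height_sq_add x, sq_nonneg (height x), norm_nonneg (shadow x)]

theorem ext_coords {x y : Sphere2} (h : height x = height y) (h' : shadow x = shadow y) :
    x = y := by
  apply Subtype.ext
  apply (WithLp.equiv 2 _).injective
  exact Prod.ext h h'

theorem height_eq_zero_iff {x : Sphere2} : height x = 0 ↔ ‖shadow x‖ = 1 := by
  have := height_sq_add x
  constructor
  · intro h
    rw [h] at this
    nlinarith [norm_nonneg (shadow x)]
  · intro h
    rw [h] at this
    nlinarith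

/-- On the closed upper hemisphere the shadow determines the point. -/
theorem eq_of_shadow_eq {x y : Sphere2} (hx : 0 ≤ height x) (hy : 0 ≤ height y)
    (h : shadow x = shadow y) : x = y := by
  refine ext_coords ?_ h
  have h1 := height_sq_add x
  have h2 := height_sq_add y
  rw [h] at h1
  exact (sq_eq_sq₀ hx hy).mp (by linarith)

theorem ne_neg (x : Sphere2) : x ≠ -x := by
  intro h
  have h1 : height x = -height x := congrArg height h
  have h2 : shadow x = -shadow x := congrArg shadow h
  have h3 := height_sq_add x
  rw [eq_neg_iff_add_eq_zero, ← two_smul ℝ, smul_eq_zero_iff_right two_ne_zero] at h1 h2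
  simp [h1, h2] at h3

/-- The point of the closed upper hemisphere above a point of the disk. -/
noncomputable def lift (z : UnitDisk) : Sphere2 :=
  ⟨WithLp.toLp 2 (√(1 - ‖(z : EuclideanSpace ℝ (Fin 2))‖ ^ 2), z), by
    have hz : ‖(z : EuclideanSpace ℝ (Fin 2))‖ ≤ 1 := mem_closedBall_zero_iff.mp z.2
    have h : 0 ≤ 1 - ‖(z : EuclideanSpace ℝ (Fin 2))‖ ^ 2 := by
      nlinarith [norm_nonneg (z : EuclideanSpace ℝ (Fin 2))]
    rw [mem_sphere_zero_iff_norm, ← sq_eq_sq₀ (norm_nonneg _) zero_le_one,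
      WithLp.prod_norm_sq_eq_of_L2]
    simp [Real.sq_sqrt h]⟩

@[simp] theorem height_lift (z : UnitDisk) :
    height (lift z) = √(1 - ‖(z : EuclideanSpace ℝ (Fin 2))‖ ^ 2) := rfl

@[simp] theorem shadow_lift (z : UnitDisk) : shadow (lift z) = z := rfl

theorem height_lift_nonneg (z : UnitDisk) : 0 ≤ height (lift z) := Real.sqrt_nonneg _

theorem continuous_lift : Continuous lift := by
  refine Continuous.subtype_mk ((WithLp.prod_continuous_toLp 2 ℝ (EuclideanSpace ℝ (Fin 2))).comp
    (Continuous.prodMk ?_ continuous_subtype_val)) _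
  exact (continuous_const.sub (continuous_subtype_val.norm.pow 2)).sqrt

/-- The shadow of a point, as a point of the disk. -/
noncomputable def diskShadow (x : Sphere2) : UnitDisk :=
  ⟨shadow x, by simpa using norm_shadow_le x⟩

theorem continuous_diskShadow : Continuous diskShadow := continuous_shadow.subtype_mk _

end Sphere2

open Sphere2

theorem RP2.mk_eq_mk_iff {z w : UnitDisk} : RP2.mk z = RP2.mk w ↔ z = w ∨
    (‖(z : EuclideanSpace ℝ (Fin 2))‖ = 1 ∧
      (w : EuclideanSpace ℝ (Fin 2)) = -(z : EuclideanSpace ℝ (Fin 2))) :=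
  ⟨fun h => Quotient.exact h, fun h => Quotient.sound h⟩

theorem RP2.continuous_mk : Continuous RP2.mk := continuous_quotient_mk'

/-- The double cover of the projective plane by the sphere: the upper hemisphere is projected to
the disk, and the lower one is first moved to the upper one by the antipodal map. -/
noncomputable def RP2.proj (x : Sphere2) : RP2 :=
  if 0 ≤ height x then RP2.mk (diskShadow x) else RP2.mk (diskShadow (-x))

namespace RP2

theorem proj_of_nonneg {x : Sphere2} (h : 0 ≤ height x) : proj x = mk (diskShadow x) := if_pos h

theorem mk_diskShadow_neg {x : Sphere2} (h : height x = 0) :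
    mk (diskShadow x) = mk (diskShadow (-x)) :=
  mk_eq_mk_iff.mpr (Or.inr ⟨height_eq_zero_iff.mp h, rfl⟩)

theorem proj_of_nonpos {x : Sphere2} (h : height x ≤ 0) : proj x = mk (diskShadow (-x)) := by
  by_cases h0 : 0 ≤ height x
  · rw [proj_of_nonneg h0, mk_diskShadow_neg (le_antisymm h h0)]
  · exact if_neg h0

@[simp] theorem proj_neg (x : Sphere2) : proj (-x) = proj x := by
  rcases le_total 0 (height x) with h | h
  · rw [proj_of_nonneg h, proj_of_nonpos (by simpa using h), neg_neg]
  · rw [proj_of_nonpos h, proj_of_nonneg (by simpa using h)]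

theorem continuous_proj : Continuous proj :=
  Continuous.if_le (continuous_mk.comp continuous_diskShadow)
    (continuous_mk.comp (continuous_diskShadow.comp continuous_neg)) continuous_const
    continuous_height fun _ h => mk_diskShadow_neg h.symm

@[simp] theorem proj_lift (z : UnitDisk) : proj (lift z) = mk z := by
  rw [proj_of_nonneg (height_lift_nonneg z)]
  rfl

theorem proj_surjective : Function.Surjective proj := fun q => by
  induction q using Quotient.inductionOn with
  | _ z => exact ⟨lift z, proj_lift z⟩

theorem proj_eq_proj_iff {x y : Sphere2} : proj x = proj y ↔ y = x ∨ y = -x := by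
  constructor
  · intro h
    have key : ∀ x y : Sphere2, 0 ≤ height x → 0 ≤ height y → proj x = proj y → y = x ∨ y = -x := by
      intro x y hx hy h
      rw [proj_of_nonneg hx, proj_of_nonneg hy, mk_eq_mk_iff] at h
      rcases h with h | ⟨h1, h2⟩
      · exact Or.inl (eq_of_shadow_eq hy hx (congrArg Subtype.val h).symm)
      · have h2 : shadow y = -shadow x := h2
        have h1 : ‖shadow x‖ = 1 := h1
        have hx0 := height_eq_zero_iff.mpr h1
        have hy0 : height y = 0 := height_eq_zero_iff.mpr (by rw [h2, norm_neg, h1])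
        exact Or.inr (ext_coords (by rw [height_neg, hx0, hy0, neg_zero]) h2)
    rcases le_total 0 (height x) with hx | hx <;> rcases le_total 0 (height y) with hy | hy
    · exact key x y hx hy h
    · rcases key x (-y) hx (by simpa using hy) (by rw [h, proj_neg]) with h | h
      · exact Or.inr (by rw [← h, neg_neg])
      · exact Or.inl (neg_injective h)
    · rcases key (-x) y (by simpa using hx) hy (by rw [← h, proj_neg]) with h | h
      · exact Or.inr h
      · exact Or.inl (by rw [h, neg_neg])
    · rcases key (-x) (-y) (by simpa using hx) (by simpa using hy) (by rw [proj_neg, h, proj_neg])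
        with h | h
      · exact Or.inl (neg_injective h)
      · exact Or.inr (by rw [← neg_neg y, h, neg_neg])
  · rintro (rfl | rfl)
    exacts [rfl, (proj_neg x).symm]

theorem isOpenMap_proj : IsOpenMap proj := by
  intro U hU
  have h : IsOpen (proj ⁻¹' (proj '' U)) := by
    have : proj ⁻¹' (proj '' U) = U ∪ Neg.neg ⁻¹' U := by
      ext x
      constructor
      · rintro ⟨y, hy, hyx⟩
        rcases proj_eq_proj_iff.mp hyx with rfl | rfl
        · exact Or.inl hy
        · exact Or.inr (by rwa [mem_preimage, neg_neg])
      · rintro (h | h)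
        · exact ⟨x, h, rfl⟩
        · exact ⟨-x, h, proj_neg x⟩
    rw [this]
    exact hU.union (hU.preimage continuous_neg)
  have h2 : mk ⁻¹' (proj '' U) = lift ⁻¹' (proj ⁻¹' (proj '' U)) := by
    ext z
    rw [mem_preimage, mem_preimage, mem_preimage, proj_lift]
  change IsOpen (mk ⁻¹' (proj '' U))
  rw [h2]
  exact h.preimage continuous_lift

instance : T2Space RP2 := by
  rw [t2Space_iff_of_isOpenQuotientMap ⟨proj_surjective, continuous_proj, isOpenMap_proj⟩]
  have : {q : Sphere2 × Sphere2 | proj q.1 = proj q.2} = {q | q.2 = q.1} ∪ {q | q.2 = -q.1} := by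
    ext q
    exact proj_eq_proj_iff
  rw [this]
  exact (isClosed_eq continuous_snd continuous_fst).union
    (isClosed_eq continuous_snd continuous_fst.neg)

/-- The open hemisphere around `x` is embedded in the projective plane. -/
theorem injOn_proj_hemisphere (x : Sphere2) :
    InjOn proj {y : Sphere2 | 0 < inner ℝ (x : WithLp 2 (ℝ × EuclideanSpace ℝ (Fin 2))) y} := by
  intro y hy z hz h
  rcases proj_eq_proj_iff.mp h with h | h
  · exact h.symm
  · rw [mem_ofPred_eq] at hy hz
    rw [h, coe_neg_sphere, inner_neg_right] at hz
    linarith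

theorem isOpen_hemisphere (x : Sphere2) :
    IsOpen {y : Sphere2 | 0 < inner ℝ (x : WithLp 2 (ℝ × EuclideanSpace ℝ (Fin 2))) y} :=
  isOpen_lt continuous_const (continuous_const.inner continuous_subtype_val)

theorem mem_hemisphere (x : Sphere2) :
    x ∈ {y : Sphere2 | 0 < inner ℝ (x : WithLp 2 (ℝ × EuclideanSpace ℝ (Fin 2))) y} := by
  rw [mem_ofPred_eq, real_inner_self_eq_norm_sq, norm_eq_of_mem_sphere]
  norm_num

theorem isLocalHomeomorph_proj : IsLocalHomeomorph proj := by
  rw [isLocalHomeomorph_iff_isOpenEmbedding_restrict]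
  intro x
  refine ⟨_, (isOpen_hemisphere x).mem_nhds (mem_hemisphere x), ?_⟩
  exact .of_continuous_injective_isOpenMap (continuous_proj.comp continuous_subtype_val)
    (injOn_iff_injective.mp (injOn_proj_hemisphere x))
    (isOpenMap_proj.domRestrict (isOpen_hemisphere x))

theorem isCoveringMap_proj : IsCoveringMap proj :=
  isLocalHomeomorph_iff_isCoveringMap.mp isLocalHomeomorph_proj

end RP2

/-- A simple closed curve in the projective plane lifts to a path in the sphere, which closes up
after one turn or arrives at the antipode of its origin. -/
theorem IsSimpleClosedCurve.exists_lift {C : Set RP2} (hC : IsSimpleClosedCurve C) :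
    ∃ c : ℝ → Sphere2, Continuous c ∧ range (RP2.proj ∘ c) = C ∧
      (∀ s t, RP2.proj (c s) = RP2.proj (c t) ↔ Circle.exp s = Circle.exp t) ∧
      ((∀ t, c (t + 2 * Real.pi) = c t) ∨ ∀ t, c (t + 2 * Real.pi) = -c t) := by
  obtain ⟨γ, hγ, hi, rfl⟩ := hC
  obtain ⟨e₀, he₀⟩ := RP2.proj_surjective (γ (Circle.exp 0))
  obtain ⟨F, ⟨-, hF⟩, -⟩ := RP2.isCoveringMap_proj.existsUnique_continuousMap_lifts
    (⟨fun t => γ (Circle.exp t), hγ.comp Circle.exp.continuous⟩ : C(ℝ, RP2)) 0 e₀ he₀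
  have hF' : ∀ t, RP2.proj (F t) = γ (Circle.exp t) := fun t => congrFun hF t
  refine ⟨F, F.continuous, ?_, fun s t => ?_, ?_⟩
  · ext q
    constructor
    · rintro ⟨t, rfl⟩
      exact ⟨Circle.exp t, (hF' t).symm⟩
    · rintro ⟨z, rfl⟩
      obtain ⟨t, -, rfl⟩ := Circle.exists_exp_eq z
      exact ⟨t, hF' t⟩
  · rw [hF', hF', hi.eq_iff]
  · have hper : ∀ t, F (t + 2 * Real.pi) = F t ∨ F (t + 2 * Real.pi) = -F t := fun t => by
      apply RP2.proj_eq_proj_iff.mp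
      rw [hF', hF', hi.eq_iff, Circle.exp_add_two_pi]
    have hc : Continuous fun t => F (t + 2 * Real.pi) := F.continuous.comp (continuous_add_const _)
    have h1 : IsClosed {t | F (t + 2 * Real.pi) = F t} := isClosed_eq hc F.continuous
    have h2 : IsClosed {t | F (t + 2 * Real.pi) = -F t} := isClosed_eq hc F.continuous.neg
    by_contra! hcon
    obtain ⟨⟨s, hs⟩, t, ht⟩ := hcon
    obtain ⟨u, -, hu1, hu2⟩ := isPreconnected_closed_iff.mp (isPreconnected_univ (α := ℝ)) _ _ h1 h2
      (fun t _ => hper t) ⟨t, trivial, (hper t).resolve_right ht⟩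
      ⟨s, trivial, (hper s).resolve_left hs⟩
    exact ne_neg (F u) (hu1.symm.trans hu2)

/-! ### Stereographic projection -/

instance : Fact (Module.finrank ℝ (WithLp 2 (ℝ × EuclideanSpace ℝ (Fin 2))) = 2 + 1) :=
  ⟨by rw [(WithLp.linearEquiv 2 ℝ (ℝ × EuclideanSpace ℝ (Fin 2))).finrank_eq]; simp⟩

/-- `ψ` is a stereographic projection from `N` with inverse `ι`, scaled so that the antipodal map
becomes `z ↦ -1 / conj z`. -/
structure IsStereographic (N : Sphere2) (ψ : Sphere2 → ℂ) (ι : ℂ → Sphere2) : Prop where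
  continuousOn : ContinuousOn ψ {N}ᶜ
  continuous_symm : Continuous ι
  symm_ne : ∀ z, ι z ≠ N
  right_inv : ∀ z, ψ (ι z) = z
  left_inv : ∀ x, x ≠ N → ι (ψ x) = x
  map_neg_mul : ∀ x, x ≠ N → x ≠ -N → ψ (-x) * (starRingEnd ℂ) (ψ x) = -1

theorem Sphere2.exists_isStereographic (N : Sphere2) : ∃ ψ ι, IsStereographic N ψ ι := by
  have hN := norm_eq_of_mem_sphere N
  have hdim : Module.finrank ℝ
      (Submodule.span ℝ {(N : WithLp 2 (ℝ × EuclideanSpace ℝ (Fin 2)))})ᗮ = 2 :=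
    Submodule.finrank_orthogonal_span_singleton (n := 2) (ne_zero_of_mem_unit_sphere N)
  let L : (Submodule.span ℝ {(N : WithLp 2 (ℝ × EuclideanSpace ℝ (Fin 2)))})ᗮ ≃ₗᵢ[ℝ] ℂ :=
    (Complex.isometryOfOrthonormal ((stdOrthonormalBasis ℝ _).reindex (finCongr hdim))).symm
  have hsrc : ∀ x, x ≠ N → x ∈ (stereographic hN).source := fun x hx => by
    rw [stereographic_source]
    exact hx
  refine ⟨fun x => (1 / 2 : ℝ) • L (stereographic hN x),
    fun z => (stereographic hN).symm (L.symm ((2 : ℝ) • z)), ?_, ?_, fun z => ?_, fun z => ?_,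
    fun x hx => ?_, fun x hx hx' => ?_⟩
  · have := (stereographic hN).continuousOn
    rw [stereographic_source] at this
    exact (L.continuous.comp_continuousOn this).const_smul (1 / 2 : ℝ)
  · have := (stereographic hN).continuousOn_symm
    rw [stereographic_target, continuousOn_univ] at this
    exact this.comp (L.symm.continuous.comp (continuous_const_smul (2 : ℝ)))
  · have := (stereographic hN).map_target (x := L.symm ((2 : ℝ) • z)) (by simp)
    rw [stereographic_source] at this
    exact this
  · rw [(stereographic hN).right_inv (by simp), L.apply_symm_apply, smul_smul]
    norm_num
  · rw [smul_smul, show (2 : ℝ) * (1 / 2) = 1 by norm_num, one_smul, L.symm_apply_apply,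
      (stereographic hN).left_inv (hsrc x hx)]
  · have hlt : ∀ y : Sphere2, y ≠ N →
        inner ℝ (N : WithLp 2 (ℝ × EuclideanSpace ℝ (Fin 2))) y < 1 := fun y hy =>
      (inner_lt_one_iff_real_of_norm_eq_one hN (norm_eq_of_mem_sphere y)).mpr
        fun h => hy (Subtype.ext h).symm
    set a := inner ℝ (N : WithLp 2 (ℝ × EuclideanSpace ℝ (Fin 2))) (x : WithLp 2 _) with ha
    have h1 : a < 1 := hlt x hx
    have h2 : -a < 1 := by
      have := hlt (-x) fun h => hx' (by rw [← h, neg_neg])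
      rwa [coe_neg_sphere, inner_neg_right] at this
    set w := (Submodule.span ℝ
      {(N : WithLp 2 (ℝ × EuclideanSpace ℝ (Fin 2)))})ᗮ.orthogonalProjectionOnto (x : WithLp 2 _)
      with hw
    have hpyth : ‖w‖ ^ 2 = 1 - a ^ 2 := by
      have hsplit : (x : WithLp 2 (ℝ × EuclideanSpace ℝ (Fin 2))) = a • N + w := by
        rw [← (Submodule.span ℝ {(N : WithLp 2 (ℝ × EuclideanSpace ℝ
          (Fin 2)))}).starProjection_add_starProjection_orthogonal x,
          Submodule.starProjection_unit_singleton ℝ hN x]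
        rfl
      have hNw : inner ℝ (N : WithLp 2 (ℝ × EuclideanSpace ℝ (Fin 2))) w = 0 :=
        Submodule.mem_orthogonal_singleton_iff_inner_right.mp w.2
      have h := norm_add_sq_eq_norm_sq_add_norm_sq_of_inner_eq_zero
        (a • (N : WithLp 2 (ℝ × EuclideanSpace ℝ (Fin 2)))) w
        (by rw [inner_smul_left, hNw, mul_zero])
      rw [← hsplit, norm_eq_of_mem_sphere, norm_smul, hN, mul_one, mul_one,
        Real.norm_eq_abs, abs_mul_abs_self] at h
      rw [Submodule.norm_coe] at h
      linear_combination -h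
    simp only [stereographic_apply, coe_neg_sphere, inner_neg_right, map_neg, ← ha, ← hw, map_smul]
    simp only [Complex.real_smul, map_mul, Complex.conj_ofReal]
    have hn : L w * (starRingEnd ℂ) (L w) = ((1 - a ^ 2 : ℝ) : ℂ) := by
      rw [Complex.mul_conj, Complex.normSq_eq_norm_sq, L.norm_map, hpyth]
    have h3 : ((1 - a : ℝ) : ℂ) ≠ 0 := by exact_mod_cast (sub_pos.mpr h1).ne'
    have h4 : ((1 + a : ℝ) : ℂ) ≠ 0 := by
      have : (1 + a) ≠ 0 := by linarith
      exact_mod_cast this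
    push_cast at h3 h4 hn ⊢
    rw [sub_neg_eq_add]
    field_simp
    linear_combination -hn

namespace IsStereographic

variable {N : Sphere2} {ψ : Sphere2 → ℂ} {ι : ℂ → Sphere2}

theorem injective_symm (h : IsStereographic N ψ ι) : Function.Injective ι :=
  Function.LeftInverse.injective h.right_inv

theorem injOn (h : IsStereographic N ψ ι) : InjOn ψ {N}ᶜ := fun x hx y hy hxy => by
  rw [← h.left_inv x hx, hxy, h.left_inv y hy]

theorem symm_image (h : IsStereographic N ψ ι) {S : Set Sphere2} (hS : N ∉ S) :
    ι '' (ψ '' S) = S := by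
  rw [image_image]
  exact (image_congr fun x hx => h.left_inv x fun hxN => hS (hxN ▸ hx)).trans (image_id S)

theorem image_symm (h : IsStereographic N ψ ι) (S : Set ℂ) : ψ '' (ι '' S) = S := by
  rw [image_image]
  exact (image_congr fun x _ => h.right_inv x).trans (image_id S)

theorem isOpen_image_symm (h : IsStereographic N ψ ι) {U : Set ℂ} (hU : IsOpen U) :
    IsOpen (ι '' U) := by
  have : ι '' U = {N}ᶜ ∩ ψ ⁻¹' U := by
    ext x
    constructor
    · rintro ⟨z, hz, rfl⟩
      exact ⟨h.symm_ne z, by rwa [mem_preimage, h.right_inv]⟩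
    · rintro ⟨hx, hx'⟩
      exact ⟨ψ x, hx', h.left_inv x hx⟩
  rw [this]
  exact h.continuousOn.isOpen_inter_preimage isOpen_compl_singleton hU

theorem notMem_image_symm (h : IsStereographic N ψ ι) (S : Set ℂ) : N ∉ ι '' S := by
  rintro ⟨z, -, hz⟩
  exact h.symm_ne z hz

end IsStereographic

/-! ### Arrangements of lines on the sphere -/

/-- The Euclidean plane containing the unit disk. -/
abbrev Plane : Type := EuclideanSpace ℝ (Fin 2)

/-- The radial retraction of the plane to the unit disk. -/
noncomputable def retractDisk (c : Plane) : UnitDisk :=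
  ⟨(max 1 ‖c‖)⁻¹ • c, by
    have h : 0 < max 1 ‖c‖ := lt_max_of_lt_left one_pos
    rw [mem_closedBall_zero_iff, norm_smul, norm_inv, Real.norm_of_nonneg h.le, inv_mul_le_iff₀ h,
      mul_one]
    exact le_max_right _ _⟩

theorem continuous_retractDisk : Continuous retractDisk :=
  Continuous.subtype_mk (((continuous_const.max continuous_norm).inv₀ fun _ =>
    (lt_max_of_lt_left one_pos).ne').smul continuous_id) _

theorem coe_retractDisk {c : Plane} (h : ‖c‖ ≤ 1) : (retractDisk c : Plane) = c := by
  change (max 1 ‖c‖)⁻¹ • c = c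
  rw [max_eq_left h, inv_one, one_smul]

theorem norm_retractDisk {c : Plane} (h : 1 ≤ ‖c‖) : ‖(retractDisk c : Plane)‖ = 1 := by
  change ‖(max 1 ‖c‖)⁻¹ • c‖ = 1
  rw [max_eq_right h, norm_smul, norm_inv, norm_norm, inv_mul_cancel₀ (by linarith)]

namespace Sphere2

/-- The point above or below a point of the disk, on the open hemisphere given by a sign. -/
noncomputable def cap (σ : SignType) (c : Plane) : Sphere2 :=
  if σ = 1 then lift (retractDisk c) else -lift (retractDisk (-c))

theorem continuous_cap (σ : SignType) : Continuous (cap σ) := by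
  unfold cap
  split_ifs
  · exact continuous_lift.comp continuous_retractDisk
  · exact (continuous_lift.comp (continuous_retractDisk.comp continuous_neg)).neg

theorem shadow_cap (σ : SignType) {c : Plane} (h : ‖c‖ ≤ 1) : shadow (cap σ c) = c := by
  unfold cap
  split_ifs
  · rw [shadow_lift, coe_retractDisk h]
  · rw [shadow_neg, shadow_lift, coe_retractDisk (by rwa [norm_neg]), neg_neg]

theorem height_cap_eq_zero (σ : SignType) {c : Plane} (h : 1 ≤ ‖c‖) : height (cap σ c) = 0 := by
  rw [height_eq_zero_iff]
  unfold cap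
  split_ifs
  · rw [shadow_lift, norm_retractDisk h]
  · rw [shadow_neg, norm_neg, shadow_lift, norm_retractDisk (by rwa [norm_neg])]

theorem sign_height_cap {σ : SignType} (hσ : σ ≠ 0) {c : Plane} (h : ‖c‖ < 1) :
    SignType.sign (height (cap σ c)) = σ := by
  have h0 : ∀ c : Plane, ‖c‖ < 1 → 0 < height (lift (retractDisk c)) := fun c h => by
    rw [height_lift, coe_retractDisk h.le, Real.sqrt_pos]
    nlinarith [norm_nonneg c]
  unfold cap
  split_ifs with h1
  · rw [sign_pos (h0 c h), h1]
  · rw [height_neg, sign_neg (neg_neg_of_pos (h0 (-c) (by rwa [norm_neg])))]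
    cases σ
    · exact absurd rfl hσ
    · rfl
    · exact absurd rfl h1

theorem eq_of_sign_height_eq {x y : Sphere2}
    (h : SignType.sign (height x) = SignType.sign (height y)) (h' : shadow x = shadow y) :
    x = y := by
  rcases lt_trichotomy (height y) 0 with hy | hy | hy
  · rw [sign_neg hy, sign_eq_neg_one_iff] at h
    exact neg_injective (eq_of_shadow_eq (by rw [height_neg]; linarith)
      (by rw [height_neg]; linarith) (by rw [shadow_neg, shadow_neg, h']))
  · rw [hy, sign_zero, sign_eq_zero_iff] at h
    exact ext_coords (h.trans hy.symm) h'
  · rw [sign_pos hy, sign_eq_one_iff] at h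
    exact eq_of_shadow_eq h.le hy.le h'

theorem norm_shadow_lt {x : Sphere2} (hx : height x ≠ 0) : ‖shadow x‖ < 1 :=
  (norm_shadow_le x).lt_of_ne fun h => hx (height_eq_zero_iff.mpr h)

theorem cap_shadow {x : Sphere2} (hx : height x ≠ 0) :
    cap (SignType.sign (height x)) (shadow x) = x :=
  eq_of_sign_height_eq (sign_height_cap (by rwa [ne_eq, sign_eq_zero_iff]) (norm_shadow_lt hx))
    (shadow_cap _ (norm_shadow_le x))

/-- The parametrization of the equator by the unit circle of the complex plane. -/
noncomputable def equator (z : Circle) : Sphere2 :=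
  ⟨WithLp.toLp 2 (0, !₂[(z : ℂ).re, (z : ℂ).im]), by
    have hz : ‖(z : ℂ)‖ = 1 := z.norm_coe
    rw [mem_sphere_zero_iff_norm, WithLp.norm_toLp_snd, EuclideanSpace.norm_eq, Fin.sum_univ_two]
    have := Complex.re_sq_add_im_sq_eq_one hz
    simpa using this⟩

theorem height_equator (z : Circle) : height (equator z) = 0 := rfl

theorem shadow_equator (z : Circle) : shadow (equator z) = !₂[(z : ℂ).re, (z : ℂ).im] := rfl

theorem continuous_equator : Continuous equator := by
  refine Continuous.subtype_mk ((WithLp.prod_continuous_toLp 2 ℝ (EuclideanSpace ℝ (Fin 2))).comp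
    (continuous_const.prodMk ?_)) _
  refine (PiLp.continuous_toLp 2 _).comp (continuous_pi fun i => ?_)
  fin_cases i
  · exact Complex.continuous_re.comp continuous_subtype_val
  · exact Complex.continuous_im.comp continuous_subtype_val

theorem equator_injective : Function.Injective equator := fun z w h => by
  have h' := congrArg shadow h
  rw [shadow_equator, shadow_equator] at h'
  have h0 := congrFun (congrArg WithLp.ofLp h') 0
  have h1 := congrFun (congrArg WithLp.ofLp h') 1
  exact Subtype.ext (Complex.ext (by simpa using h0) (by simpa using h1))

theorem exists_equator_eq {x : Sphere2} (hx : height x = 0) : ∃ z, equator z = x := by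
  have h := height_eq_zero_iff.mp hx
  rw [EuclideanSpace.norm_eq, Fin.sum_univ_two, Real.sqrt_eq_one] at h
  have hz : ‖(⟨shadow x 0, shadow x 1⟩ : ℂ)‖ = 1 := by
    rw [Complex.norm_def, Complex.normSq_mk, Real.sqrt_eq_one]
    simpa [← sq] using h
  refine ⟨⟨_, mem_sphere_zero_iff_norm.mpr hz⟩, ext_coords hx.symm ?_⟩
  refine (shadow_equator _).trans ?_
  ext i
  fin_cases i <;> rfl

theorem equator_exp_add_pi (t : ℝ) :
    equator (Circle.exp (t + Real.pi)) = -equator (Circle.exp t) := by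
  refine ext_coords (by rw [height_neg, height_equator, height_equator, neg_zero]) ?_
  rw [shadow_neg, shadow_equator, shadow_equator]
  have : (Circle.exp (t + Real.pi) : ℂ) = -(Circle.exp t : ℂ) := by
    rw [Circle.coe_exp, Circle.coe_exp]
    push_cast
    rw [add_mul, Complex.exp_add, Complex.exp_pi_mul_I]
    ring
  rw [this]
  ext i
  fin_cases i <;> simp

/-- The equator together with the points of the sphere above or below the lines `⟪l.1, ·⟫ = l.2` of
the disk, for `l` in `Λ`. -/
def arrangement (Λ : Set (Plane × ℝ)) : Set Sphere2 :=
  {x | height x = 0 ∨ ∃ l ∈ Λ, inner ℝ l.1 (shadow x) = l.2}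

/-- The position of a point with respect to the equator and to each of the lines. -/
noncomputable def signs (Λ : Set (Plane × ℝ)) (x : Sphere2) : SignType × (Λ → SignType) :=
  (SignType.sign (height x), fun l => SignType.sign (inner ℝ l.1.1 (shadow x) - l.1.2))

/-- The convex open subset of the disk that consists of the points with given signs. -/
def cellShadow (Λ : Set (Plane × ℝ)) (κ : Λ → SignType) : Set Plane :=
  {c | ‖c‖ < 1 ∧ ∀ l : Λ, SignType.sign (inner ℝ l.1.1 c - l.1.2) = κ l}

variable {Λ : Set (Plane × ℝ)} {κ : Λ → SignType}

theorem convex_preimage_sign_sub (n : Plane) (k : ℝ) (s : SignType) :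
    Convex ℝ {c : Plane | SignType.sign (inner ℝ n c - k) = s} := by
  have hl : IsLinearMap ℝ fun c : Plane => inner ℝ n c := (innerₛₗ ℝ n).isLinear
  cases s
  · simpa [sign_eq_zero_iff, sub_eq_zero] using convex_hyperplane hl k
  · simpa [sign_eq_neg_one_iff] using convex_halfSpace_lt hl k
  · simpa [sign_eq_one_iff] using convex_halfSpace_gt hl k

theorem convex_cellShadow : Convex ℝ (cellShadow Λ κ) := by
  have : cellShadow Λ κ = Metric.ball 0 1 ∩
      ⋂ l : Λ, {c : Plane | SignType.sign (inner ℝ l.1.1 c - l.1.2) = κ l} := by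
    ext c
    simp [cellShadow]
  rw [this]
  exact (convex_ball _ _).inter (convex_iInter fun l => convex_preimage_sign_sub _ _ _)

theorem isOpen_cellShadow (hΛ : Λ.Finite) (hκ : ∀ l, κ l ≠ 0) : IsOpen (cellShadow Λ κ) := by
  have : cellShadow Λ κ = Metric.ball 0 1 ∩
      ⋂ l : Λ, {c : Plane | SignType.sign (inner ℝ l.1.1 c - l.1.2) = κ l} := by
    ext c
    simp [cellShadow]
  rw [this]
  have := hΛ.to_subtype
  refine Metric.isOpen_ball.inter (isOpen_iInter_of_finite fun l => ?_)
  have hc : Continuous fun c : Plane => inner ℝ l.1.1 c - l.1.2 :=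
    (continuous_const.inner continuous_id).sub continuous_const
  have h0 := hκ l
  generalize κ l = s at h0
  cases s
  · exact absurd rfl h0
  · simpa only [SignType.neg_eq_neg_one, sign_eq_neg_one_iff] using
      isOpen_lt hc continuous_const
  · simpa only [SignType.pos_eq_one, sign_eq_one_iff] using isOpen_lt continuous_const hc

theorem notMem_arrangement_iff {x : Sphere2} :
    x ∉ arrangement Λ ↔ (signs Λ x).1 ≠ 0 ∧ ∀ l, (signs Λ x).2 l ≠ 0 := by
  simp only [arrangement, signs, mem_ofPred_eq, not_or, not_exists, not_and, ne_eq, sign_eq_zero_iff,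
    sub_eq_zero, Subtype.forall]

theorem signs_cap {σ : SignType} (hσ : σ ≠ 0) {c : Plane} (hc : c ∈ cellShadow Λ κ) :
    signs Λ (cap σ c) = (σ, κ) := by
  refine Prod.ext (sign_height_cap hσ hc.1) (funext fun l => ?_)
  rw [← show _ = (σ, κ).2 l from hc.2 l, signs, shadow_cap σ hc.1.le]

theorem shadow_mem_cellShadow {x : Sphere2} (hx : x ∉ arrangement Λ) :
    shadow x ∈ cellShadow Λ (signs Λ x).2 :=
  ⟨norm_shadow_lt fun h => hx (Or.inl h), fun _ => rfl⟩

theorem setOf_signs_eq {σ : SignType} (hσ : σ ≠ 0) (hκ : ∀ l, κ l ≠ 0) :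
    {x | x ∉ arrangement Λ ∧ signs Λ x = (σ, κ)} = cap σ '' cellShadow Λ κ := by
  ext x
  constructor
  · rintro ⟨hx, hs⟩
    refine ⟨shadow x, ?_, ?_⟩
    · have := shadow_mem_cellShadow hx
      rwa [hs] at this
    · have := cap_shadow (x := x) fun h => hx (Or.inl h)
      rwa [show SignType.sign (height x) = σ from congrArg Prod.fst hs] at this
  · rintro ⟨c, hc, rfl⟩
    have := signs_cap hσ hc
    refine ⟨notMem_arrangement_iff.mpr ?_, this⟩
    rw [this]
    exact ⟨hσ, hκ⟩

theorem isPreconnected_setOf_signs_eq (k : SignType × (Λ → SignType)) :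
    IsPreconnected {x | x ∉ arrangement Λ ∧ signs Λ x = k} := by
  rcases eq_empty_or_nonempty {x | x ∉ arrangement Λ ∧ signs Λ x = k} with h | ⟨x, hx, rfl⟩
  · rw [h]
    exact isPreconnected_empty
  · obtain ⟨h1, h2⟩ := notMem_arrangement_iff.mp hx
    have := setOf_signs_eq h1 h2
    rw [Prod.mk.eta] at this
    rw [this]
    exact convex_cellShadow.isPreconnected.image _ (continuous_cap _).continuousOn

theorem isClosed_arrangement (hΛ : Λ.Finite) : IsClosed (arrangement Λ) := by
  have : arrangement Λ = {x | height x = 0} ∪ ⋃ l ∈ Λ, {x | inner ℝ l.1 (shadow x) = l.2} := by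
    ext x
    simp [arrangement]
  rw [this]
  exact (isClosed_eq continuous_height continuous_const).union (hΛ.isClosed_biUnion fun l _ =>
    isClosed_eq (continuous_const.inner continuous_shadow) continuous_const)

theorem dense_height_ne_zero : Dense {x : Sphere2 | height x ≠ 0} := by
  intro x
  by_cases hx : height x = 0
  · have hn := height_eq_zero_iff.mp hx
    let e : ℝ → Sphere2 := fun t => ⟨WithLp.toLp 2 (Real.sin t, Real.cos t • shadow x), by
      rw [mem_sphere_zero_iff_norm, ← sq_eq_sq₀ (norm_nonneg _) zero_le_one,
        WithLp.prod_norm_sq_eq_of_L2]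
      simp [norm_smul, hn]⟩
    have he : Continuous e := by
      refine Continuous.subtype_mk ((WithLp.prod_continuous_toLp 2 ℝ
        (EuclideanSpace ℝ (Fin 2))).comp (Real.continuous_sin.prodMk
          (Real.continuous_cos.smul continuous_const))) _
    have he0 : e 0 = x := ext_coords (by rw [hx]; exact Real.sin_zero)
      (by change Real.cos 0 • shadow x = shadow x; rw [Real.cos_zero, one_smul])
    have ht : Tendsto e (𝓝[>] 0) (𝓝 x) := he0 ▸ he.continuousAt.tendsto.mono_left nhdsWithin_le_nhds
    refine mem_closure_of_tendsto ht ?_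
    filter_upwards [Ioo_mem_nhdsGT Real.pi_pos] with t htt
    exact (Real.sin_pos_of_pos_of_lt_pi htt.1 htt.2).ne'
  · exact subset_closure hx

theorem dense_inner_shadow_ne {n : Plane} (hn : n ≠ 0) (k : ℝ) :
    Dense {x : Sphere2 | inner ℝ n (shadow x) ≠ k} := by
  rw [← dense_closure]
  refine dense_height_ne_zero.mono fun x hx => ?_
  by_cases hk : inner ℝ n (shadow x) = k
  · have hc : Continuous fun t : ℝ => shadow x + t • n := by fun_prop
    have h0 : Tendsto (fun t : ℝ => shadow x + t • n) (𝓝[>] 0) (𝓝 (shadow x)) := by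
      have := hc.tendsto 0
      rw [zero_smul, add_zero] at this
      exact this.mono_left nhdsWithin_le_nhds
    have h1 := ((continuous_cap (SignType.sign (height x))).tendsto _).comp h0
    rw [cap_shadow hx] at h1
    refine mem_closure_of_tendsto h1 ?_
    filter_upwards [h0.eventually (Metric.isOpen_ball.mem_nhds
      (mem_ball_zero_iff.mpr (norm_shadow_lt hx))), self_mem_nhdsWithin] with t ht ht0
    rw [dist_zero_right] at ht
    rw [Function.comp_apply, shadow_cap _ ht.le, inner_add_right, hk,
      inner_smul_right, ne_eq, add_eq_left, mul_eq_zero, inner_self_eq_zero]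
    exact fun h => h.elim (ne_of_gt ht0) hn
  · exact subset_closure hk

theorem dense_compl_arrangement (hΛ : Λ.Finite) (h0 : ∀ l ∈ Λ, l.1 ≠ 0) :
    Dense (arrangement Λ)ᶜ := by
  have : (arrangement Λ)ᶜ = {x | height x ≠ 0} ∩ ⋂ l ∈ Λ, {x | inner ℝ l.1 (shadow x) ≠ l.2} := by
    ext x
    simp only [arrangement, mem_compl_iff, mem_ofPred_eq, not_or, not_exists, not_and, mem_inter_iff,
      mem_iInter, ne_eq]
  rw [this]
  refine dense_height_ne_zero.inter_of_isOpen_left (dense_biInter_of_isOpen (fun l _ => ?_)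
    hΛ.countable fun l hl => dense_inner_shadow_ne (h0 l hl) _)
    (isOpen_ne_fun continuous_height continuous_const)
  exact isOpen_ne_fun (continuous_const.inner continuous_shadow) continuous_const

end Sphere2

/-! ### Closed lifts bound disks -/

section
open Sphere2
variable {N : Sphere2} {ψ : Sphere2 → ℂ} {ι : ℂ → Sphere2}

/-- If a Jordan curve on the sphere is disjoint from its antipodal image, then so is its union with
the region it bounds away from the pole: the overlap would be open and closed. -/
theorem IsStereographic.symm_ne_neg_symm (h : IsStereographic N ψ ι) {K : Set ℂ}
    (hK : IsJordanCurve K) (hN : -N ∈ ι '' K) (hd : ∀ z ∈ K, ∀ w ∈ K, ι z ≠ -ι w) :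
    ∀ z ∈ K ∪ insideOf K, ∀ w ∈ K ∪ insideOf K, ι z ≠ -ι w := by
  have hKpre : IsPreconnected K := by
    obtain ⟨γ, hγ, -, rfl⟩ := hK
    exact isPreconnected_range hγ
  set J := ι '' insideOf K with hJ
  have hJo : IsOpen J := h.isOpen_image_symm (isOpen_insideOf hK.isCompact)
  have hDc : IsClosed (ι '' (K ∪ insideOf K)) := by
    rw [← hK.closure_insideOf]
    exact ((isBounded_insideOf hK.isCompact).isCompact_closure.image h.continuous_symm).isClosed
  have hdisj : ∀ z, z ∈ K → ι z ∉ J := fun z hz ⟨w, hw, hwz⟩ =>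
    hw.1 (h.injective_symm hwz ▸ hz)
  -- the antipodal curve contains the pole, hence stays in the outer region
  have hneg : ∀ z ∈ K, -ι z ∉ J := by
    intro z hz hzJ
    have hpre : IsPreconnected ((fun z => -ι z) '' K) :=
      hKpre.image _ h.continuous_symm.neg.continuousOn
    obtain ⟨y, hy, hy1, hy2⟩ := hpre _ _ hJo hDc.isOpen_compl (by
        rintro _ ⟨w, hw, rfl⟩
        by_cases hwJ : -ι w ∈ J
        · exact Or.inl hwJ
        · refine Or.inr fun hwD => ?_
          rw [image_union] at hwD
          obtain ⟨u, hu, huw⟩ := hwD.resolve_right hwJ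
          exact hd u hu w hw huw) ⟨_, mem_image_of_mem _ hz, hzJ⟩
        ⟨N, by
          obtain ⟨w, hw, hwN⟩ := hN
          exact ⟨w, hw, by simp only [hwN, neg_neg]⟩, h.notMem_image_symm _⟩
    exact hy2 (image_mono subset_union_right hy1)
  set W := ι '' (K ∪ insideOf K) ∩ Neg.neg ⁻¹' (ι '' (K ∪ insideOf K)) with hW
  have hWeq : W = J ∩ Neg.neg ⁻¹' J := by
    refine subset_antisymm ?_ (inter_subset_inter (image_mono subset_union_right)
      (preimage_mono (image_mono subset_union_right)))
    rintro x ⟨⟨z, hz, rfl⟩, w, hw, hwz⟩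
    have hzw : ι z = -ι w := by rw [hwz, neg_neg]
    rcases hz with hz | hz <;> rcases hw with hw | hw
    · exact absurd hzw (hd z hz w hw)
    · exact absurd ⟨w, hw, hwz⟩ (hneg z hz)
    · exact absurd ⟨z, hz, hzw⟩ (hneg w hw)
    · exact ⟨⟨z, hz, rfl⟩, w, hw, hwz⟩
  have hWc : IsClopen W := ⟨hDc.inter (hDc.preimage continuous_neg),
    hWeq ▸ hJo.inter (hJo.preimage continuous_neg)⟩
  have hpre : PreconnectedSpace Sphere2 := by
    refine isPreconnected_iff_preconnectedSpace.mp (isPreconnected_sphere ?_ 0 1)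
    rw [← Module.finrank_eq_rank, Fact.out (p := Module.finrank ℝ (WithLp 2 (ℝ × Plane)) = 2 + 1)]
    norm_num
  rcases isClopen_iff.mp hWc with hW0 | hW1
  · intro z hz w hw hzw
    have : ι z ∈ W := ⟨mem_image_of_mem _ hz, w, hw, by rw [hzw, neg_neg]⟩
    rw [hW0] at this
    exact this
  · obtain ⟨z, hz⟩ := hK.nontrivial.nonempty
    have : ι z ∈ W := hW1 ▸ mem_univ _
    rw [hWeq] at this
    exact absurd this.1 (hdisj z hz)

/-- A path that starts and ends off the inside of a Jordan curve and visits it contains a chord. -/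
theorem IsStereographic.exists_chord (h : IsStereographic N ψ ι) {K : Set ℂ}
    (hK : IsJordanCurve K) {T : Set Sphere2} {e : ℝ → Sphere2} {s₀ t₀ s₁ : ℝ}
    (he : ContinuousOn e (Icc s₀ s₁)) (h0 : s₀ ≤ t₀) (h1 : t₀ ≤ s₁) (hs₀ : e s₀ ∉ ι '' insideOf K)
    (ht₀ : e t₀ ∈ ι '' insideOf K) (hs₁ : e s₁ ∉ ι '' insideOf K)
    (H : ∀ t₁ t₂, s₀ ≤ t₁ → t₁ < t₂ → t₂ ≤ s₁ → (∀ t ∈ Ioo t₁ t₂, e t ∈ ι '' insideOf K) →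
      (∀ t ∈ Icc t₁ t₂, e t ∈ ι '' (K ∪ insideOf K)) →
      InjOn e (Icc t₁ t₂) ∧ ∀ t ∈ Icc t₁ t₂, e t ∈ T) :
    ∃ Q a b, IsArc Q a b ∧ Q ⊆ ι ⁻¹' T ∧ a ∈ K ∧ b ∈ K ∧ Q \ {a, b} ⊆ insideOf K := by
  obtain ⟨t₁, t₂, hst, h1t, ht2, hts, hn1, hn2, hin⟩ := exists_maximal_excursion
    (h.isOpen_image_symm (isOpen_insideOf hK.isCompact)) he h0 h1 hs₀ ht₀ hs₁
  have hlt := h1t.trans ht2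
  have hec : ContinuousOn e (Icc t₁ t₂) := he.mono (Icc_subset_Icc hst hts)
  have hDc : IsClosed (ι '' (K ∪ insideOf K)) := by
    rw [← hK.closure_insideOf]
    exact ((isBounded_insideOf hK.isCompact).isCompact_closure.image h.continuous_symm).isClosed
  have hcl : ∀ t ∈ Icc t₁ t₂, e t ∈ ι '' (K ∪ insideOf K) := by
    intro t ht
    rw [← closure_Ioo hlt.ne] at ht hec
    refine closure_minimal ?_ hDc (hec.image_closure (mem_image_of_mem e ht))
    rintro _ ⟨s, hs, rfl⟩
    exact image_mono subset_union_right (hin s hs)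
  obtain ⟨hinj, hT⟩ := H t₁ t₂ hst hlt hts hin hcl
  have hend : ∀ t ∈ Icc t₁ t₂, e t ∉ ι '' insideOf K → ψ (e t) ∈ K := by
    intro t ht hn
    have := hcl t ht
    rw [image_union] at this
    obtain ⟨z, hz, hze⟩ := this.resolve_right hn
    rwa [← hze, h.right_inv]
  have hNe : e '' Icc t₁ t₂ ⊆ {N}ᶜ := by
    rintro _ ⟨t, ht, rfl⟩ hN
    exact h.notMem_image_symm _ (mem_singleton_iff.mp hN ▸ hcl t ht)
  obtain ⟨harc, hsub⟩ := IsArc.of_excursion hlt hec hinj hin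
  refine ⟨_, _, _, harc.image (h.continuousOn.mono hNe) (h.injOn.mono hNe), ?_,
    hend t₁ (left_mem_Icc.mpr hlt.le) hn1, hend t₂ (right_mem_Icc.mpr hlt.le) hn2, ?_⟩
  · rintro _ ⟨_, ⟨t, ht, rfl⟩, rfl⟩
    rw [mem_preimage, h.left_inv _ (hNe (mem_image_of_mem e ht))]
    exact hT t ht
  · rintro _ ⟨⟨x, hx, rfl⟩, hxe⟩
    obtain ⟨z, hz, rfl⟩ := hsub ⟨hx, fun hx' => hxe (by
      rcases hx' with rfl | rfl
      exacts [Or.inl rfl, Or.inr rfl])⟩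
    rwa [h.right_inv]

end

section
open Sphere2
variable {N : Sphere2} {ψ : Sphere2 → ℂ} {ι : ℂ → Sphere2} {Λ : Set (Plane × ℝ)}

/-- A region bounded by a Jordan curve and meeting an arrangement of lines can be cut along it. If
the region meets the equator, the cut is a piece of the equator, and otherwise a piece of a line. -/
theorem IsStereographic.exists_chord_arrangement (h : IsStereographic N ψ ι) {K : Set ℂ}
    (hK : IsJordanCurve K) (hanti : ∀ z ∈ K ∪ insideOf K, ∀ w ∈ K ∪ insideOf K, ι z ≠ -ι w)
    (h0 : ∀ l ∈ Λ, l.1 ≠ 0) (hne : (insideOf K ∩ ι ⁻¹' arrangement Λ).Nonempty) :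
    ∃ Q a b, IsArc Q a b ∧ Q ⊆ ι ⁻¹' arrangement Λ ∧ a ∈ K ∧ b ∈ K ∧ Q \ {a, b} ⊆ insideOf K := by
  by_cases heq : ∃ z ∈ insideOf K, height (ι z) = 0
  · obtain ⟨z, hz, hz0⟩ := heq
    obtain ⟨w, hw⟩ := exists_equator_eq hz0
    obtain ⟨θ, -, rfl⟩ := Circle.exists_exp_eq w
    have hfar : ∀ t, equator (Circle.exp t) = -ι z →
        equator (Circle.exp t) ∉ ι '' (K ∪ insideOf K) := by
      rintro t ht ⟨y, hy, hyt⟩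
      exact hanti y hy z (Or.inr hz) (hyt.trans ht)
    have hl : equator (Circle.exp (θ - Real.pi)) = -ι z := by
      rw [← hw, ← neg_eq_iff_eq_neg, ← equator_exp_add_pi, sub_add_cancel]
    have hr : equator (Circle.exp (θ + Real.pi)) = -ι z := by rw [← hw, equator_exp_add_pi]
    have hpi := Real.pi_pos
    refine h.exists_chord hK (e := fun t => equator (Circle.exp t)) (s₀ := θ - Real.pi)
      (t₀ := θ) (s₁ := θ + Real.pi)
      (continuous_equator.comp Circle.exp.continuous).continuousOn (by linarith) (by linarith)
      (fun hm => hfar _ hl (image_mono subset_union_right hm)) (hw ▸ mem_image_of_mem ι hz)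
      (fun hm => hfar _ hr (image_mono subset_union_right hm)) ?_
    intro t₁ t₂ h1 h12 h2 _ hcl
    refine ⟨fun s hs t ht hst => ?_, fun t _ => Or.inl (height_equator _)⟩
    -- the two ends of the half turns are antipodal to a point inside, so the excursion is shorter
    have h1' : t₁ ≠ θ - Real.pi := fun h' => hfar t₁ (h' ▸ hl) (hcl t₁ (left_mem_Icc.mpr h12.le))
    have h1'' := lt_of_le_of_ne h1 h1'.symm
    refine Circle.exp_injOn_of_sub_lt (equator_injective hst) ?_
    rw [abs_lt]
    constructor <;> linarith [hs.1, hs.2, ht.1, ht.2]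
  · push Not at heq
    obtain ⟨z, hz, hzT⟩ := hne
    obtain ⟨l, hl, hlz⟩ := hzT.resolve_left (heq z hz)
    set x := ι z with hx
    set v : Plane := !₂[-l.1 1, l.1 0] with hv
    have hv0 : v ≠ 0 := by
      intro hv'
      refine h0 l hl ?_
      have e0 := congrFun (congrArg WithLp.ofLp hv') 0
      have e1 := congrFun (congrArg WithLp.ofLp hv') 1
      ext i
      fin_cases i
      · simpa [hv] using e1
      · simpa [hv] using e0
    have hlv : inner ℝ l.1 v = (0 : ℝ) := by
      simp only [hv, PiLp.inner_apply, Fin.sum_univ_two]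
      simp [mul_comm]
    have hvn : 0 < ‖v‖ := norm_pos_iff.mpr hv0
    have hfar : ∀ t : ℝ, |t| = 2 / ‖v‖ → 1 ≤ ‖shadow x + t • v‖ := by
      intro t ht
      have e1 : ‖t • v‖ = 2 := by
        rw [norm_smul, Real.norm_eq_abs, ht, div_mul_cancel₀ _ hvn.ne']
      have e2 := norm_sub_norm_le (t • v) (-shadow x)
      rw [norm_neg, sub_neg_eq_add, add_comm (t • v)] at e2
      linarith [norm_shadow_le x]
    have hR : 0 < 2 / ‖v‖ := by positivity
    have hc : Continuous fun t : ℝ => shadow x + t • v := by fun_prop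
    have hout : ∀ t : ℝ, 1 ≤ ‖shadow x + t • v‖ →
        cap (SignType.sign (height x)) (shadow x + t • v) ∉ ι '' insideOf K := by
      rintro t ht ⟨y, hy, hyt⟩
      exact heq y hy (by rw [hyt]; exact height_cap_eq_zero _ ht)
    refine h.exists_chord hK (e := fun t => cap (SignType.sign (height x)) (shadow x + t • v))
      (s₀ := -(2 / ‖v‖)) (t₀ := 0) (s₁ := 2 / ‖v‖)
      ((continuous_cap _).comp hc).continuousOn (by linarith) hR.le
      (hout _ (hfar _ (by rw [abs_neg, abs_of_pos hR]))) ?_ (hout _ (hfar _ (abs_of_pos hR))) ?_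
    · simp only [zero_smul, add_zero]
      rw [cap_shadow (heq z hz)]
      exact mem_image_of_mem ι hz
    · intro t₁ t₂ _ h12 _ hin _
      have hle : Icc t₁ t₂ ⊆ {t | ‖shadow x + t • v‖ ≤ 1} := by
        rw [← closure_Ioo h12.ne]
        refine closure_minimal (fun t ht => ?_) (isClosed_le hc.norm continuous_const)
        by_contra hcon
        exact hout t (not_le.mp hcon).le (hin t ht)
      refine ⟨fun s hs t ht hst => ?_, fun t ht => Or.inr ⟨l, hl, ?_⟩⟩
      · have := congrArg shadow hst
        rw [shadow_cap _ (hle hs), shadow_cap _ (hle ht), add_right_inj] at this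
        exact smul_left_injective ℝ hv0 this
      · rw [shadow_cap _ (hle ht), inner_add_right, inner_smul_right, hlv, mul_zero, add_zero, hlz]

theorem IsPreconnected.sign_eq {X : Type*} [TopologicalSpace X] {S : Set X}
    (hS : IsPreconnected S) {f : X → ℝ} (hf : ContinuousOn f S) (h0 : ∀ x ∈ S, f x ≠ 0) {x y : X}
    (hx : x ∈ S) (hy : y ∈ S) : SignType.sign (f x) = SignType.sign (f y) := by
  have key : ∀ x ∈ S, ∀ y ∈ S, f x < 0 → f y < 0 := by
    intro x hx y hy hfx
    by_contra! hfy
    obtain ⟨z, hz, hz0⟩ := hS.intermediate_value hx hy hf ⟨hfx.le, hfy⟩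
    exact h0 z hz hz0
  rcases (h0 x hx).lt_or_gt with hfx | hfx
  · rw [sign_neg hfx, sign_neg (key x hx y hy hfx)]
  · rcases (h0 y hy).lt_or_gt with hfy | hfy
    · exact absurd (key y hy x hx hfy) hfx.not_gt
    · rw [sign_pos hfx, sign_pos hfy]

/-- The closed cells of an arrangement of lines are disks. -/
theorem IsStereographic.isDiskWithBoundary_of_cell (h : IsStereographic N ψ ι) {K : Set ℂ}
    (hK : IsJordanCurve K) (hΛ : Λ.Finite) (hN : N ∈ arrangement Λ) (hKT : K ⊆ ι ⁻¹' arrangement Λ)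
    (hJT : insideOf K ∩ ι ⁻¹' arrangement Λ = ∅) : IsDiskWithBoundary K (K ∪ insideOf K) := by
  obtain ⟨z₀, hz₀⟩ := hK.insideOf_nonempty
  have hoff : ∀ z ∈ insideOf K, ι z ∉ arrangement Λ := fun z hz hT =>
    (hJT.subset ⟨hz, hT⟩ : z ∈ (∅ : Set ℂ))
  obtain ⟨hσ, hκ⟩ := notMem_arrangement_iff.mp (hoff z₀ hz₀)
  set σ := (signs Λ (ι z₀)).1 with hσdef
  set κ := (signs Λ (ι z₀)).2 with hκdef
  have hcell : ι '' insideOf K = cap σ '' cellShadow Λ κ := by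
    rw [← setOf_signs_eq hσ hκ]
    apply subset_antisymm
    · rintro _ ⟨z, hz, rfl⟩
      refine ⟨hoff z hz, Prod.ext ?_ (funext fun l => ?_)⟩
      · exact hK.isPreconnected_insideOf.sign_eq (f := fun z => height (ι z))
          (continuous_height.comp h.continuous_symm).continuousOn
          (fun z hz h0 => hoff z hz (Or.inl h0)) hz hz₀
      · exact hK.isPreconnected_insideOf.sign_eq
          (f := fun z => inner ℝ l.1.1 (shadow (ι z)) - l.1.2)
          ((continuous_const.inner (continuous_shadow.comp h.continuous_symm)).sub
            continuous_const).continuousOn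
          (fun z hz h0 => hoff z hz (Or.inr ⟨l, l.2, sub_eq_zero.mp h0⟩)) hz hz₀
    · have hNc : N ∉ {x | x ∉ arrangement Λ ∧ signs Λ x = (σ, κ)} := fun hN' => hN'.1 hN
      rw [← h.symm_image hNc]
      refine image_mono (IsPreconnected.subset_insideOf hK.isCompact
        ((isPreconnected_setOf_signs_eq (σ, κ)).image ψ (h.continuousOn.mono fun x hx hxN =>
          hNc (hxN ▸ hx))) ?_ ⟨ι z₀, ⟨hoff z₀ hz₀, rfl⟩, h.right_inv z₀⟩ hz₀)
      rw [disjoint_left]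
      rintro _ ⟨x, hx, rfl⟩ hxK
      have := hKT hxK
      rw [mem_preimage, h.left_inv x fun hxN => hNc (hxN ▸ hx)] at this
      exact hx.1 this
  set G := cellShadow Λ κ with hG
  have hGc : Convex ℝ G := convex_cellShadow
  have hGo : IsOpen G := isOpen_cellShadow hΛ hκ
  have hGne : G.Nonempty := by
    have : (cap σ '' G).Nonempty := hcell ▸ ⟨ι z₀, mem_image_of_mem ι hz₀⟩
    exact this.of_image
  have hGle : ∀ c ∈ closure G, ‖c‖ ≤ 1 := fun c hc => by
    have : closure G ⊆ Metric.closedBall 0 1 :=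
      closure_minimal (fun c hc => mem_closedBall_zero_iff.mpr hc.1.le) Metric.isClosed_closedBall
    exact mem_closedBall_zero_iff.mp (this hc)
  have hGcpt : IsCompact (closure G) := (isCompact_closedBall (0 : Plane) 1).of_isClosed_subset
    isClosed_closure fun c hc => mem_closedBall_zero_iff.mpr (hGle c hc)
  have hcpt : IsCompact (K ∪ insideOf K) := by
    rw [← hK.closure_insideOf]
    exact (isBounded_insideOf hK.isCompact).isCompact_closure
  have hcl : cap σ '' closure G ⊆ ι '' (K ∪ insideOf K) := by
    refine (image_closure_subset_closure_image (continuous_cap σ)).trans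
      (closure_minimal ?_ (hcpt.image h.continuous_symm).isClosed)
    rw [← hcell]
    exact image_mono subset_union_right
  have hcapN : MapsTo (cap σ) (closure G) {N}ᶜ := fun c hc hN' =>
    h.notMem_image_symm _ (mem_singleton_iff.mp hN' ▸ hcl (mem_image_of_mem _ hc))
  have hfc : ContinuousOn (ψ ∘ cap σ) (closure G) :=
    h.continuousOn.comp (continuous_cap σ).continuousOn hcapN
  have hfi : InjOn (ψ ∘ cap σ) (closure G) := h.injOn.comp (fun c hc d hd hcd => by
    rw [← shadow_cap σ (hGle c hc), hcd, shadow_cap σ (hGle d hd)]) hcapN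
  have hfG : ψ ∘ cap σ '' G = insideOf K := by
    rw [image_comp, ← hcell, h.image_symm]
  have hfcl : ψ ∘ cap σ '' closure G = K ∪ insideOf K := by
    apply subset_antisymm
    · rw [image_comp, ← h.image_symm (K ∪ insideOf K)]
      exact image_mono hcl
    · rw [← hK.closure_insideOf]
      refine closure_minimal ?_ (hGcpt.image_of_continuousOn hfc).isClosed
      rw [← hfG]
      exact image_mono subset_closure
  have hint : interior (closure G) = G := by
    rw [hGc.interior_closure_eq_interior_of_nonempty_interior (by rwa [hGo.interior_eq]),
      hGo.interior_eq]
  have hfr : ψ ∘ cap σ '' frontier (closure G) = K := by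
    rw [frontier, closure_closure, hint, hfi.image_sdiff_subset subset_closure, hfG, hfcl]
    ext z
    simp only [Set.mem_sdiff, mem_union]
    exact ⟨fun hz => hz.1.resolve_right hz.2, fun hz => ⟨Or.inl hz, fun hz' => hz'.1 hz⟩⟩
  have := IsDiskWithBoundary.of_convex Complex.orthonormalBasisOneI.repr hGc.closure hGcpt
    (by rwa [hint]) hfc hfi
  rwa [hfr, hfcl] at this

/-- A simple closed curve in an arrangement of lines bounds a disk as soon as it lifts to a closed
curve of the sphere. -/
theorem boundsDisk_of_periodic_lift {C : Set RP2} (hC : IsSimpleClosedCurve C) (hΛ : Λ.Finite)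
    (h0 : ∀ l ∈ Λ, l.1 ≠ 0) (hCΛ : RP2.proj ⁻¹' C ⊆ arrangement Λ) {c : ℝ → Sphere2}
    (hc : Continuous c) (hrange : range (RP2.proj ∘ c) = C)
    (hexp : ∀ s t, RP2.proj (c s) = RP2.proj (c t) ↔ Circle.exp s = Circle.exp t)
    (hper : ∀ t, c (t + 2 * Real.pi) = c t) : BoundsDisk C := by
  have hper' : ∀ s t, Circle.exp s = Circle.exp t → c s = c t := by
    intro s t hst
    obtain ⟨m, rfl⟩ := Circle.exp_eq_exp.mp hst
    exact Function.Periodic.int_mul hper m t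
  have hinj : InjOn RP2.proj (range c) := by
    rintro _ ⟨s, rfl⟩ _ ⟨t, rfl⟩ hst
    exact hper' s t ((hexp s t).mp hst)
  have hanti : ∀ s t, c s ≠ -c t := by
    intro s t hst
    have : RP2.proj (c s) = RP2.proj (c t) := by rw [hst, RP2.proj_neg]
    exact ne_neg (c t) ((hinj ⟨s, rfl⟩ ⟨t, rfl⟩ this).symm.trans hst)
  have hcpt : IsCompact (range c) := by
    have : range c = c '' Icc 0 (2 * Real.pi) := by
      refine subset_antisymm ?_ (image_subset_range _ _)
      rintro _ ⟨t, rfl⟩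
      obtain ⟨s, hs, hst⟩ := Circle.exists_exp_eq (Circle.exp t)
      exact ⟨s, Ico_subset_Icc_self hs, hper' s t hst⟩
    rw [this]
    exact isCompact_Icc.image hc
  have himg : RP2.proj '' range c = C := by rw [← range_comp, hrange]
  have hJ : IsJordanCurve (range c) := by
    have : Nonempty Sphere2 := ⟨c 0⟩
    have hinv := continuousOn_invFunOn_of_isCompact hcpt RP2.continuous_proj.continuousOn hinj
    have := IsJordanCurve.image (C := RP2.proj '' range c) (himg ▸ hC) hinv
      (Function.invFunOn_injOn_image _ _)
    rwa [hinj.leftInvOn_invFunOn.image_image] at this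
  obtain ⟨ψ, ι, h⟩ := exists_isStereographic (-c 0)
  have hN : -c 0 ∉ range c := fun ⟨s, hs⟩ => hanti s 0 hs
  have hsub : range c ⊆ {-c 0}ᶜ := fun x hx hxN => hN (mem_singleton_iff.mp hxN ▸ hx)
  have hcT : range c ⊆ arrangement Λ := by
    rintro _ ⟨t, rfl⟩
    exact hCΛ (himg ▸ mem_image_of_mem _ ⟨t, rfl⟩)
  have hNT : -c 0 ∈ arrangement Λ := hCΛ (by
    rw [mem_preimage, RP2.proj_neg, ← himg]
    exact mem_image_of_mem _ ⟨0, rfl⟩)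
  set K := ψ '' range c with hKdef
  have hK : IsJordanCurve K := hJ.image (h.continuousOn.mono hsub) (h.injOn.mono hsub)
  have hιK : ι '' K = range c := h.symm_image hN
  have hfree := h.symm_ne_neg_symm hK (by rw [neg_neg, hιK]; exact ⟨0, rfl⟩) (by
    intro z hz w hw hzw
    obtain ⟨s, hs⟩ := hιK.subset (mem_image_of_mem ι hz)
    obtain ⟨t, ht⟩ := hιK.subset (mem_image_of_mem ι hw)
    exact hanti s t (by rw [hs, ht, hzw]))
  have hfin := hΛ.to_subtype
  have hdisk : IsDiskWithBoundary K (K ∪ insideOf K) := by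
    refine isDiskWithBoundary_of_chords (T := ι ⁻¹' arrangement Λ) (I₀ := insideOf K)
      (key := signs Λ ∘ ι) ?_ ?_ ?_ ?_ hK ?_ subset_rfl
    · rw [dense_iff_inter_open]
      intro U hU hUne
      obtain ⟨_, ⟨z, hz, rfl⟩, hzT⟩ := (dense_compl_arrangement hΛ h0).inter_open_nonempty _
        (h.isOpen_image_symm hU) (hUne.image ι)
      exact ⟨z, hz, hzT⟩
    · intro k
      have : {z | z ∉ ι ⁻¹' arrangement Λ ∧ (signs Λ ∘ ι) z = k} =
          ψ '' {x | x ∉ arrangement Λ ∧ signs Λ x = k} := by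
        ext z
        constructor
        · rintro ⟨hz, hzk⟩
          exact ⟨ι z, ⟨hz, hzk⟩, h.right_inv z⟩
        · rintro ⟨x, hx, rfl⟩
          have : ι (ψ x) = x := h.left_inv x fun hxN => hx.1 (hxN ▸ hNT)
          exact ⟨by rw [mem_preimage, this]; exact hx.1,
            by rw [Function.comp_apply, this]; exact hx.2⟩
      rw [this]
      exact (isPreconnected_setOf_signs_eq k).image _ (h.continuousOn.mono fun x hx hxN =>
        hx.1 (mem_singleton_iff.mp hxN ▸ hNT))
    · intro K' hK' _ hI hne
      have hcl : K' ∪ insideOf K' ⊆ K ∪ insideOf K := by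
        rw [← hK'.closure_insideOf, ← hK.closure_insideOf]
        exact closure_mono hI
      exact h.exists_chord_arrangement hK' (fun z hz w hw => hfree z (hcl hz) w (hcl hw)) h0 hne
    · exact fun K' hK' hT _ he => h.isDiskWithBoundary_of_cell hK' hΛ hNT hT he
    · rw [← image_subset_iff, hιK]
      exact hcT
  obtain ⟨f, hf, hfi, hfs, hfb⟩ := hdisk
  let L := Complex.orthonormalBasisOneI.repr.symm
  have hLb : ∀ z : UnitDisk, L (z : Plane) ∈ Metric.closedBall (0 : ℂ) 1 := fun z => by
    rw [mem_closedBall_zero_iff, L.norm_map]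
    exact mem_closedBall_zero_iff.mp z.2
  refine ⟨fun z => RP2.proj (ι (f (L z))), ?_, fun z w hzw => ?_, ?_⟩
  · refine RP2.continuous_proj.comp (h.continuous_symm.comp (hf.comp_continuous ?_ hLb))
    exact L.continuous.comp continuous_subtype_val
  · have hmem : ∀ z : UnitDisk, f (L z) ∈ K ∪ insideOf K := fun z =>
      hfb ▸ mem_image_of_mem f (hLb z)
    rcases RP2.proj_eq_proj_iff.mp hzw with h' | h'
    · exact Subtype.ext (L.injective (hfi (hLb z) (hLb w) (h.injective_symm h').symm))
    · exact absurd h' (hfree _ (hmem w) _ (hmem z))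
  · have : (fun z : UnitDisk => L (z : Plane)) '' {z | ‖(z : Plane)‖ = 1} =
        Metric.sphere (0 : ℂ) 1 := by
      ext y
      constructor
      · rintro ⟨z, hz, rfl⟩
        rw [mem_sphere_zero_iff_norm, L.norm_map]
        exact hz
      · intro hy
        rw [mem_sphere_zero_iff_norm, ← L.symm.norm_map] at hy
        exact ⟨⟨L.symm y, mem_closedBall_zero_iff.mpr hy.le⟩, hy, L.apply_symm_apply y⟩
    rw [← himg, ← hιK, ← hfs, ← this, image_image, image_image, image_image]

end

/-! ### Symmetric curves separate antipodes -/

section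
open Sphere2 ComplexConjugate
variable {N : Sphere2} {ψ : Sphere2 → ℂ} {ι : ℂ → Sphere2} {D : Set Sphere2}

theorem IsStereographic.hasSqrtOn_image_iff (h : IsStereographic N ψ ι) (hN : N ∉ D) {φ : ℂ → ℂ} :
    HasSqrtOn φ (ψ '' D) ↔ HasSqrtOn (fun y => φ (ψ y)) D := by
  have hsub : D ⊆ {N}ᶜ := fun x hx hxN => hN (mem_singleton_iff.mp hxN ▸ hx)
  constructor
  · rintro ⟨g, hg, hg2⟩
    exact ⟨g ∘ ψ, hg.comp (h.continuousOn.mono hsub) (mapsTo_image ψ D),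
      fun y hy => hg2 _ (mem_image_of_mem ψ hy)⟩
  · rintro ⟨g, hg, hg2⟩
    refine ⟨g ∘ ι, hg.comp h.continuous_symm.continuousOn ?_, ?_⟩
    · rintro _ ⟨y, hy, rfl⟩
      rwa [h.left_inv y (hsub hy)]
    · rintro _ ⟨y, hy, rfl⟩
      rw [Function.comp_apply, h.left_inv y (hsub hy), hg2 y hy]

/-- The quotient `(w - z) / (w - z')`, where `z` and `z'` are antipodal, has no square root `g` on a
symmetric connected set, because `g (-y) * conj (g y)` would be a constant, not real but equal to
its conjugate. -/
theorem IsStereographic.not_hasSqrtOn_div (h : IsStereographic N ψ ι) (hD : IsPreconnected D)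
    (hne : D.Nonempty) (hsymm : ∀ y ∈ D, -y ∈ D) (hN : N ∉ D) {x : Sphere2} (hx : x ∉ D)
    (hxN : x ≠ N) (hxN' : x ≠ -N) :
    ¬ HasSqrtOn (fun y => (ψ y - ψ x) * (ψ y - ψ (-x))⁻¹) D := by
  rintro ⟨g, hg, hg2⟩
  replace hg2 : ∀ y ∈ D, g y ^ 2 = (ψ y - ψ x) * (ψ y - ψ (-x))⁻¹ := hg2
  have hneg : ∀ y ∈ D, y ≠ N ∧ y ≠ -N := fun y hy => ⟨fun hyN => hN (hyN ▸ hy), fun hyN =>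
    hN (by simpa [hyN] using hsymm y hy)⟩
  have hz := h.map_neg_mul x hxN hxN'
  have hz0 : ψ x ≠ 0 := fun h0 => by simp [h0] at hz
  have hz0' : conj (ψ x) ≠ 0 := fun h0 => by simp [h0] at hz
  have hsq : ∀ y ∈ D, (g (-y) * conj (g y)) ^ 2 = (Complex.I * ‖ψ x‖) ^ 2 := by
    intro y hy
    obtain ⟨hyN, hyN'⟩ := hneg y hy
    have hw := h.map_neg_mul y hyN hyN'
    have hw0' : conj (ψ y) ≠ 0 := fun h0 => by simp [h0] at hw
    have h1 : ψ y - ψ x ≠ 0 := sub_ne_zero.mpr fun he => hx (h.injOn hyN hxN he ▸ hy)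
    have hxn : -x ≠ N := fun he => hxN' (by rw [← he, neg_neg])
    have h2 : ψ y - ψ (-x) ≠ 0 := sub_ne_zero.mpr fun he =>
      hx (by simpa [h.injOn hyN hxn he] using hsymm y hy)
    rw [mul_pow, ← map_pow, hg2 y hy, hg2 (-y) (hsymm y hy), mul_pow, Complex.I_sq,
      ← Complex.mul_conj']
    have hw' : ψ (-y) = -1 / conj (ψ y) := by rw [eq_div_iff hw0', hw]
    have hz' : ψ (-x) = -1 / conj (ψ x) := by rw [eq_div_iff hz0', hz]
    have h1' : conj (ψ y) - conj (ψ x) ≠ 0 := by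
      rw [← map_sub]
      exact (map_ne_zero _).mpr h1
    have h2' : 1 + ψ x * conj (ψ y) ≠ 0 := by
      intro h0
      apply (map_ne_zero (starRingEnd ℂ)).mpr h2
      rw [map_sub, hz', map_div₀, Complex.conj_conj, map_neg, map_one, sub_eq_zero,
        eq_div_iff hz0]
      linear_combination h0
    rw [map_mul, map_inv₀, map_sub, map_sub, hw', hz', map_div₀, Complex.conj_conj,
      map_neg, map_one]
    have e1 : -1 / conj (ψ y) - ψ x = -(1 + ψ x * conj (ψ y)) / conj (ψ y) := by
      field_simp
      ring
    have e2 : -1 / conj (ψ y) - -1 / conj (ψ x) =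
        (conj (ψ y) - conj (ψ x)) / (conj (ψ x) * conj (ψ y)) := by
      field_simp
      ring
    have e3 : conj (ψ y) - -1 / ψ x = (1 + ψ x * conj (ψ y)) / ψ x := by
      field_simp
      ring
    rw [e1, e2, e3]
    field_simp
  have hcont : ContinuousOn (fun y => g (-y) * conj (g y)) D :=
    (hg.comp continuous_neg.continuousOn hsymm).mul (Complex.continuous_conj.comp_continuousOn hg)
  have hI : (Complex.I * ‖ψ x‖ : ℂ) ≠ 0 := mul_ne_zero Complex.I_ne_zero (by simpa using hz0)
  obtain ⟨y, hy⟩ := hne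
  have hconj : g (-(-y)) * conj (g (-y)) = conj (g (-y) * conj (g y)) := by
    rw [neg_neg, map_mul, Complex.conj_conj, mul_comm]
  rcases hD.eq_or_eq_neg_of_sq_eq hcont (continuousOn_const (c := Complex.I * ‖ψ x‖)) hsq
    (fun _ => hI) with hc | hc
  · have h1 : g (-y) * conj (g y) = Complex.I * ‖ψ x‖ := hc hy
    have h2 : g (-(-y)) * conj (g (-y)) = Complex.I * ‖ψ x‖ := hc (hsymm y hy)
    rw [h1, h2] at hconj
    apply hI
    simp only [map_mul, Complex.conj_I, Complex.conj_ofReal] at hconj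
    linear_combination (1 / 2) * hconj
  · have h1 : g (-y) * conj (g y) = -(Complex.I * ‖ψ x‖) := hc hy
    have h2 : g (-(-y)) * conj (g (-y)) = -(Complex.I * ‖ψ x‖) := hc (hsymm y hy)
    rw [h1, h2] at hconj
    apply hI
    simp only [map_neg, map_mul, Complex.conj_I, Complex.conj_ofReal] at hconj
    linear_combination (-1 / 2) * hconj

/-- Of two antipodal points exactly one lies inside a symmetric Jordan curve of the sphere. -/
theorem IsStereographic.mem_insideOf_neg_iff (h : IsStereographic N ψ ι) (hD : IsJordanCurve D)
    (hsymm : ∀ y ∈ D, -y ∈ D) (hN : N ∉ D) {x : Sphere2} (hx : x ∉ D)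
    (hxN : x ≠ N) (hxN' : x ≠ -N) :
    ψ (-x) ∈ insideOf (ψ '' D) ↔ ψ x ∉ insideOf (ψ '' D) := by
  have hpre : IsPreconnected D := by
    obtain ⟨γ, hγ, -, rfl⟩ := hD
    exact isPreconnected_range hγ
  have hsub : D ⊆ {N}ᶜ := fun x hx hxN => hN (mem_singleton_iff.mp hxN ▸ hx)
  have hnot := h.not_hasSqrtOn_div hpre hD.nontrivial.nonempty hsymm hN hx hxN hxN'
  have hoff : ∀ x, x ∉ D → x ≠ N → ψ x ∉ ψ '' D := by
    rintro x hx hxN ⟨y, hy, hyx⟩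
    exact hx (h.injOn (hsub hy) hxN hyx ▸ hy)
  have hx' : -x ∉ D := fun hx' => hx (by simpa using hsymm _ hx')
  have hxn : -x ≠ N := fun he => hxN' (by rw [← he, neg_neg])
  have key : ∀ x, x ∉ D → x ≠ N →
      (ψ x ∈ insideOf (ψ '' D) ↔ ¬ HasSqrtOn (fun y => ψ y - ψ x) D) := by
    intro x hx hxN
    rw [insideOf, mem_ofPred_eq, h.hasSqrtOn_image_iff hN]
    exact and_iff_right (hoff x hx hxN)
  have hc : ∀ x, ContinuousOn (fun y => ψ y - ψ x) D := fun x =>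
    (h.continuousOn.mono hsub).sub continuousOn_const
  have hnz : ∀ x, x ∉ D → x ≠ N → ∀ y ∈ D, ψ y - ψ x ≠ 0 := fun x hx hxN y hy =>
    sub_ne_zero.mpr fun he => hoff x hx hxN ⟨y, hy, he⟩
  rw [key _ hx' hxn, key _ hx hxN, not_not]
  constructor
  · intro h1
    by_contra h2
    refine hnot (((hD.hasSqrtOn_mul (hc x) (hc (-x)) (hnz x hx hxN) (hnz _ hx' hxn) h2 h1).mul
      (⟨fun y => (ψ y - ψ (-x))⁻¹, (hc (-x)).inv₀ (hnz _ hx' hxn), fun _ _ => rfl⟩ :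
        HasSqrtOn (fun y => (ψ y - ψ (-x))⁻¹ ^ 2) D)).congr fun y hy => ?_)
    have := hnz _ hx' hxn y hy
    field_simp
  · intro h1 h2
    exact hnot (h1.mul (h2.inv (hnz _ hx' hxn)))

/-- Along a path crossing a Jordan curve of the sphere transversely, the side changes. -/
theorem IsStereographic.exists_flip (h : IsStereographic N ψ ι) {C₁ C₂ : Set RP2}
    (hD : IsJordanCurve D) (hDC : D = RP2.proj ⁻¹' C₁) (hN : N ∉ D) {c : ℝ → Sphere2}
    (hc : Continuous c) (hcC : ∀ t, RP2.proj (c t) ∈ C₂) {t₀ δ : ℝ} (hδ : 0 < δ)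
    (hinj : InjOn c (Icc (t₀ - δ) (t₀ + δ))) (ht₀ : c t₀ ∈ D)
    (htr : CrossTransverselyAt C₁ C₂ (RP2.proj (c t₀))) :
    ∃ ε > 0, ∃ P : Prop,
      (∀ t ∈ Ioo (t₀ - ε) t₀, c t ∉ D ∧ (ψ (c t) ∈ insideOf (ψ '' D) ↔ P)) ∧
      ∀ t ∈ Ioo t₀ (t₀ + ε), c t ∉ D ∧ (ψ (c t) ∈ insideOf (ψ '' D) ↔ ¬ P) := by
  have hsub : D ⊆ {N}ᶜ := fun x hx hxN => hN (mem_singleton_iff.mp hxN ▸ hx)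
  have hK : IsJordanCurve (ψ '' D) := hD.image (h.continuousOn.mono hsub) (h.injOn.mono hsub)
  obtain ⟨φ, hpφ, hφ0, hφ⟩ := htr
  obtain ⟨e, hxe, he⟩ := RP2.isLocalHomeomorph_proj (c t₀)
  set χ := e.trans φ with hχ
  have hsrc : ∀ x, x ∈ χ.source ↔ x ∈ e.source ∧ RP2.proj x ∈ φ.source := fun x => by
    rw [hχ, OpenPartialHomeomorph.trans_source, he]
    rfl
  have hχapp : ∀ x, χ x = φ (RP2.proj x) := fun x => by
    rw [hχ, OpenPartialHomeomorph.trans_apply, he]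
  have hx₀ : c t₀ ∈ χ.source := (hsrc _).mpr ⟨hxe, hpφ⟩
  have hχ0 : χ (c t₀) = 0 := by rw [hχapp, hφ0]
  have hmemD : ∀ x ∈ χ.source, (x ∈ D ↔ χ x 1 = 0) := fun x hx => by
    rw [hDC, hχapp]
    exact (hφ _ ((hsrc x).mp hx).2).1
  -- a round neighbourhood of the crossing in the chart, whose preimage avoids the pole
  obtain ⟨r, hr, hball⟩ : ∃ r > 0, Metric.ball (0 : Plane) r ⊆ χ.target ∩ χ.symm ⁻¹' {N}ᶜ := by
    refine Metric.isOpen_iff.mp (χ.isOpen_inter_preimage_symm isOpen_compl_singleton) 0 ⟨?_, ?_⟩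
    · rw [← hχ0]
      exact χ.map_source hx₀
    · rw [mem_preimage, ← hχ0, χ.left_inv hx₀]
      exact hsub ht₀
  set f : Plane → ℂ := fun v => ψ (χ.symm v) with hf
  have hfc : ContinuousOn f (Metric.ball 0 r) :=
    h.continuousOn.comp (χ.continuousOn_symm.mono fun v hv => (hball hv).1) fun v hv => (hball hv).2
  have hoff : ∀ v ∈ Metric.ball (0 : Plane) r, v 1 ≠ 0 → f v ∉ ψ '' D := by
    rintro v hv hv1 ⟨y, hy, hyv⟩
    have : χ.symm v ∈ D := h.injOn (hsub hy) (hball hv).2 hyv ▸ hy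
    rw [hmemD _ (χ.map_target (hball hv).1), χ.right_inv (hball hv).1] at this
    exact hv1 this
  have hlin : IsLinearMap ℝ fun v : Plane => v 1 := ⟨fun _ _ => rfl, fun _ _ => rfl⟩
  have hhalf : ∀ H ⊆ Metric.ball (0 : Plane) r, Convex ℝ H → (∀ v ∈ H, v 1 ≠ 0) →
      ∀ v ∈ H, f v ∈ insideOf (ψ '' D) → ∀ w ∈ H, f w ∈ insideOf (ψ '' D) := by
    intro H hHb hH hH0 v hv hvi w hw
    refine IsPreconnected.subset_insideOf hK.isCompact (hH.isPreconnected.image f (hfc.mono hHb))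
      (disjoint_left.mpr ?_) (mem_image_of_mem f hv) hvi (mem_image_of_mem f hw)
    rintro _ ⟨u, hu, rfl⟩
    exact hoff u (hHb hu) (hH0 u hu)
  have hup : ∀ v ∈ Metric.ball (0 : Plane) r, ∀ w ∈ Metric.ball (0 : Plane) r, 0 < v 1 → 0 < w 1 →
      f v ∈ insideOf (ψ '' D) → f w ∈ insideOf (ψ '' D) := fun v hv w hw hv1 hw1 hvi =>
    hhalf (Metric.ball 0 r ∩ {v | 0 < v 1}) inter_subset_left
      ((convex_ball _ _).inter (convex_halfSpace_gt hlin 0)) (fun u hu => hu.2.ne') v ⟨hv, hv1⟩ hvi w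
      ⟨hw, hw1⟩
  have hdown : ∀ v ∈ Metric.ball (0 : Plane) r, ∀ w ∈ Metric.ball (0 : Plane) r, v 1 < 0 →
      w 1 < 0 → f v ∈ insideOf (ψ '' D) → f w ∈ insideOf (ψ '' D) := fun v hv w hw hv1 hw1 hvi =>
    hhalf (Metric.ball 0 r ∩ {v | v 1 < 0}) inter_subset_left
      ((convex_ball _ _).inter (convex_halfSpace_lt hlin 0)) (fun u hu => hu.2.ne) v ⟨hv, hv1⟩ hvi w
      ⟨hw, hw1⟩
  have hBopen : IsOpen (χ.source ∩ χ ⁻¹' Metric.ball 0 r) :=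
    χ.isOpen_inter_preimage Metric.isOpen_ball
  have hx₀B : c t₀ ∈ χ.source ∩ χ ⁻¹' Metric.ball 0 r :=
    ⟨hx₀, by rw [mem_preimage, hχ0]; exact Metric.mem_ball_self hr⟩
  -- both sides of the curve accumulate at the crossing
  have hex : ∀ U : Set ℂ, ψ '' D ⊆ closure U → U ⊆ (ψ '' D)ᶜ →
      ∃ v ∈ Metric.ball (0 : Plane) r, v 1 ≠ 0 ∧ f v ∈ U := by
    intro U hU hUD
    obtain ⟨z, hz, hzU⟩ := mem_closure_iff.mp (hU (mem_image_of_mem ψ ht₀)) _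
      (hBopen.preimage h.continuous_symm) (by
        rw [mem_preimage, h.left_inv _ (hsub ht₀)]
        exact hx₀B)
    refine ⟨χ (ι z), hz.2, fun h0 => ?_, ?_⟩
    · exact hUD hzU ⟨ι z, (hmemD _ hz.1).mpr h0, h.right_inv z⟩
    · rw [hf]
      simp only
      rwa [χ.left_inv hz.1, h.right_inv]
  obtain ⟨v, hv, hv1, hvi⟩ := hex _ (hK.subset_closure_insideOf hK.insideOf_nonempty)
    fun z hz => hz.1
  obtain ⟨w, hw, hw1, hwo⟩ := hex _ (hK.subset_closure_outsideOf hK.insideOf_nonempty)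
    fun z hz => hz.1
  have hwi : f w ∉ insideOf (ψ '' D) := fun hwi =>
    disjoint_left.mp (disjoint_insideOf_outsideOf _) hwi hwo
  obtain ⟨P, hP, hP'⟩ : ∃ P : Prop,
      (∀ u ∈ Metric.ball (0 : Plane) r, 0 < u 1 → (f u ∈ insideOf (ψ '' D) ↔ ¬ P)) ∧
      ∀ u ∈ Metric.ball (0 : Plane) r, u 1 < 0 → (f u ∈ insideOf (ψ '' D) ↔ P) := by
    rcases hv1.lt_or_gt with hv1 | hv1 <;> rcases hw1.lt_or_gt with hw1 | hw1
    · exact absurd (hdown v hv w hw hv1 hw1 hvi) hwi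
    · exact ⟨True, fun u hu hu1 => iff_of_false (fun hui => hwi (hup u hu w hw hu1 hw1 hui))
        (not_not.mpr trivial), fun u hu hu1 => iff_of_true (hdown v hv u hu hv1 hu1 hvi) trivial⟩
    · exact ⟨False, fun u hu hu1 => iff_of_true (hup v hv u hu hv1 hu1 hvi) not_false,
        fun u hu hu1 => iff_of_false (fun hui => hwi (hdown u hu w hw hu1 hw1 hui)) not_false⟩
    · exact absurd (hup v hv w hw hv1 hw1 hvi) hwi
  -- the path runs monotonically along the other axis
  obtain ⟨η, hη, hηB⟩ := Metric.isOpen_iff.mp (hBopen.preimage hc) t₀ hx₀B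
  set ε := min (η / 2) δ with hε
  have hε0 : 0 < ε := lt_min (half_pos hη) hδ
  have hmem : ∀ t ∈ Icc (t₀ - ε) (t₀ + ε), c t ∈ χ.source ∩ χ ⁻¹' Metric.ball 0 r := fun t ht => by
    refine hηB ?_
    rw [Metric.mem_ball, Real.dist_eq, abs_lt]
    constructor <;> linarith [ht.1, ht.2, min_le_left (η / 2) δ]
  have hsubδ : Icc (t₀ - ε) (t₀ + ε) ⊆ Icc (t₀ - δ) (t₀ + δ) :=
    Icc_subset_Icc (by linarith [min_le_right (η / 2) δ]) (by linarith [min_le_right (η / 2) δ])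
  have hyc : ContinuousOn (fun t => χ (c t) 1) (Icc (t₀ - ε) (t₀ + ε)) := by
    have : ContinuousOn (fun t => χ (c t)) (Icc (t₀ - ε) (t₀ + ε)) :=
      χ.continuousOn.comp hc.continuousOn fun t ht => (hmem t ht).1
    exact (PiLp.continuous_apply 2 _ 1).comp_continuousOn this
  have hyi : InjOn (fun t => χ (c t) 1) (Icc (t₀ - ε) (t₀ + ε)) := by
    intro s hs t ht hst
    have h0 : ∀ t ∈ Icc (t₀ - ε) (t₀ + ε), χ (c t) 0 = 0 := fun t ht => by
      rw [hχapp]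
      exact (hφ _ ((hsrc _).mp (hmem t ht).1).2).2.mp (hcC t)
    refine hinj (hsubδ hs) (hsubδ ht) (χ.injOn (hmem s hs).1 (hmem t ht).1 ?_)
    ext i
    fin_cases i
    · exact (h0 s hs).trans (h0 t ht).symm
    · exact hst
  have hfc : ∀ t ∈ Icc (t₀ - ε) (t₀ + ε), ψ (c t) = f (χ (c t)) := fun t ht => by
    rw [hf]
    simp only
    rw [χ.left_inv (hmem t ht).1]
  have hmid : t₀ ∈ Icc (t₀ - ε) (t₀ + ε) := ⟨by linarith, by linarith⟩
  have h10 : χ (c t₀) 1 = 0 := by rw [hχ0]; rfl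
  have hD1 : ∀ t ∈ Icc (t₀ - ε) (t₀ + ε), χ (c t) 1 ≠ 0 → c t ∉ D := fun t ht h1 hcD =>
    h1 ((hmemD _ (hmem t ht).1).mp hcD)
  rcases hyc.strictMonoOn_of_injOn_Icc' (by linarith) hyi with hm | hm
  · refine ⟨ε, hε0, P, fun t ht => ?_, fun t ht => ?_⟩
    · have ht' : t ∈ Icc (t₀ - ε) (t₀ + ε) := ⟨ht.1.le, by linarith [ht.2]⟩
      have := hm ht' hmid ht.2
      simp only [h10] at this
      exact ⟨hD1 t ht' this.ne, by rw [hfc t ht']; exact hP' _ (hmem t ht').2 this⟩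
    · have ht' : t ∈ Icc (t₀ - ε) (t₀ + ε) := ⟨by linarith [ht.1], ht.2.le⟩
      have := hm hmid ht' ht.1
      simp only [h10] at this
      exact ⟨hD1 t ht' this.ne', by rw [hfc t ht']; exact hP _ (hmem t ht').2 this⟩
  · refine ⟨ε, hε0, ¬ P, fun t ht => ?_, fun t ht => ?_⟩
    · have ht' : t ∈ Icc (t₀ - ε) (t₀ + ε) := ⟨ht.1.le, by linarith [ht.2]⟩
      have := hm ht' hmid ht.2
      simp only [h10] at this
      exact ⟨hD1 t ht' this.ne', by rw [hfc t ht']; exact hP _ (hmem t ht').2 this⟩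
    · have ht' : t ∈ Icc (t₀ - ε) (t₀ + ε) := ⟨by linarith [ht.1], ht.2.le⟩
      have := hm hmid ht' ht.1
      simp only [h10] at this
      exact ⟨hD1 t ht' this.ne, by rw [hfc t ht', not_not]; exact hP' _ (hmem t ht').2 this⟩

end

/-! ### Counting crossings -/

/-- A two-valued function that is locally constant off `Z` and jumps at each point of `Z` has
different values at the ends of an interval precisely if it meets `Z` in an odd number of points. -/
theorem finite_and_odd_ncard_of_flips {Z : Set ℝ} {P : ℝ → Prop}
    (hloc : ∀ t ∉ Z, ∀ᶠ s in 𝓝 t, s ∉ Z ∧ (P s ↔ P t))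
    (hflip : ∀ t ∈ Z, ∃ ε > 0, ∃ Q : Prop, (∀ s ∈ Ioo (t - ε) t, s ∉ Z ∧ (P s ↔ Q)) ∧
      ∀ s ∈ Ioo t (t + ε), s ∉ Z ∧ (P s ↔ ¬ Q)) {a b : ℝ} (hab : a ≤ b) (ha : a ∉ Z) (hb : b ∉ Z) :
    (Z ∩ Icc a b).Finite ∧ (Odd (Z ∩ Icc a b).ncard ↔ ¬ (P a ↔ P b)) := by
  have hfin : ∀ a b : ℝ, (Z ∩ Icc a b).Finite := by
    intro a b
    refine isCompact_Icc.induction_on (p := fun s => (Z ∩ s).Finite) (by simp)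
      (fun s t hst ht => ht.subset (inter_subset_inter_right _ hst))
      (fun s t hs ht => by rw [inter_union_distrib_left]; exact hs.union ht) fun t _ => ?_
    by_cases ht : t ∈ Z
    · obtain ⟨ε, hε, Q, h1, h2⟩ := hflip t ht
      refine ⟨Ioo (t - ε) (t + ε), mem_nhdsWithin_of_mem_nhds
        (Ioo_mem_nhds (by linarith) (by linarith)), (finite_singleton t).subset ?_⟩
      rintro s ⟨hsZ, hs⟩
      by_contra hst
      rcases lt_or_gt_of_ne (show s ≠ t from hst) with hst | hst
      · exact (h1 s ⟨hs.1, hst⟩).1 hsZ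
      · exact (h2 s ⟨hst, hs.2⟩).1 hsZ
    · refine ⟨{s | s ∉ Z}, mem_nhdsWithin_of_mem_nhds ((hloc t ht).mono fun s hs => hs.1), ?_⟩
      have : Z ∩ {s | s ∉ Z} = ∅ := by
        ext s
        simp
      rw [this]
      exact finite_empty
  have hconst : ∀ a b : ℝ, a ≤ b → Z ∩ Icc a b = ∅ → (P a ↔ P b) := by
    intro a b hab he
    refine isPreconnected_Icc.induction₂ (fun s t => P s ↔ P t) (fun t ht => ?_)
      (fun _ _ _ _ _ _ => Iff.trans) (fun _ _ _ _ => Iff.symm) (left_mem_Icc.mpr hab)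
      (right_mem_Icc.mpr hab)
    have htZ : t ∉ Z := fun htZ => (he.subset ⟨htZ, ht⟩ : t ∈ (∅ : Set ℝ))
    exact mem_nhdsWithin_of_mem_nhds ((hloc t htZ).mono fun s hs => hs.2.symm)
  refine ⟨hfin a b, ?_⟩
  induction hn : (Z ∩ Icc a b).ncard generalizing b with
  | zero =>
    rw [ncard_eq_zero (hfin a b)] at hn
    simp [hconst a b hab hn]
  | succ n ih =>
    have hne : (Z ∩ Icc a b).Nonempty := by
      rw [← ncard_pos (hfin a b)]
      omega
    -- remove the last jump
    obtain ⟨t, ⟨htZ, hta, htb⟩, hmax⟩ := (hfin a b).exists_maximalFor id _ hne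
    have hmax' : ∀ s ∈ Z ∩ Icc a b, s ≤ t := fun s hs => by
      by_contra! hts
      exact absurd (hmax hs hts.le) (not_le.mpr hts)
    have hta' : a < t := lt_of_le_of_ne hta fun h => ha (h ▸ htZ)
    have htb' : t < b := lt_of_le_of_ne htb fun h => hb (h ▸ htZ)
    obtain ⟨ε, hε, Q, h1, h2⟩ := hflip t htZ
    obtain ⟨s, hs1, hst⟩ := exists_between (max_lt hta' (sub_lt_self t hε))
    obtain ⟨u, htu, hu1⟩ := exists_between (lt_min htb' (lt_add_of_pos_right t hε))
    obtain ⟨has, hεs⟩ := max_lt_iff.mp hs1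
    obtain ⟨hub, huε⟩ := lt_min_iff.mp hu1
    have hs := h1 s ⟨hεs, hst⟩
    have hu := h2 u ⟨htu, huε⟩
    have hcut : Z ∩ Icc a s = (Z ∩ Icc a b) \ {t} := by
      ext v
      constructor
      · rintro ⟨hv, hva, hvs⟩
        exact ⟨⟨hv, hva, by linarith⟩, by simp only [mem_singleton_iff]; linarith⟩
      · rintro ⟨⟨hv, hva, hvb⟩, hvt⟩
        refine ⟨hv, hva, ?_⟩
        by_contra! hsv
        have hvt' : v < t := lt_of_le_of_ne (hmax' v ⟨hv, hva, hvb⟩) hvt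
        exact (h1 v ⟨by linarith, hvt'⟩).1 hv
    have hcard : (Z ∩ Icc a s).ncard = n := by
      rw [hcut, ncard_sdiff_singleton_of_mem (show t ∈ Z ∩ Icc a b from ⟨htZ, hta, htb⟩), hn]
      rfl
    have hub' := hconst u b hub.le (by
      rw [eq_empty_iff_forall_notMem]
      rintro v ⟨hv, hvu, hvb⟩
      linarith [hmax' v ⟨hv, by linarith, hvb⟩])
    have := ih has.le hs.1 hcard
    rw [Nat.odd_add_one, this]
    tauto

section
open Sphere2

/-- A set of finitely many segments of the disk lies on a finite arrangement of lines. -/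
theorem exists_arrangement_of_segments {S : Set (UnitDisk × UnitDisk)} (hS : S.Finite) :
    ∃ Λ : Set (Plane × ℝ), Λ.Finite ∧ (∀ l ∈ Λ, l.1 ≠ 0) ∧
      RP2.proj ⁻¹' (⋃ s ∈ S, RP2.segment s.1 s.2) ⊆ arrangement Λ := by
  have hn : ∀ s : UnitDisk × UnitDisk, ∃ n : Plane, n ≠ 0 ∧
      inner ℝ n ((s.2 : Plane) - s.1) = (0 : ℝ) := by
    intro s
    set v : Plane := (s.2 : Plane) - s.1
    by_cases hv : v = 0
    · exact ⟨!₂[1, 0], fun h => one_ne_zero (congrFun (congrArg WithLp.ofLp h) 0),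
        by rw [hv, inner_zero_right]⟩
    · refine ⟨!₂[-v 1, v 0], fun h => hv ?_, ?_⟩
      · have e0 := congrFun (congrArg WithLp.ofLp h) 0
        have e1 := congrFun (congrArg WithLp.ofLp h) 1
        ext i
        fin_cases i
        · simpa using e1
        · simpa using e0
      · simp only [PiLp.inner_apply, Fin.sum_univ_two]
        simp [mul_comm]
  choose n hn0 hn using hn
  refine ⟨(fun s => (n s, inner ℝ (n s) (s.1 : Plane))) '' S ∪
    (fun s => (n s, -inner ℝ (n s) (s.1 : Plane))) '' S, (hS.image _).union (hS.image _), ?_, ?_⟩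
  · rintro _ (⟨s, -, rfl⟩ | ⟨s, -, rfl⟩) <;> exact hn0 s
  · intro x hx
    obtain ⟨s, hs, z, hz, hzx⟩ := mem_iUnion₂.mp hx
    have hz' : inner ℝ (n s) (z : Plane) = (inner ℝ (n s) (s.1 : Plane) : ℝ) := by
      rw [mem_ofPred_eq, segment_eq_image'] at hz
      obtain ⟨t, -, ht⟩ := hz
      rw [← ht, inner_add_right, inner_smul_right, hn, mul_zero, add_zero]
    rw [← RP2.proj_lift, RP2.proj_eq_proj_iff] at hzx
    rcases hzx with rfl | rfl
    · exact Or.inr ⟨_, Or.inl ⟨s, hs, rfl⟩, hz'⟩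
    · refine Or.inr ⟨_, Or.inr ⟨s, hs, rfl⟩, ?_⟩
      rw [shadow_neg, shadow_lift, inner_neg_right, hz']

theorem Circle.exp_half_eq_of_antiperiodic {c : ℝ → Sphere2}
    (hexp : ∀ s t, RP2.proj (c s) = RP2.proj (c t) ↔ Circle.exp s = Circle.exp t)
    (hanti : ∀ t, c (t + 2 * Real.pi) = -c t) {s t : ℝ} (hst : c s = c t) :
    Circle.exp (s / 2) = Circle.exp (t / 2) := by
  obtain ⟨m, hm⟩ := Circle.exp_eq_exp.mp ((hexp s t).mp (by rw [hst]))
  have hper : Function.Periodic c (4 * Real.pi) := fun t => by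
    rw [show t + 4 * Real.pi = t + 2 * Real.pi + 2 * Real.pi by ring, hanti, hanti, neg_neg]
  rcases m.even_or_odd' with ⟨k, rfl | rfl⟩
  · exact Circle.exp_eq_exp.mpr ⟨k, by rw [hm]; push_cast; ring⟩
  · exfalso
    have : c s = -c t := by
      rw [hm, show t + ((2 * k + 1 : ℤ) : ℝ) * (2 * Real.pi) = t + 2 * Real.pi + k * (4 * Real.pi) by
        push_cast; ring, hper.int_mul k, hanti]
    exact ne_neg (c t) (hst.symm.trans this)

/-- The preimage in the sphere of a simple closed curve with antiperiodic lift is a Jordan curve. -/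
theorem isJordanCurve_range_of_antiperiodic {c : ℝ → Sphere2} (hc : Continuous c)
    (hexp : ∀ s t, RP2.proj (c s) = RP2.proj (c t) ↔ Circle.exp s = Circle.exp t)
    (hanti : ∀ t, c (t + 2 * Real.pi) = -c t) : IsJordanCurve (range c) := by
  have hpi := Real.pi_pos
  have hinj : ∀ s t, c s = c t → |s - t| < 4 * Real.pi → s = t := fun s t hst hlt => by
    have := Circle.exp_injOn_of_sub_lt (Circle.exp_half_eq_of_antiperiodic hexp hanti hst) (by
      rw [← sub_div, abs_div, abs_two]
      linarith)
    linarith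
  have hper : Function.Periodic c (4 * Real.pi) := fun t => by
    rw [show t + 4 * Real.pi = t + 2 * Real.pi + 2 * Real.pi by ring, hanti, hanti, neg_neg]
  have hA := IsArc.of_Icc (α := c) (s := 0) (t := 2 * Real.pi) (by linarith) hc.continuousOn
    fun s hs t ht hst => hinj s t hst (by
      rw [abs_lt]; constructor <;> linarith [hs.1, hs.2, ht.1, ht.2])
  have hB := IsArc.of_Icc (α := c) (s := 2 * Real.pi) (t := 4 * Real.pi) (by linarith)
    hc.continuousOn fun s hs t ht hst => hinj s t hst (by
      rw [abs_lt]; constructor <;> linarith [hs.1, hs.2, ht.1, ht.2])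
  have h4 : c (4 * Real.pi) = c 0 := by simpa using hper 0
  rw [h4] at hB
  have hU : c '' Icc 0 (2 * Real.pi) ∪ c '' Icc (2 * Real.pi) (4 * Real.pi) = range c := by
    rw [← image_union, Icc_union_Icc_eq_Icc (by linarith) (by linarith)]
    refine subset_antisymm (image_subset_range _ _) ?_
    rintro _ ⟨t, rfl⟩
    obtain ⟨s, hs, hst⟩ := hper.exists_mem_Ico₀ (by linarith) t
    exact ⟨s, Ico_subset_Icc_self hs, hst.symm⟩
  rw [← hU]
  refine IsJordanCurve.of_arcs hA hB.symm ?_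
  rintro _ ⟨⟨s, hs, rfl⟩, t, ht, hts⟩
  by_cases hlt : t - s < 4 * Real.pi
  · have := hinj t s hts (by rw [abs_lt]; constructor <;> linarith [hs.1, hs.2, ht.1, ht.2])
    have hs2 : s = 2 * Real.pi := le_antisymm hs.2 (this ▸ ht.1)
    exact Or.inr (by rw [hs2]; rfl)
  · have hs0 : s = 0 := le_antisymm (by linarith [ht.2]) hs.1
    exact Or.inl (by rw [hs0])

/-- Two piecewise linear simple closed curves that do not bound disks and cross transversely have an
odd number of crossings. -/
theorem odd_ncard_inter {C₁ C₂ : Set RP2} (h₁ : IsSimpleClosedCurve C₁)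
    (h₂ : IsSimpleClosedCurve C₂) {S₁ S₂ : Set (UnitDisk × UnitDisk)} (hS₁ : S₁.Finite)
    (hS₂ : S₂.Finite) (hC₁ : C₁ = ⋃ s ∈ S₁, RP2.segment s.1 s.2)
    (hC₂ : C₂ = ⋃ s ∈ S₂, RP2.segment s.1 s.2) (hb₁ : ¬ BoundsDisk C₁) (hb₂ : ¬ BoundsDisk C₂)
    (htrans : IntersectOnlyTransversely C₁ C₂) : (C₁ ∩ C₂).Finite ∧ Odd (C₁ ∩ C₂).ncard := by
  obtain ⟨Λ₁, hΛ₁, hΛ₁0, hΛ₁C⟩ := exists_arrangement_of_segments hS₁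
  obtain ⟨Λ₂, hΛ₂, hΛ₂0, hΛ₂C⟩ := exists_arrangement_of_segments hS₂
  rw [← hC₁] at hΛ₁C
  rw [← hC₂] at hΛ₂C
  obtain ⟨c₁, hc₁, hr₁, he₁, hp₁⟩ := h₁.exists_lift
  obtain ⟨c₂, hc₂, hr₂, he₂, hp₂⟩ := h₂.exists_lift
  replace hp₁ := hp₁.resolve_left fun hp =>
    hb₁ (boundsDisk_of_periodic_lift h₁ hΛ₁ hΛ₁0 hΛ₁C hc₁ hr₁ he₁ hp)
  replace hp₂ := hp₂.resolve_left fun hp =>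
    hb₂ (boundsDisk_of_periodic_lift h₂ hΛ₂ hΛ₂0 hΛ₂C hc₂ hr₂ he₂ hp)
  have hmem₂ : ∀ t, RP2.proj (c₂ t) ∈ C₂ := fun t => hr₂ ▸ ⟨t, rfl⟩
  have hD : range c₁ = RP2.proj ⁻¹' C₁ := by
    ext x
    constructor
    · rintro ⟨t, rfl⟩
      exact hr₁ ▸ ⟨t, rfl⟩
    · intro hx
      rw [mem_preimage, ← hr₁] at hx
      obtain ⟨t, ht⟩ := hx
      rcases RP2.proj_eq_proj_iff.mp ht with rfl | rfl
      · exact ⟨t, rfl⟩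
      · exact ⟨_, hp₁ t⟩
  have hJ := isJordanCurve_range_of_antiperiodic hc₁ he₁ hp₁
  have hsymm : ∀ y ∈ range c₁, -y ∈ range c₁ := fun y hy => by
    rw [hD, mem_preimage] at hy ⊢
    rwa [RP2.proj_neg]
  -- a pole off both curves
  obtain ⟨N, hN₁, hN₂⟩ : ∃ N, RP2.proj N ∉ C₁ ∧ RP2.proj N ∉ C₂ := by
    have hd := (dense_compl_arrangement hΛ₁ hΛ₁0).inter_of_isOpen_left
      (dense_compl_arrangement hΛ₂ hΛ₂0) (isClosed_arrangement hΛ₁).isOpen_compl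
    obtain ⟨N, -, hN⟩ := hd.inter_open_nonempty univ isOpen_univ ⟨c₁ 0, trivial⟩
    exact ⟨N, fun h => hN.1 (hΛ₁C h), fun h => hN.2 (hΛ₂C h)⟩
  obtain ⟨ψ, ι, h⟩ := exists_isStereographic N
  have hND : N ∉ range c₁ := by rwa [hD]
  have hcN : ∀ t, c₂ t ≠ N := fun t ht => hN₂ (ht ▸ hmem₂ t)
  have hcN' : ∀ t, c₂ t ≠ -N := fun t ht => hN₂ (by
    rw [← RP2.proj_neg, ← ht]
    exact hmem₂ t)
  have hsub : range c₁ ⊆ {N}ᶜ := fun x hx hxN => hND (mem_singleton_iff.mp hxN ▸ hx)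
  have hK : IsJordanCurve (ψ '' range c₁) :=
    hJ.image (h.continuousOn.mono hsub) (h.injOn.mono hsub)
  have hψc : Continuous fun t => ψ (c₂ t) := h.continuousOn.comp_continuous hc₂ hcN
  have hloc : ∀ t ∉ c₂ ⁻¹' range c₁, ∀ᶠ s in 𝓝 t, s ∉ c₂ ⁻¹' range c₁ ∧
      (ψ (c₂ s) ∈ insideOf (ψ '' range c₁) ↔ ψ (c₂ t) ∈ insideOf (ψ '' range c₁)) := by
    intro t ht
    have htK : ψ (c₂ t) ∉ ψ '' range c₁ := by
      rintro ⟨y, hy, hyt⟩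
      have := h.injOn (hsub hy) (hcN t) hyt
      exact ht (by rwa [mem_preimage, ← this])
    rcases mem_insideOf_or htK with hin | hout
    · filter_upwards [((isOpen_insideOf hK.isCompact).preimage hψc).mem_nhds hin] with s hs
      exact ⟨fun hs' => hs.1 (mem_image_of_mem ψ hs'), iff_of_true hs hin⟩
    · have hdis := disjoint_right.mp (disjoint_insideOf_outsideOf (ψ '' range c₁))
      filter_upwards [((isOpen_outsideOf hK.isCompact).preimage hψc).mem_nhds hout] with s hs
      exact ⟨fun hs' => hs.1 (mem_image_of_mem ψ hs'), iff_of_false (hdis hs) (hdis hout)⟩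
  have hpi := Real.pi_pos
  have hinj₂ : ∀ s t, RP2.proj (c₂ s) = RP2.proj (c₂ t) → |s - t| < 2 * Real.pi → s = t :=
    fun s t hst hlt => Circle.exp_injOn_of_sub_lt ((he₂ s t).mp hst) hlt
  have hflip : ∀ t ∈ c₂ ⁻¹' range c₁, ∃ ε > 0, ∃ Q : Prop,
      (∀ s ∈ Ioo (t - ε) t, s ∉ c₂ ⁻¹' range c₁ ∧ (ψ (c₂ s) ∈ insideOf (ψ '' range c₁) ↔ Q)) ∧
      ∀ s ∈ Ioo t (t + ε), s ∉ c₂ ⁻¹' range c₁ ∧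
        (ψ (c₂ s) ∈ insideOf (ψ '' range c₁) ↔ ¬ Q) := by
    intro t ht
    refine h.exists_flip hJ hD hND hc₂ hmem₂ (δ := Real.pi / 2) (by linarith) ?_ ht
      (htrans _ ⟨?_, hmem₂ t⟩)
    · intro s hs u hu hsu
      refine hinj₂ s u (by rw [hsu]) ?_
      rw [abs_lt]
      constructor <;> linarith [hs.1, hs.2, hu.1, hu.2]
    · rw [mem_preimage, hD] at ht
      exact ht
  -- a base point off the other curve, next to a crossing if need be
  obtain ⟨a, ha⟩ : ∃ a, a ∉ c₂ ⁻¹' range c₁ := by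
    by_contra! hall
    obtain ⟨ε, hε, Q, hQ, -⟩ := hflip 0 (hall 0)
    exact (hQ (0 - ε / 2) ⟨by linarith, by linarith⟩).1 (hall _)
  have hb : a + 2 * Real.pi ∉ c₂ ⁻¹' range c₁ := fun hb => ha (by
    rw [mem_preimage, hp₂] at hb
    simpa using hsymm _ hb)
  obtain ⟨hfin, hodd⟩ := finite_and_odd_ncard_of_flips hloc hflip (by linarith) ha hb
  have hchange := h.mem_insideOf_neg_iff hJ hsymm hND ha (hcN a) (hcN' a)
  rw [hp₂, hchange] at hodd
  replace hodd := hodd.mpr (by tauto)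
  have himg : (fun t => RP2.proj (c₂ t)) '' (c₂ ⁻¹' range c₁ ∩ Icc a (a + 2 * Real.pi)) =
      C₁ ∩ C₂ := by
    ext q
    constructor
    · rintro ⟨t, ⟨ht, -⟩, rfl⟩
      rw [mem_preimage, hD] at ht
      exact ⟨ht, hmem₂ t⟩
    · rintro ⟨hq₁, hq₂⟩
      rw [← hr₂] at hq₂
      obtain ⟨t, rfl⟩ := hq₂
      have hper : Function.Periodic (fun t => RP2.proj (c₂ t)) (2 * Real.pi) := fun t => by
        simp only [hp₂, RP2.proj_neg]
      obtain ⟨s, hs, hst⟩ := hper.exists_mem_Ico (by linarith) t a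
      have hst' : RP2.proj (c₂ t) = RP2.proj (c₂ s) := hst
      refine ⟨s, ⟨?_, Ico_subset_Icc_self hs⟩, hst'.symm⟩
      rw [mem_preimage, hD, mem_preimage, ← hst']
      exact hq₁
  have hinjOn : InjOn (fun t => RP2.proj (c₂ t))
      (c₂ ⁻¹' range c₁ ∩ Icc a (a + 2 * Real.pi)) := by
    rintro s ⟨hsZ, hs⟩ t ⟨htZ, ht⟩ hst
    have hs' : s < a + 2 * Real.pi := lt_of_le_of_ne hs.2 fun h => hb (h ▸ hsZ)
    have ht' : t < a + 2 * Real.pi := lt_of_le_of_ne ht.2 fun h => hb (h ▸ htZ)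
    refine hinj₂ s t hst ?_
    rw [abs_lt]
    constructor <;> linarith [hs.1, ht.1]
  rw [← himg, hinjOn.ncard_image]
  exact ⟨hfin.image _, hodd⟩

end

/-! ### Transport along homeomorphisms -/

theorem IsSimpleClosedCurve.image_homeomorph {C : Set RP2} (h : IsSimpleClosedCurve C)
    (Φ : RP2 ≃ₜ RP2) : IsSimpleClosedCurve (Φ '' C) := by
  obtain ⟨γ, hγ, hi, rfl⟩ := h
  exact ⟨Φ ∘ γ, Φ.continuous.comp hγ, Φ.injective.comp hi, range_comp Φ γ⟩

theorem BoundsDisk.of_image_homeomorph {C : Set RP2} {Φ : RP2 ≃ₜ RP2} (h : BoundsDisk (Φ '' C)) :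
    BoundsDisk C := by
  obtain ⟨f, hf, hi, hfC⟩ := h
  refine ⟨Φ.symm ∘ f, Φ.symm.continuous.comp hf, Φ.symm.injective.comp hi, ?_⟩
  rw [image_comp, hfC, ← image_comp, Φ.symm_comp_self, image_id]

theorem IntersectOnlyTransversely.image_homeomorph {C₁ C₂ : Set RP2}
    (h : IntersectOnlyTransversely C₁ C₂) (Φ : RP2 ≃ₜ RP2) :
    IntersectOnlyTransversely (Φ '' C₁) (Φ '' C₂) := by
  rintro _ ⟨⟨p, hp₁, rfl⟩, q, hq₂, hqp⟩
  obtain rfl := Φ.injective hqp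
  obtain ⟨φ, hq, hφ0, hφ⟩ := h q ⟨hp₁, hq₂⟩
  refine ⟨Φ.symm.toOpenPartialHomeomorph.trans φ, by simpa using hq, by simpa using hφ0,
    fun y hy => ?_⟩
  have hy' : Φ.symm y ∈ φ.source := by simpa using hy
  have himg : ∀ C : Set RP2, y ∈ Φ '' C ↔ Φ.symm y ∈ C := fun C => by
    rw [Φ.image_eq_preimage_symm]
    rfl
  rw [himg, himg]
  exact hφ _ hy'

theorem mainTheorem7 (Φ : RP2 ≃ₜ RP2) (C₁ C₂ : Set RP2)
    (h₁ : IsOneHomologousCycle Φ C₁) (h₂ : IsOneHomologousCycle Φ C₂)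
    (hne : C₁ ≠ C₂) (htrans : IntersectOnlyTransversely C₁ C₂) :
    (C₁ ∩ C₂).Finite ∧ Odd (C₁ ∩ C₂).ncard := by
  obtain ⟨⟨hs₁, S₁, hS₁, hC₁⟩, hb₁⟩ := h₁
  obtain ⟨⟨hs₂, S₂, hS₂, hC₂⟩, hb₂⟩ := h₂
  have h := odd_ncard_inter (hs₁.image_homeomorph Φ) (hs₂.image_homeomorph Φ) hS₁ hS₂ hC₁ hC₂
    (fun hb => hb₁ hb.of_image_homeomorph) (fun hb => hb₂ hb.of_image_homeomorph)
    (htrans.image_homeomorph Φ)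
  rwa [← image_inter Φ.injective, ncard_image_of_injective _ Φ.injective,
    finite_image_iff Φ.injective.injOn] at h
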